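/- Let $K\subset\mathbb R^3$ be a (tame) knot, and let $g(K)$ be its genus, the minimum genus of a compact connected orientable (tame) surface in $\mathbb R^3$ with boundary $K$. The length of a braid word in the generators $\sigma_1^{\pm1},\dots,\sigma_{n-1}^{\pm1}$ of the braid group $B_n$ is its number of letters (the number of crossings), and an $n$-braid represents $K$ if its closure is ambient isotopic to $K$. Let $br(K)$ be the braid index of $K$, the minimum number of strands of a braid representing $K$. For every integer $n\ge br(K)$ there is an $n$-braid representing $K$; let $b_n(K)$ be the minimum length of such a braid, and put $b_n'(K)=b_n(K)-n$. Then the function $n\mapsto b_n'(K)$ on $\{n\in\mathbb N: n\ge br(K)\}$ has the following properties: 1. it is nonincreasing, that is, $b_m'(K)\le b_n'(K)$ whenever $m\ge n\ge br(K)$; 2. $b_n'(K)\equiv 1 \pmod 2$ for all $n\ge br(K)$; 3. $b_n'(K)\ge 2g(K)-1$ for all $n\ge br(K)$. -/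

import Mathlib

noncomputable section

namespace BraidLength

/-- Three-dimensional space, with coordinates `![x, y, z]`. -/
abbrev R3 : Type := Fin 3 → ℝ

/-! ### Knots and isotopy -/

/-- `A` can be carried onto `B` by an ambient isotopy of `ℝ³`. -/
def AmbientIsotopic (A B : Set R3) : Prop :=
  ∃ F : unitInterval → (R3 ≃ₜ R3),
    Continuous (fun p : unitInterval × R3 => F p.1 p.2) ∧
    (∀ x, F 0 x = x) ∧ F 1 '' A = B

/-- `P` is a simple closed polygon with `m ≥ 3` vertices. -/
def IsSimpleClosedPolygon (P : Set R3) : Prop :=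
  ∃ m : ℕ, 3 ≤ m ∧ ∃ v : ZMod m → R3, Function.Injective v ∧
    (∀ i j, i ≠ j →
      segment ℝ (v i) (v (i + 1)) ∩ segment ℝ (v j) (v (j + 1)) ⊆
        {v i, v (i + 1)} ∩ {v j, v (j + 1)}) ∧
    P = ⋃ i, segment ℝ (v i) (v (i + 1))

/-- A (tame) knot: a subset of `ℝ³` that some homeomorphism of `ℝ³` carries onto a simple closed
polygon. -/
def IsKnot (K : Set R3) : Prop :=
  ∃ h : R3 ≃ₜ R3, IsSimpleClosedPolygon (h '' K)

/-! ### Braid words and their closures -/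

/-- Words in the generators `σ₁^±1, …, σ_{n-1}^±1` of the braid group on `n` strands.
The letter `(i, true)` is `σ_{i+1}` and `(i, false)` is its inverse. -/
abbrev BraidWord (n : ℕ) : Type := List (Fin (n - 1) × Bool)

/-- A point of `ℝ³`. -/
def pt (x y z : ℝ) : R3 := ![x, y, z]

/-- The part of the braid in the column `k ≤ x ≤ k + 1` that realizes one letter. The `n` strands
start and end at the heights `0, …, n - 1` in the plane `y = 0`. The strands at heights `i` and
`i + 1` are interchanged, the rising one passing on the side `y = 1` (and the falling one on the
side `y = -1`) for `σ_{i+1}`, and the other way round for the inverse; all others are straight. -/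
def crossingColumn (n k : ℕ) (a : Fin (n - 1) × Bool) : Set R3 :=
  let i : ℕ := a.1
  let ε : ℝ := if a.2 then 1 else -1
  (⋃ j ∈ {j : ℕ | j < n ∧ j ≠ i ∧ j ≠ i + 1}, segment ℝ (pt k 0 j) (pt (k + 1) 0 j)) ∪
  (segment ℝ (pt k 0 i) (pt (k + 1 / 2) ε (i + 1 / 2)) ∪
    segment ℝ (pt (k + 1 / 2) ε (i + 1 / 2)) (pt (k + 1) 0 (i + 1))) ∪
  (segment ℝ (pt k 0 (i + 1)) (pt (k + 1 / 2) (-ε) (i + 1 / 2)) ∪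
    segment ℝ (pt (k + 1 / 2) (-ε) (i + 1 / 2)) (pt (k + 1) 0 i))

/-- The arc in the plane `z = j` that joins the end `(c, 0, j)` of a braid with `c` letters to its
start `(0, 0, j)`, going around the braid axis `x = 1/2, y = -3/2`. -/
def closingArc (c j : ℕ) : Set R3 :=
  segment ℝ (pt c 0 j) (pt (c + 1) 0 j) ∪ segment ℝ (pt (c + 1) 0 j) (pt (c + 1) (-2) j) ∪
  segment ℝ (pt (c + 1) (-2) j) (pt 0 (-2) j) ∪ segment ℝ (pt 0 (-2) j) (pt 0 0 j)

/-- The closure of a braid word on `n` strands, as a closed braid around the axis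
`x = 1/2, y = -3/2`. -/
def closedBraid {n : ℕ} (w : BraidWord n) : Set R3 :=
  (⋃ k : Fin w.length, crossingColumn n k (w.get k)) ∪ ⋃ j : Fin n, closingArc w.length j

/-- The `n`-braid given by the word `w` represents `K`. -/
def Represents {n : ℕ} (w : BraidWord n) (K : Set R3) : Prop :=
  AmbientIsotopic (closedBraid w) K

/-- The braid index `br(K)`: the minimum number of strands of a braid representing `K`
(with the convention `⊤` for a set that no braid represents). -/
def braidIndex (K : Set R3) : ℕ∞ :=
  ⨅ n ∈ {n : ℕ | ∃ w : BraidWord n, Represents w K}, (n : ℕ∞)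

/-- The lengths (numbers of crossings) of the `n`-braids representing `K`. -/
def lengthSet (n : ℕ) (K : Set R3) : Set ℕ :=
  {c | ∃ w : BraidWord n, w.length = c ∧ Represents w K}

/-- `b_n(K)`: the minimum length of an `n`-braid representing `K`. -/
def b (n : ℕ) (K : Set R3) : ℕ := sInf (lengthSet n K)

/-- `b_n'(K) = b_n(K) - n`. -/
def b' (n : ℕ) (K : Set R3) : ℤ := (b n K : ℤ) - n

/-! ### Seifert surfaces and the genus -/

/-- The `d`-dimensional simplices. -/
def simplices (T : Geometry.SimplicialComplex ℝ R3) (d : ℕ) : Set (Finset R3) :=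
  {s | s ∈ T.faces ∧ s.card = d + 1}

/-- The triangles that contain the simplex `e`. -/
def trianglesAt (T : Geometry.SimplicialComplex ℝ R3) (e : Finset R3) : Set (Finset R3) :=
  {t | t ∈ simplices T 2 ∧ e ⊆ t}

/-- An orientation of all triangles such that any two triangles with a common edge induce
opposite directions on it. Here `o t a b` says that the boundary of the oriented triangle `t`
runs along its edge `ab` from `a` to `b`. -/
def IsOrientable (T : Geometry.SimplicialComplex ℝ R3) : Prop :=
  ∃ o : Finset R3 → R3 → R3 → Prop,
    (∀ t ∈ simplices T 2, ∀ a ∈ t, ∀ b ∈ t, ∀ c ∈ t, a ≠ b → b ≠ c → a ≠ c →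
      (o t a b ↔ o t b c) ∧ (o t a b ↔ ¬ o t b a)) ∧
    (∀ t ∈ simplices T 2, ∀ t' ∈ simplices T 2, t ≠ t' →
      ∀ a b, a ≠ b → a ∈ t → b ∈ t → a ∈ t' → b ∈ t' → (o t a b ↔ o t' b a))

/-- The complex triangulates a compact connected orientable surface with (possibly empty)
boundary. -/
structure IsSurface (T : Geometry.SimplicialComplex ℝ R3) : Prop where
  finite : T.faces.Finite
  /-- Every simplex is a face of a triangle. -/
  pure : ∀ s ∈ T.faces, ∃ t ∈ simplices T 2, s ⊆ t
  /-- Every edge lies in one or two triangles. -/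
  edge : ∀ e ∈ simplices T 1, (trianglesAt T e).ncard = 1 ∨ (trianglesAt T e).ncard = 2
  /-- The link of every vertex is connected (so that it is an arc or a circle): one gets from any
  triangle at `v` to any other one through triangles at `v`, crossing edges at `v`. -/
  link : ∀ v ∈ T.vertices, ∀ s ∈ trianglesAt T {v}, ∀ t ∈ trianglesAt T {v},
    Relation.ReflTransGen
      (fun s' t' => ∃ e ∈ simplices T 1, v ∈ e ∧ s' ∈ trianglesAt T e ∧ t' ∈ trianglesAt T e) s t
  connected : IsConnected T.space
  orientable : IsOrientable T

/-- The boundary of a triangulated surface: the union of the edges lying in only one triangle. -/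
def boundary (T : Geometry.SimplicialComplex ℝ R3) : Set R3 :=
  ⋃ e ∈ {e | e ∈ simplices T 1 ∧ (trianglesAt T e).ncard = 1}, convexHull ℝ (e : Set R3)

/-- The Euler characteristic of a triangulated surface. -/
def eulerChar (T : Geometry.SimplicialComplex ℝ R3) : ℤ :=
  (simplices T 0).ncard - (simplices T 1).ncard + (simplices T 2).ncard

/-- `S` is a (tame) Seifert surface of genus `g` for the knot `K`: some homeomorphism of `ℝ³`
carries `S` onto a polyhedral compact connected orientable surface and `K` onto its boundary.
As there is one boundary component, the genus is given by `χ(S) = 1 - 2g`. -/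
def IsSeifertSurface (S K : Set R3) (g : ℕ) : Prop :=
  ∃ (h : R3 ≃ₜ R3) (T : Geometry.SimplicialComplex ℝ R3),
    IsSurface T ∧ h '' S = T.space ∧ h '' K = boundary T ∧ eulerChar T = 1 - 2 * (g : ℤ)

/-- The genus of a knot: the minimum genus of its Seifert surfaces. -/
def genus (K : Set R3) : ℕ := sInf {g | ∃ S, IsSeifertSurface S K g}

end BraidLength

end

noncomputable section

namespace BraidLength

/-! ### Ambient isotopies -/

/-! Monotonicity comes from Markov stabilization: one more strand and one more letter give a word
with an isotopic closure, so `b (n + 1) K ≤ b n K + 1` and `b'` cannot increase. The same move turns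
a representative on `m` strands into one on every `n ≥ m` strands. As the hypothesis `braidIndex K ≤
n` already provides a word on some `m ≤ n` strands, Alexander's theorem is not needed.

The other two claims hold for every word with `c` letters on `n` strands that represents `K`, hence
for a shortest one. They use only that a knot is connected, so that the permutation of the strands
has a single orbit. For the parity, an `n`-cycle has the sign `(-1)^(n-1)`, whereas a product of `c`
transpositions has the sign `(-1)^c`. For the genus, the closed braid bounds the surface of
Seifert's algorithm, `n` stacked disks joined by `c` half-twisted bands. It is orientable with `χ =
n - c`, and it is connected because every generator occurs in the word: otherwise the strands at
heights `≤ j`, for a missing generator `j`, would form an invariant set. Thus `c - n = 2g - 1` for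
the genus `g` of this surface.

Two geometric constructions carry this. `ambientIsotopic_stabilize` realizes the stabilization by
explicit homeomorphisms of space: a segment of the top strand is lifted, the horizontal planes are
turned and stretched by similarities until its ends lie over the desired arc, and the result is
flattened. `Crossings.surface` is an explicit triangulation; its triangles are shown to meet in
common faces (`glue_vert`) by separating planes, and `boundary_surface` identifies its boundary with
the closed braid. -/

theorem AmbientIsotopic.trans {A B C : Set R3} (h₁ : AmbientIsotopic A B)
    (h₂ : AmbientIsotopic B C) : AmbientIsotopic A C := by
  obtain ⟨F, hF, hF0, hF1⟩ := h₁
  obtain ⟨G, hG, hG0, hG1⟩ := h₂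
  refine ⟨fun t => (F t).trans (G t), ?_, fun x => by simp [hF0, hG0], ?_⟩
  · exact hG.comp (continuous_fst.prodMk hF)
  · rw [← hG1, ← hF1, Set.image_image]
    rfl

theorem AmbientIsotopic.symm {A B : Set R3} (h : AmbientIsotopic A B) : AmbientIsotopic B A := by
  obtain ⟨F, hF, hF0, hF1⟩ := h
  -- The reversed isotopy starts at `F 1`; precomposing with the inverse of `F 1` makes it start at
  -- the identity.
  refine ⟨fun t => (F 1).symm.trans (F (unitInterval.symm t)), ?_, fun x => by simp, ?_⟩
  · exact hF.comp ((unitInterval.continuous_symm.comp continuous_fst).prodMk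
      ((F 1).symm.continuous.comp continuous_snd))
  · rw [← hF1, Set.image_image]
    simp [hF0]

/-- A continuous family of self-maps of `ℝ³` starting at the identity, with continuous inverses,
is an ambient isotopy. -/
theorem ambientIsotopic_image (f g : ℝ → R3 → R3)
    (hf : Continuous fun p : unitInterval × R3 => f p.1 p.2)
    (hg : ∀ t ∈ Set.Icc (0 : ℝ) 1, Continuous (g t))
    (hgf : ∀ t ∈ Set.Icc (0 : ℝ) 1, ∀ x, g t (f t x) = x)
    (hfg : ∀ t ∈ Set.Icc (0 : ℝ) 1, ∀ x, f t (g t x) = x)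
    (h0 : ∀ x, f 0 x = x) (A : Set R3) : AmbientIsotopic A (f 1 '' A) := by
  refine ⟨fun t =>
    { toFun := f t
      invFun := g t
      left_inv := hgf t t.2
      right_inv := hfg t t.2
      continuous_toFun := hf.comp (continuous_const.prodMk continuous_id)
      continuous_invFun := hg t t.2 }, hf, fun x => by simpa using h0 x, ?_⟩
  simp

/-! ### Points and segments -/

@[simp] theorem pt_zero (x y z : ℝ) : pt x y z 0 = x := rfl
@[simp] theorem pt_one (x y z : ℝ) : pt x y z 1 = y := rfl
@[simp] theorem pt_two (x y z : ℝ) : pt x y z 2 = z := rfl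

theorem R3_ext {p q : R3} (h0 : p 0 = q 0) (h1 : p 1 = q 1) (h2 : p 2 = q 2) : p = q := by
  ext i; fin_cases i <;> assumption

theorem mem_segment_iff {p a b : R3} : p ∈ segment ℝ a b ↔
    ∃ t : ℝ, 0 ≤ t ∧ t ≤ 1 ∧ p = pt (a 0 + t * (b 0 - a 0)) (a 1 + t * (b 1 - a 1))
      (a 2 + t * (b 2 - a 2)) := by
  rw [segment_eq_image']
  constructor
  · rintro ⟨t, ⟨h0, h1⟩, rfl⟩
    exact ⟨t, h0, h1, R3_ext (by simp) (by simp) (by simp)⟩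
  · rintro ⟨t, h0, h1, rfl⟩
    exact ⟨t, ⟨h0, h1⟩, R3_ext (by simp) (by simp) (by simp)⟩

theorem segment_along_x {a b : ℝ} (h : a ≤ b) (y z : ℝ) :
    segment ℝ (pt a y z) (pt b y z) = (fun x => pt x y z) '' Set.Icc a b := by
  ext p
  rw [mem_segment_iff]
  constructor
  · rintro ⟨t, h0, h1, rfl⟩
    refine ⟨a + t * (b - a), ⟨by nlinarith, by nlinarith⟩, by simp⟩
  · rintro ⟨x, ⟨h0, h1⟩, rfl⟩
    rcases eq_or_lt_of_le h with rfl | hab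
    · exact ⟨0, le_rfl, zero_le_one, R3_ext (by simp; linarith) (by simp) (by simp)⟩
    · have : 0 < b - a := by linarith
      refine ⟨(x - a) / (b - a), by apply div_nonneg <;> linarith,
        by rw [div_le_one this]; linarith, R3_ext ?_ (by simp) (by simp)⟩
      simp; field_simp; ring

theorem segment_along_x_union {a b c : ℝ} (hab : a ≤ b) (hbc : b ≤ c) (y z : ℝ) :
    segment ℝ (pt a y z) (pt b y z) ∪ segment ℝ (pt b y z) (pt c y z) =
      segment ℝ (pt a y z) (pt c y z) := by
  rw [segment_along_x hab, segment_along_x hbc, segment_along_x (hab.trans hbc), ← Set.image_union,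
    Set.Icc_union_Icc_eq_Icc hab hbc]

/-- A map that is affine on a segment maps it onto the segment between the image points. -/
theorem image_segment_of_affine {f : R3 → R3} {a b a' b' : R3}
    (h : ∀ t : ℝ, 0 ≤ t → t ≤ 1 → f (pt (a 0 + t * (b 0 - a 0)) (a 1 + t * (b 1 - a 1))
      (a 2 + t * (b 2 - a 2))) = pt (a' 0 + t * (b' 0 - a' 0)) (a' 1 + t * (b' 1 - a' 1))
      (a' 2 + t * (b' 2 - a' 2))) : f '' segment ℝ a b = segment ℝ a' b' := by
  ext p
  rw [mem_segment_iff]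
  constructor
  · rintro ⟨q, hq, rfl⟩
    obtain ⟨t, h0, h1, rfl⟩ := mem_segment_iff.1 hq
    exact ⟨t, h0, h1, h t h0 h1⟩
  · rintro ⟨t, h0, h1, rfl⟩
    exact ⟨_, mem_segment_iff.2 ⟨t, h0, h1, rfl⟩, h t h0 h1⟩

/-! ### Stretching a line -/

/-- The nearest point of the unit interval. -/
def clamp (x : ℝ) : ℝ := max 0 (min x 1)

theorem continuous_clamp : Continuous clamp := by unfold clamp; fun_prop

theorem clamp_of_nonpos {x : ℝ} (h : x ≤ 0) : clamp x = 0 := by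
  unfold clamp; rw [max_eq_left]; exact (min_le_left _ _).trans h

theorem clamp_of_one_le {x : ℝ} (h : 1 ≤ x) : clamp x = 1 := by
  unfold clamp; rw [min_eq_right h, max_eq_right zero_le_one]

theorem clamp_of_mem {x : ℝ} (h0 : 0 ≤ x) (h1 : x ≤ 1) : clamp x = x := by
  unfold clamp; rw [min_eq_left h1, max_eq_right h0]

theorem clamp_nonneg (x : ℝ) : 0 ≤ clamp x := le_max_left _ _

/-- The map of the line that stretches `[a, a + 1]` by the factor `1 + τ`. -/
def stretch (τ a x : ℝ) : ℝ := x + τ * clamp (x - a)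

/-- The inverse of `stretch`. -/
def unstretch (τ a x : ℝ) : ℝ := x - τ * clamp ((x - a) / (1 + τ))

theorem unstretch_stretch {τ : ℝ} (hτ : 0 ≤ τ) (a x : ℝ) :
    unstretch τ a (stretch τ a x) = x := by
  have h1 : 0 < 1 + τ := by linarith
  unfold unstretch stretch
  rcases le_total (x - a) 0 with h | h
  · rw [clamp_of_nonpos h, clamp_of_nonpos]
    · simp
    · exact div_nonpos_of_nonpos_of_nonneg (by linarith) h1.le
  rcases le_total (x - a) 1 with h' | h'
  · rw [clamp_of_mem h h']
    have : (x + τ * (x - a) - a) / (1 + τ) = x - a := by field_simp; ring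
    rw [this, clamp_of_mem h h']; ring
  · rw [clamp_of_one_le h', clamp_of_one_le]
    · ring
    · rw [one_le_div h1]; linarith

theorem stretch_unstretch {τ : ℝ} (hτ : 0 ≤ τ) (a x : ℝ) :
    stretch τ a (unstretch τ a x) = x := by
  have h1 : 0 < 1 + τ := by linarith
  unfold unstretch stretch
  obtain ⟨y, hy⟩ : ∃ y, (x - a) / (1 + τ) = y := ⟨_, rfl⟩
  have hx : x - a = y * (1 + τ) := by rw [← hy]; field_simp
  rw [hy]
  rcases le_total y 0 with h | h
  · rw [clamp_of_nonpos h, clamp_of_nonpos]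
    · ring
    · nlinarith
  rcases le_total y 1 with h' | h'
  · rw [clamp_of_mem h h']
    have : x - τ * y - a = y := by linarith
    rw [this, clamp_of_mem h h']; ring
  · rw [clamp_of_one_le h', clamp_of_one_le]
    · ring
    · nlinarith

theorem stretch_of_le {τ a x : ℝ} (h : x ≤ a) : stretch τ a x = x := by
  rw [stretch, clamp_of_nonpos (by linarith)]; ring

theorem stretch_of_ge {τ a x : ℝ} (h : a + 1 ≤ x) : stretch τ a x = x + τ := by
  rw [stretch, clamp_of_one_le (by linarith)]; ring

theorem stretch_zero (a x : ℝ) : stretch 0 a x = x := by simp [stretch]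

theorem monotone_stretch {τ : ℝ} (hτ : 0 ≤ τ) (a : ℝ) : Monotone (stretch τ a) := by
  intro x y h
  have : clamp (x - a) ≤ clamp (y - a) := by unfold clamp; gcongr
  unfold stretch; gcongr

theorem image_stretch_Icc {τ : ℝ} (hτ : 0 ≤ τ) (a x y : ℝ) :
    stretch τ a '' Set.Icc x y = Set.Icc (stretch τ a x) (stretch τ a y) := by
  have hm : StrictMono (stretch τ a) := (monotone_stretch hτ a).strictMono_of_injective
    (Function.LeftInverse.injective (unstretch_stretch hτ a))
  ext z
  constructor
  · rintro ⟨w, ⟨h1, h2⟩, rfl⟩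
    exact ⟨hm.monotone h1, hm.monotone h2⟩
  · rintro ⟨h1, h2⟩
    rw [← stretch_unstretch hτ a z] at h1 h2
    exact ⟨_, ⟨hm.le_iff_le.1 h1, hm.le_iff_le.1 h2⟩, stretch_unstretch hτ a z⟩

@[fun_prop] theorem Continuous.stretch {X : Type*} [TopologicalSpace X] {f g h : X → ℝ}
    (hf : Continuous f) (hg : Continuous g) (hh : Continuous h) :
    Continuous fun x => stretch (f x) (g x) (h x) :=
  hh.add (hf.mul (continuous_clamp.comp (hh.sub hg)))

theorem continuous_unstretch {X : Type*} [TopologicalSpace X] {f g h : X → ℝ}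
    (hf : Continuous f) (hf0 : ∀ x, 0 ≤ f x) (hg : Continuous g) (hh : Continuous h) :
    Continuous fun x => unstretch (f x) (g x) (h x) :=
  hh.sub (hf.mul (continuous_clamp.comp ((hh.sub hg).div (continuous_const.add hf)
    fun x => by linarith [hf0 x])))

@[fun_prop] theorem Continuous.pt {X : Type*} [TopologicalSpace X] {f g h : X → ℝ}
    (hf : Continuous f) (hg : Continuous g) (hh : Continuous h) :
    Continuous fun x => pt (f x) (g x) (h x) := by
  refine continuous_pi fun i => ?_
  fin_cases i <;> assumption

/-! ### The loop added by a stabilization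

The segment from `(c, 0, m)` to `(c + 1, 0, m)` is deformed into the arc that a stabilization puts
in its place. The isotopy moves nothing at heights `≤ m` outside a small neighbourhood of the
segment. -/

/-- The height profile used to lift the segment. -/
def bump (c x y : ℝ) : ℝ := clamp (min (3 * (x - c)) (3 * (c + 1 - x))) * clamp (1 - |y|)

theorem bump_nonneg (c x y : ℝ) : 0 ≤ bump c x y := mul_nonneg (clamp_nonneg _) (clamp_nonneg _)

theorem continuous_bump (c : ℝ) : Continuous fun p : R3 => bump c (p 0) (p 1) := by
  unfold bump
  exact (continuous_clamp.comp (by fun_prop)).mul (continuous_clamp.comp (by fun_prop))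

/-- Lift a neighbourhood of the segment. -/
def liftMap (c m t : ℝ) (p : R3) : R3 :=
  pt (p 0) (p 1) (stretch (t * (3 * bump c (p 0) (p 1))) (m - 1) (p 2))

/-- On each vertical line this is a stretch of the interval from `m - 1` to `m`, with an amount
depending continuously on the line, so it is inverted line by line. Heights `≤ m - 1` stay fixed,
and everything above `m` is only shifted. -/
theorem ambientIsotopic_liftMap (c m : ℝ) (A : Set R3) :
    AmbientIsotopic A (liftMap c m 1 '' A) := by
  have hb : Continuous fun p : R3 => 3 * bump c (p 0) (p 1) :=
    continuous_const.mul (continuous_bump c)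
  have h0 : ∀ t ∈ Set.Icc (0 : ℝ) 1, ∀ p : R3, 0 ≤ t * (3 * bump c (p 0) (p 1)) := fun t ht p =>
    mul_nonneg ht.1 (mul_nonneg (by norm_num) (bump_nonneg _ _ _))
  refine ambientIsotopic_image (liftMap c m)
    (fun t p => pt (p 0) (p 1) (unstretch (t * (3 * bump c (p 0) (p 1))) (m - 1) (p 2)))
    ?_ ?_ ?_ ?_ ?_ A
  · unfold liftMap
    refine Continuous.pt (by fun_prop) (by fun_prop) (Continuous.stretch ?_ (by fun_prop)
      (by fun_prop))
    exact (continuous_subtype_val.comp continuous_fst).mul (hb.comp continuous_snd)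
  · intro t ht
    exact Continuous.pt (by fun_prop) (by fun_prop)
      (continuous_unstretch (continuous_const.mul hb) (h0 t ht) (by fun_prop) (by fun_prop))
  · intro t ht p
    apply R3_ext <;> simp [liftMap, unstretch_stretch (h0 t ht p)]
  · intro t ht p
    apply R3_ext <;> simp [liftMap, stretch_unstretch (h0 t ht p)]
  · intro p
    apply R3_ext <;> simp [liftMap, stretch_zero]

/-- The first coordinate, relative to the midpoint of the segment, of the first end of the lifted arc
at height `s`. -/
def firstX (s : ℝ) : ℝ := min s 1 - 1 / 2 + min (3 / 2 * max (s - 1) 0) 1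

/-- The second coordinate of the first end of the lifted arc at height `s`. -/
def firstY (s : ℝ) : ℝ :=
  2 * min (min s 1) (1 - min s 1) - max (3 / 2 * max (s - 1) 0 - 1) 0

/-- The first coordinate, relative to the midpoint of the segment, of the second end of the lifted
arc at height `s`. -/
def secondX (c s : ℝ) : ℝ := 1 / 2 - min s 1 - min ((c + 2) / 2 * max (s - 1) 0) c

/-- The second coordinate of the second end of the lifted arc at height `s`. -/
def secondY (c s : ℝ) : ℝ :=
  -(2 * min (min s 1) (1 - min s 1)) - max ((c + 2) / 2 * max (s - 1) 0 - c) 0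

section ends

variable {c s : ℝ}

/-- Up to height `1` the two ends make a half turn about each other, along opposite halves of the
diamond with corners `(±1/2, 0)` and `(0, ±1)`. This is the new crossing. -/
theorem firstX_of_le (h1 : s ≤ 1) : firstX s = s - 1 / 2 := by
  simp only [firstX, min_eq_left h1, max_eq_right (sub_nonpos.2 h1)]
  norm_num

theorem firstY_of_le (h1 : s ≤ 1) : firstY s = 2 * min s (1 - s) := by
  simp only [firstY, min_eq_left h1, max_eq_right (sub_nonpos.2 h1)]
  norm_num

theorem secondX_of_le (hc : 0 ≤ c) (h1 : s ≤ 1) : secondX c s = 1 / 2 - s := by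
  simp only [secondX, min_eq_left h1, max_eq_right (sub_nonpos.2 h1), mul_zero, min_eq_left hc]
  ring

theorem secondY_of_le (hc : 0 ≤ c) (h1 : s ≤ 1) : secondY c s = -(2 * min s (1 - s)) := by
  simp only [secondY, min_eq_left h1, max_eq_right (sub_nonpos.2 h1), mul_zero, zero_sub,
    max_eq_right (neg_nonpos.2 hc), sub_zero]

/-- Between the heights `1` and `3` the ends travel along the future closing arc: the first one goes
`1` to the right and then `2` in the direction of `-y`, the second one `c` to the left and then `2`
in that direction. The speeds `3/2` and `(c + 2)/2` make both arrive at height `3`. -/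
theorem firstX_of_ge (h1 : 1 ≤ s) : firstX s = 1 / 2 + min (3 / 2 * (s - 1)) 1 := by
  simp only [firstX, min_eq_right h1, max_eq_left (sub_nonneg.2 h1)]
  norm_num

theorem firstY_of_ge (h1 : 1 ≤ s) : firstY s = -max (3 / 2 * (s - 1) - 1) 0 := by
  simp only [firstY, min_eq_right h1, max_eq_left (sub_nonneg.2 h1)]
  norm_num

theorem secondX_of_ge (h1 : 1 ≤ s) :
    secondX c s = -(1 / 2) - min ((c + 2) / 2 * (s - 1)) c := by
  simp only [secondX, min_eq_right h1, max_eq_left (sub_nonneg.2 h1)]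
  norm_num

theorem secondY_of_ge (h1 : 1 ≤ s) : secondY c s = -max ((c + 2) / 2 * (s - 1) - c) 0 := by
  simp only [secondY, min_eq_right h1, max_eq_left (sub_nonneg.2 h1)]
  norm_num

end ends

/-- The complex number whose multiplication stretches and rotates the horizontal plane at height
`s` so that the ends of the lifted arc get the right distance and direction: real part. -/
def twistRe (c s : ℝ) : ℝ := (secondX c s - firstX s) / (2 * (1 / 2 - s / 9))

/-- The complex number whose multiplication stretches and rotates the horizontal plane at height
`s` so that the ends of the lifted arc get the right distance and direction: imaginary part. -/
def twistIm (c s : ℝ) : ℝ := (secondY c s - firstY s) / (2 * (1 / 2 - s / 9))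

/-- The similarity is invertible because the two ends never coincide. Up to height `1` their first
coordinates agree only for `s = 1/2`, where the second ones are `1` and `-1`; above it the first
coordinates are at least `1/2` and at most `-1/2`, respectively. -/
theorem twist_ne_zero {c s : ℝ} (hc : 0 ≤ c) (h3 : s ≤ 3) :
    twistRe c s ^ 2 + twistIm c s ^ 2 ≠ 0 := by
  have hw : 2 * (1 / 2 - s / 9) ≠ 0 := by linarith
  intro h
  have h1 : twistRe c s = 0 := by nlinarith [sq_nonneg (twistRe c s), sq_nonneg (twistIm c s)]
  have h2 : twistIm c s = 0 := by nlinarith [sq_nonneg (twistRe c s), sq_nonneg (twistIm c s)]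
  rw [twistRe, div_eq_zero_iff, or_iff_left hw] at h1
  rw [twistIm, div_eq_zero_iff, or_iff_left hw] at h2
  rcases le_total s 1 with hs | hs
  · rw [firstX_of_le hs, secondX_of_le hc hs] at h1
    rw [firstY_of_le hs, secondY_of_le hc hs] at h2
    have : s = 1 / 2 := by linarith
    subst this
    norm_num at h2
  · rw [firstX_of_ge hs, secondX_of_ge hs] at h1
    have h4 : 0 ≤ min (3 / 2 * (s - 1)) 1 := le_min (by linarith) zero_le_one
    have h5 : 0 ≤ min ((c + 2) / 2 * (s - 1)) c := le_min (by nlinarith) hc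
    linarith

/-- The height above `m`, cut off at `0` and `3`. -/
def cutHeight (s : ℝ) : ℝ := max 0 (min s 3)

theorem cutHeight_of_mem {s : ℝ} (h0 : 0 ≤ s) (h3 : s ≤ 3) : cutHeight s = s := by
  rw [cutHeight, min_eq_left h3, max_eq_right h0]

theorem cutHeight_of_nonpos {s : ℝ} (h : s ≤ 0) : cutHeight s = 0 := by
  rw [cutHeight, max_eq_left]; exact (min_le_left _ _).trans h

theorem cutHeight_le (s : ℝ) : cutHeight s ≤ 3 := max_le (by norm_num) (min_le_right _ _)

/-- Move the horizontal planes above the height `m` by similarities. -/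
def twistMap (c m t : ℝ) (p : R3) : R3 :=
  let s := cutHeight (t * (p 2 - m))
  pt (c + 1 / 2 + (firstX s + secondX c s) / 2 +
      (twistRe c s * (p 0 - (c + 1 / 2)) - twistIm c s * p 1))
    ((firstY s + secondY c s) / 2 + (twistRe c s * p 1 + twistIm c s * (p 0 - (c + 1 / 2)))) (p 2)

/-- The inverse of `twistMap`. -/
def untwistMap (c m t : ℝ) (p : R3) : R3 :=
  let s := cutHeight (t * (p 2 - m))
  let x := p 0 - (c + 1 / 2 + (firstX s + secondX c s) / 2)
  let y := p 1 - (firstY s + secondY c s) / 2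
  pt (c + 1 / 2 + (twistRe c s * x + twistIm c s * y) / (twistRe c s ^ 2 + twistIm c s ^ 2))
    ((twistRe c s * y - twistIm c s * x) / (twistRe c s ^ 2 + twistIm c s ^ 2)) (p 2)

theorem continuous_firstX : Continuous firstX := by unfold firstX; fun_prop
theorem continuous_firstY : Continuous firstY := by unfold firstY; fun_prop
theorem continuous_secondX (c : ℝ) : Continuous (secondX c) := by unfold secondX; fun_prop
theorem continuous_secondY (c : ℝ) : Continuous (secondY c) := by unfold secondY; fun_prop
theorem continuous_cutHeight : Continuous cutHeight := by unfold cutHeight; fun_prop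

/-- The denominator is the distance `1 - 2s/9` between the lifted ends before the twist, which is at
least `1/3` thanks to the cut-off at `3`. -/
theorem cutHeight_half_width_ne (s : ℝ) : 2 * (1 / 2 - cutHeight s / 9) ≠ 0 := by
  linarith [cutHeight_le s]

theorem continuous_twistRe (c : ℝ) : Continuous fun s => twistRe c (cutHeight s) :=
  (((continuous_secondX c).comp continuous_cutHeight).sub
    (continuous_firstX.comp continuous_cutHeight)).div
    (by have := continuous_cutHeight; fun_prop) cutHeight_half_width_ne

theorem continuous_twistIm (c : ℝ) : Continuous fun s => twistIm c (cutHeight s) :=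
  (((continuous_secondY c).comp continuous_cutHeight).sub
    (continuous_firstY.comp continuous_cutHeight)).div
    (by have := continuous_cutHeight; fun_prop) cutHeight_half_width_ne

/-- At height `0` the prescribed ends are the actual ones, so the similarity is the identity. This
makes the twist start at the identity at time `0` and fix everything at or below the height `m`. -/
theorem twistMap_of_cutHeight {c m t : ℝ} (hc : 0 ≤ c) {p : R3}
    (h : cutHeight (t * (p 2 - m)) = 0) : twistMap c m t p = p := by
  have h1 : twistRe c 0 = 1 := by
    rw [twistRe, firstX_of_le zero_le_one, secondX_of_le hc zero_le_one]; norm_num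
  have h2 : twistIm c 0 = 0 := by
    rw [twistIm, firstY_of_le zero_le_one, secondY_of_le hc zero_le_one]; norm_num
  simp only [twistMap, h, h1, h2, firstX_of_le zero_le_one, secondX_of_le hc zero_le_one,
    firstY_of_le zero_le_one, secondY_of_le hc zero_le_one]
  apply R3_ext <;> simp

theorem ambientIsotopic_twistMap {c : ℝ} (hc : 0 ≤ c) (m : ℝ) (A : Set R3) :
    AmbientIsotopic A (twistMap c m 1 '' A) := by
  have e1 := continuous_firstX.comp continuous_cutHeight
  have e2 := continuous_firstY.comp continuous_cutHeight
  have e3 := (continuous_secondX c).comp continuous_cutHeight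
  have e4 := (continuous_secondY c).comp continuous_cutHeight
  have e5 := continuous_twistRe c
  have e6 := continuous_twistIm c
  have ne : ∀ s, twistRe c (cutHeight s) ^ 2 + twistIm c (cutHeight s) ^ 2 ≠ 0 := fun s =>
    twist_ne_zero hc (cutHeight_le s)
  refine ambientIsotopic_image (twistMap c m) (untwistMap c m) ?_ ?_ ?_ ?_ ?_ A
  · have hs : Continuous fun p : unitInterval × R3 => (p.1 : ℝ) * (p.2 2 - m) := by fun_prop
    have e1' := e1.comp hs
    have e2' := e2.comp hs
    have e3' := e3.comp hs
    have e4' := e4.comp hs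
    have e5' := e5.comp hs
    have e6' := e6.comp hs
    simp only [Function.comp_def] at e1' e2' e3' e4' e5' e6'
    unfold twistMap
    refine Continuous.pt ?_ ?_ (by fun_prop)
    · exact (continuous_const.add ((e1'.add e3').div_const 2)).add
        ((e5'.mul (by fun_prop)).sub (e6'.mul (by fun_prop)))
    · exact ((e2'.add e4').div_const 2).add
        ((e5'.mul (by fun_prop)).add (e6'.mul (by fun_prop)))
  · intro t _
    have hs : Continuous fun p : R3 => t * (p 2 - m) := by fun_prop
    have e1' := e1.comp hs
    have e2' := e2.comp hs
    have e3' := e3.comp hs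
    have e4' := e4.comp hs
    have e5' := e5.comp hs
    have e6' := e6.comp hs
    simp only [Function.comp_def] at e1' e2' e3' e4' e5' e6'
    have hx : Continuous fun p : R3 => p 0 - (c + 1 / 2 + (firstX (cutHeight (t * (p 2 - m))) +
      secondX c (cutHeight (t * (p 2 - m)))) / 2) :=
      (continuous_apply 0).sub (continuous_const.add ((e1'.add e3').div_const 2))
    have hy : Continuous fun p : R3 => p 1 - (firstY (cutHeight (t * (p 2 - m))) +
      secondY c (cutHeight (t * (p 2 - m)))) / 2 :=
      (continuous_apply 1).sub ((e2'.add e4').div_const 2)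
    have hd := (e5'.pow 2).add (e6'.pow 2)
    unfold untwistMap
    refine Continuous.pt ?_ ?_ (by fun_prop)
    · exact continuous_const.add (((e5'.mul hx).add (e6'.mul hy)).div hd fun p => ne _)
    · exact ((e5'.mul hy).sub (e6'.mul hx)).div hd fun p => ne _
  · intro t _ p
    have := ne (t * (p 2 - m))
    apply R3_ext
    · simp only [twistMap, untwistMap, pt_zero, pt_one, pt_two]
      field_simp
      ring
    · simp only [twistMap, untwistMap, pt_zero, pt_one, pt_two]
      field_simp
      ring
    · rfl
  · intro t _ p
    have := ne (t * (p 2 - m))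
    apply R3_ext
    · simp only [twistMap, untwistMap, pt_zero, pt_one, pt_two]
      field_simp
      ring
    · simp only [twistMap, untwistMap, pt_zero, pt_one, pt_two]
      field_simp
      ring
    · rfl
  · intro p
    exact twistMap_of_cutHeight hc (by simp [cutHeight])

/-- The height, relative to `m`, at which the twisted arc passes over a point. -/
def loopHeight (c x y : ℝ) : ℝ :=
  1 + max (max
    (2 / (c + 2) * (max (-x - 1 / 2) 0 + max (-y - 2 * max (x + 1 / 2) 0) 0))
    (2 / 3 * (max (x - 1 / 2) 0 + max (-y - 2 * max (1 / 2 - x) 0) 0)))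
    (2 * clamp (-1 - y))

theorem one_le_loopHeight (c x y : ℝ) : 1 ≤ loopHeight c x y := by
  have := clamp_nonneg (-1 - y)
  rw [loopHeight, le_add_iff_nonneg_right]
  exact le_max_of_le_right (by linarith)

theorem continuous_loopHeight (c : ℝ) :
    Continuous fun p : R3 => loopHeight c (p 0 - (c + 1 / 2)) (p 1) := by
  have := continuous_clamp
  unfold loopHeight
  fun_prop

/-- Flatten the twisted arc to the height `m + 1`. -/
def flattenMap (c m t : ℝ) (p : R3) : R3 :=
  pt (p 0) (p 1) (m + (min (p 2 - m) 0 +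
    max (p 2 - m) 0 / (1 + t * (loopHeight c (p 0 - (c + 1 / 2)) (p 1) - 1))))

/-- Rescaling the positive half-line by `a` and by its inverse undo each other, since signs are
preserved. -/
theorem min_max_div_cancel {a : ℝ} (ha : 0 < a) (s : ℝ) :
    min (min s 0 + max s 0 / a) 0 + max (min s 0 + max s 0 / a) 0 * a = s ∧
      min (min s 0 + max s 0 * a) 0 + max (min s 0 + max s 0 * a) 0 / a = s := by
  rcases le_total s 0 with h | h
  · simp [h]
  · have h1 : 0 ≤ s / a := by positivity
    have h2 : 0 ≤ s * a := by positivity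
    simp [h, h1, h2, ha.ne']

theorem ambientIsotopic_flattenMap (c m : ℝ) (A : Set R3) :
    AmbientIsotopic A (flattenMap c m 1 '' A) := by
  have hl := continuous_loopHeight c
  have pos : ∀ t ∈ Set.Icc (0 : ℝ) 1, ∀ p : R3,
      0 < 1 + t * (loopHeight c (p 0 - (c + 1 / 2)) (p 1) - 1) := fun t ht p => by
    nlinarith [ht.1, one_le_loopHeight c (p 0 - (c + 1 / 2)) (p 1)]
  refine ambientIsotopic_image (flattenMap c m)
    (fun t p => pt (p 0) (p 1) (m + (min (p 2 - m) 0 +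
      max (p 2 - m) 0 * (1 + t * (loopHeight c (p 0 - (c + 1 / 2)) (p 1) - 1)))))
    ?_ ?_ ?_ ?_ ?_ A
  · unfold flattenMap
    refine Continuous.pt (by fun_prop) (by fun_prop) (continuous_const.add ((by fun_prop :
      Continuous fun p : unitInterval × R3 => min (p.2 2 - m) 0).add
      ((by fun_prop : Continuous fun p : unitInterval × R3 => max (p.2 2 - m) 0).div ?_ ?_)))
    · exact continuous_const.add ((continuous_subtype_val.comp continuous_fst).mul
        ((hl.comp continuous_snd).sub continuous_const))
    · exact fun p => (pos p.1 p.1.2 p.2).ne'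
  · intro t _
    exact Continuous.pt (by fun_prop) (by fun_prop) (by fun_prop)
  · intro t ht p
    apply R3_ext
    · rfl
    · rfl
    · simp only [flattenMap, pt_zero, pt_one, pt_two, add_sub_cancel_left]
      rw [(min_max_div_cancel (pos t ht p) _).1]
      ring
  · intro t ht p
    apply R3_ext
    · rfl
    · rfl
    · simp only [flattenMap, pt_zero, pt_one, pt_two, add_sub_cancel_left]
      rw [(min_max_div_cancel (pos t ht p) _).2]
      ring
  · intro p
    apply R3_ext <;> simp [flattenMap]

/-- The composition of the three deformations. -/
def loopMap (c m : ℝ) (p : R3) : R3 := flattenMap c m 1 (twistMap c m 1 (liftMap c m 1 p))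

theorem ambientIsotopic_loopMap {c : ℝ} (hc : 0 ≤ c) (m : ℝ) (A : Set R3) :
    AmbientIsotopic A (loopMap c m '' A) := by
  have := ((ambientIsotopic_liftMap c m A).trans (ambientIsotopic_twistMap hc m _)).trans
    (ambientIsotopic_flattenMap c m _)
  rwa [Set.image_image, Set.image_image] at this

/-- The twist and the flattening act only above the height `m`. A point at or below it can be moved
only by the lift, hence only over the support of `bump` and above `m - 1`. -/
theorem loopMap_eq_self {c : ℝ} (hc : 0 ≤ c) {m : ℝ} {p : R3} (hz : p 2 ≤ m)
    (h : p 0 ≤ c ∨ c + 1 ≤ p 0 ∨ 1 ≤ |p 1| ∨ p 2 ≤ m - 1) : loopMap c m p = p := by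
  have h1 : liftMap c m 1 p = p := by
    apply R3_ext
    · rfl
    · rfl
    · simp only [liftMap, pt_two]
      by_cases hp : p 2 ≤ m - 1
      · exact stretch_of_le hp
      have : bump c (p 0) (p 1) = 0 := by
        rw [bump, mul_eq_zero]
        rcases h with h | h | h | h
        · exact Or.inl (clamp_of_nonpos ((min_le_left _ _).trans (by linarith)))
        · exact Or.inl (clamp_of_nonpos ((min_le_right _ _).trans (by linarith)))
        · exact Or.inr (clamp_of_nonpos (by linarith))
        · exact absurd h hp
      rw [this, mul_zero, mul_zero, stretch_zero]
  rw [loopMap, h1, twistMap_of_cutHeight hc (cutHeight_of_nonpos (by linarith))]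
  apply R3_ext
  · rfl
  · rfl
  · simp [flattenMap, hz]

/-! ### The image of the segment under the three deformations -/

/-- At the distance `s / 9` from an end of the segment the bump has the value `s / 3`, so the lift
is exactly `s`: the height becomes the parameter along either end. The middle third goes to the
constant height `m + 3`. -/
theorem liftMap_first {c m s : ℝ} (h0 : 0 ≤ s) (h3 : s ≤ 3) :
    liftMap c m 1 (pt (c + s / 9) 0 m) = pt (c + s / 9) 0 (m + s) := by
  apply R3_ext
  · rfl
  · rfl
  · simp only [liftMap, bump, pt_zero, pt_one, pt_two, abs_zero]
    rw [stretch_of_ge (by linarith), clamp_of_one_le (by norm_num : (1 : ℝ) ≤ 1 - 0),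
      min_eq_left (by linarith), clamp_of_mem (by linarith) (by linarith)]
    ring

theorem liftMap_second {c m s : ℝ} (h0 : 0 ≤ s) (h3 : s ≤ 3) :
    liftMap c m 1 (pt (c + 1 - s / 9) 0 m) = pt (c + 1 - s / 9) 0 (m + s) := by
  apply R3_ext
  · rfl
  · rfl
  · simp only [liftMap, bump, pt_zero, pt_one, pt_two, abs_zero]
    rw [stretch_of_ge (by linarith), clamp_of_one_le (by norm_num : (1 : ℝ) ≤ 1 - 0),
      min_eq_right (by linarith), clamp_of_mem (by linarith) (by linarith)]
    ring

theorem liftMap_top {c m t : ℝ} (h0 : 0 ≤ t) (h1 : t ≤ 1) :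
    liftMap c m 1 (pt (c + (1 + t) / 3) 0 m) = pt (c + (1 + t) / 3) 0 (m + 3) := by
  apply R3_ext
  · rfl
  · rfl
  · simp only [liftMap, bump, pt_zero, pt_one, pt_two, abs_zero]
    rw [stretch_of_ge (by linarith), clamp_of_one_le (by norm_num : (1 : ℝ) ≤ 1 - 0),
      clamp_of_one_le (le_min (by linarith) (by linarith))]
    ring

theorem twistMap_first {c m s : ℝ} (h0 : 0 ≤ s) (h3 : s ≤ 3) :
    twistMap c m 1 (pt (c + s / 9) 0 (m + s)) = pt (c + 1 / 2 + firstX s) (firstY s) (m + s) := by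
  have hs : cutHeight (1 * (m + s - m)) = s := by
    rw [one_mul, add_sub_cancel_left, cutHeight_of_mem h0 h3]
  obtain ⟨W, hW⟩ : ∃ W, 2 * (1 / 2 - s / 9) = W := ⟨_, rfl⟩
  have hW0 : W ≠ 0 := by linarith
  have hx : c + s / 9 - (c + 1 / 2) = -W / 2 := by linarith
  simp only [twistMap, pt_zero, pt_one, pt_two, hs, twistRe, twistIm, hW, hx]
  apply R3_ext
  · simp only [pt_zero]; field_simp; ring
  · simp only [pt_one]; field_simp; ring
  · rfl

theorem twistMap_second {c m s : ℝ} (h0 : 0 ≤ s) (h3 : s ≤ 3) :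
    twistMap c m 1 (pt (c + 1 - s / 9) 0 (m + s)) =
      pt (c + 1 / 2 + secondX c s) (secondY c s) (m + s) := by
  have hs : cutHeight (1 * (m + s - m)) = s := by
    rw [one_mul, add_sub_cancel_left, cutHeight_of_mem h0 h3]
  obtain ⟨W, hW⟩ : ∃ W, 2 * (1 / 2 - s / 9) = W := ⟨_, rfl⟩
  have hW0 : W ≠ 0 := by linarith
  have hx : c + 1 - s / 9 - (c + 1 / 2) = W / 2 := by linarith
  simp only [twistMap, pt_zero, pt_one, pt_two, hs, twistRe, twistIm, hW, hx]
  apply R3_ext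
  · simp only [pt_zero]; field_simp; ring
  · simp only [pt_one]; field_simp; ring
  · rfl

/-- At height `3` the ends are on the line `y = -2`, at `x = c + 2` and `x = 0`. The similarity at
this height therefore puts the middle third onto the back side of the closing arc. -/
theorem ends_at_top (c : ℝ) :
    firstX 3 = 3 / 2 ∧ firstY 3 = -2 ∧ secondX c 3 = -(1 / 2) - c ∧ secondY c 3 = -2 := by
  have h1 : (1 : ℝ) ≤ 3 := by norm_num
  rw [firstX_of_ge h1, firstY_of_ge h1, secondX_of_ge h1, secondY_of_ge h1,
    min_eq_right (by linarith : c ≤ (c + 2) / 2 * (3 - 1)),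
    max_eq_left (by linarith : 0 ≤ (c + 2) / 2 * (3 - 1) - c)]
  refine ⟨by norm_num, by norm_num, rfl, by ring⟩

theorem twistMap_top {c m t : ℝ} :
    twistMap c m 1 (pt (c + (1 + t) / 3) 0 (m + 3)) = pt (c + 2 + t * (-2 - c)) (-2) (m + 3) := by
  have hs : cutHeight (1 * (m + 3 - m)) = 3 := by
    rw [one_mul, add_sub_cancel_left, cutHeight_of_mem (by norm_num) le_rfl]
  obtain ⟨h1, h2, h3, h4⟩ := ends_at_top c
  simp only [twistMap, pt_zero, pt_one, pt_two, hs, twistRe, twistIm, h1, h2, h3, h4]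
  apply R3_ext
  · simp only [pt_zero]; ring
  · simp only [pt_one]; ring
  · rfl

/-- Of the terms in `loopHeight`, the first belongs to the second end, the second to the first end
and the last to the back side. Along the first end above height `1`, its own term is `2/3` of the
distance `d` travelled, that is, `s - 1`; the other end's term is cancelled by the subtracted
multiple of `x + 1/2`, and the last one is no larger because `2 (d - 2) ≤ 2 d / 3` for `d ≤ 3`. -/
theorem loopHeight_first {c s : ℝ} (h0 : 0 ≤ s) (h3 : s ≤ 3) :
    loopHeight c (firstX s) (firstY s) = max s 1 := by
  rcases le_total s 1 with hs | hs
  · rw [firstX_of_le hs, firstY_of_le hs, max_eq_right hs]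
    have hy : 0 ≤ min s (1 - s) := le_min h0 (by linarith)
    have h4 : 0 ≤ max (s - 1 / 2 + 1 / 2) 0 := le_max_right _ _
    have h5 : 0 ≤ max (1 / 2 - (s - 1 / 2)) 0 := le_max_right _ _
    rw [loopHeight, max_eq_right (by linarith : -(s - 1 / 2) - 1 / 2 ≤ 0),
      max_eq_right (by linarith : -(2 * min s (1 - s)) - 2 * max (s - 1 / 2 + 1 / 2) 0 ≤ 0),
      max_eq_right (by linarith : s - 1 / 2 - 1 / 2 ≤ 0),
      max_eq_right (by linarith : -(2 * min s (1 - s)) - 2 * max (1 / 2 - (s - 1 / 2)) 0 ≤ 0),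
      clamp_of_nonpos (by linarith)]
    simp
  rw [firstX_of_ge hs, firstY_of_ge hs, max_eq_left hs]
  obtain ⟨d, hd⟩ : ∃ d, 3 / 2 * (s - 1) = d := ⟨_, rfl⟩
  rw [hd]
  have hs' : s = 1 + 2 / 3 * d := by linarith
  have hd0 : 0 ≤ d := by linarith
  have hd3 : d ≤ 3 := by linarith
  rcases le_total d 1 with h | h
  · rw [min_eq_left h, max_eq_right (by linarith : d - 1 ≤ 0), loopHeight,
      max_eq_right (by linarith : -(1 / 2 + d) - 1 / 2 ≤ 0),
      max_eq_left (by linarith : 0 ≤ 1 / 2 + d + 1 / 2),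
      max_eq_right (by linarith : -(-0) - 2 * (1 / 2 + d + 1 / 2) ≤ 0),
      max_eq_left (by linarith : 0 ≤ 1 / 2 + d - 1 / 2),
      max_eq_right (by linarith : 1 / 2 - (1 / 2 + d) ≤ 0), clamp_of_nonpos (by linarith)]
    have : (0 : ℝ) ≤ 2 / 3 * d := by positivity
    simp [hs', this]
  · rw [min_eq_right h, max_eq_left (by linarith : 0 ≤ d - 1), loopHeight,
      max_eq_right (by norm_num : -(1 / 2 + 1) - 1 / 2 ≤ (0 : ℝ)),
      max_eq_left (by norm_num : (0 : ℝ) ≤ 1 / 2 + 1 + 1 / 2),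
      max_eq_right (by linarith : -(-(d - 1)) - 2 * (1 / 2 + 1 + 1 / 2) ≤ 0),
      max_eq_left (by linarith : (0 : ℝ) ≤ 1 / 2 + 1 - 1 / 2),
      max_eq_right (by linarith : (1 : ℝ) / 2 - (1 / 2 + 1) ≤ 0),
      max_eq_left (by linarith : 0 ≤ -(-(d - 1)) - 2 * 0),
      max_eq_right (by linarith : 2 / (c + 2) * (0 + 0) ≤
        2 / 3 * (1 / 2 + 1 - 1 / 2 + (-(-(d - 1)) - 2 * 0))), max_eq_left]
    · linarith
    · rcases le_total d 2 with h2 | h2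
      · rw [clamp_of_nonpos (by linarith)]; linarith
      · rw [clamp_of_mem (by linarith) (by linarith)]; linarith

/-- As for the first end, with the distance `e ≤ c + 2` travelled at the speed `(c + 2)/2`. The term
of the back side does not exceed `2 e / (c + 2)`, with equality at the end `e = c + 2`. -/
theorem loopHeight_second {c s : ℝ} (hc : 0 ≤ c) (h0 : 0 ≤ s) (h3 : s ≤ 3) :
    loopHeight c (secondX c s) (secondY c s) = max s 1 := by
  rcases le_total s 1 with hs | hs
  · rw [secondX_of_le hc hs, secondY_of_le hc hs, max_eq_right hs]
    have h6 := min_le_left s (1 - s)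
    have h7 := min_le_right s (1 - s)
    rw [loopHeight, max_eq_right (by linarith : -(1 / 2 - s) - 1 / 2 ≤ 0),
      max_eq_left (by linarith : 0 ≤ 1 / 2 - s + 1 / 2),
      max_eq_right (by linarith : - -(2 * min s (1 - s)) - 2 * (1 / 2 - s + 1 / 2) ≤ 0),
      max_eq_right (by linarith : 1 / 2 - s - 1 / 2 ≤ 0),
      max_eq_left (by linarith : 0 ≤ 1 / 2 - (1 / 2 - s)),
      max_eq_right (by linarith : - -(2 * min s (1 - s)) - 2 * (1 / 2 - (1 / 2 - s)) ≤ 0),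
      clamp_of_nonpos (by linarith)]
    simp
  rw [secondX_of_ge hs, secondY_of_ge hs, max_eq_left hs]
  obtain ⟨e, he⟩ : ∃ e, (c + 2) / 2 * (s - 1) = e := ⟨_, rfl⟩
  rw [he]
  have hc2 : 0 < c + 2 := by linarith
  have hs' : s = 1 + 2 / (c + 2) * e := by rw [← he]; field_simp; ring
  have he0 : 0 ≤ e := by rw [← he]; apply mul_nonneg <;> linarith
  have he3 : e ≤ c + 2 := by nlinarith
  have hnn : 0 ≤ 2 / (c + 2) * e := by positivity
  rcases le_total e c with h | h
  · rw [min_eq_left h, max_eq_right (by linarith : e - c ≤ 0), loopHeight,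
      max_eq_left (by linarith : 0 ≤ -(-(1 / 2) - e) - 1 / 2),
      max_eq_right (by linarith : -(1 / 2) - e + 1 / 2 ≤ 0),
      max_eq_right (by linarith : -(1 / 2) - e - 1 / 2 ≤ 0),
      max_eq_left (by linarith : 0 ≤ 1 / 2 - (-(1 / 2) - e)),
      max_eq_right (by linarith : -(-0) - 2 * (1 / 2 - (-(1 / 2) - e)) ≤ 0),
      clamp_of_nonpos (by linarith)]
    have : -(-(1 / 2) - e) - 1 / 2 = e := by ring
    rw [this, hs']
    simp [hnn]
  · rw [min_eq_right h, max_eq_left (by linarith : 0 ≤ e - c), loopHeight,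
      max_eq_left (by linarith : 0 ≤ -(-(1 / 2) - c) - 1 / 2),
      max_eq_right (by linarith : -(1 / 2) - c + 1 / 2 ≤ 0),
      max_eq_left (by linarith : 0 ≤ - -(e - c) - 2 * 0),
      max_eq_right (by linarith : -(1 / 2) - c - 1 / 2 ≤ 0),
      max_eq_left (by linarith : 0 ≤ 1 / 2 - (-(1 / 2) - c)),
      max_eq_right (by linarith : - -(e - c) - 2 * (1 / 2 - (-(1 / 2) - c)) ≤ 0)]
    have h1 : -(-(1 / 2) - c) - 1 / 2 + (- -(e - c) - 2 * 0) = e := by ring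
    rw [h1, add_zero, mul_zero, max_eq_left hnn, max_eq_left, hs']
    rcases le_total e (c + 1) with h2 | h2
    · rw [clamp_of_nonpos (by linarith)]; linarith
    · rw [clamp_of_mem (by linarith) (by linarith), div_mul_eq_mul_div, le_div_iff₀ hc2]
      nlinarith

/-- On the back side the last term is `2`, and the other two are at most `2` because they are
bounded by the full lengths `c + 2` and `3` of the two paths. -/
theorem loopHeight_top {c x : ℝ} (hc : 0 ≤ c) (h0 : -(1 / 2) - c ≤ x) (h1 : x ≤ 3 / 2) :
    loopHeight c x (-2) = 3 := by
  have hc2 : 0 < c + 2 := by linarith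
  have a1 : max (-x - 1 / 2) 0 ≤ c := max_le (by linarith) hc
  have a2 : max (- -2 - 2 * max (x + 1 / 2) 0) 0 ≤ 2 :=
    max_le (by linarith [le_max_right (x + 1 / 2) 0]) (by norm_num)
  have a3 : max (x - 1 / 2) 0 ≤ 1 := max_le (by linarith) (by norm_num)
  have a4 : max (- -2 - 2 * max (1 / 2 - x) 0) 0 ≤ 2 :=
    max_le (by linarith [le_max_right (1 / 2 - x) 0]) (by norm_num)
  rw [loopHeight, clamp_of_one_le (by norm_num), max_eq_right]
  · norm_num
  · refine max_le ?_ (by linarith)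
    rw [div_mul_eq_mul_div, div_le_iff₀ hc2]
    linarith

theorem flattenMap_eq {c m x y s a : ℝ} (h0 : 0 ≤ s) (ha : loopHeight c x y = a) :
    flattenMap c m 1 (pt (c + 1 / 2 + x) y (m + s)) = pt (c + 1 / 2 + x) y (m + s / a) := by
  simp only [flattenMap, pt_zero, pt_one, pt_two, add_sub_cancel_left, ha]
  rw [min_eq_right h0, max_eq_left h0]
  congr 2
  ring_nf

/-- The effect of the flattening on the arc: the crossing below height `1` is kept, and all that
lies higher comes down to height `1`. -/
theorem div_max_one (s : ℝ) : s / max s 1 = min s 1 := by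
  rcases le_total s 1 with h | h
  · simp [h]
  · simp [h, (by linarith : s ≠ 0)]

theorem loopMap_first {c m s : ℝ} (h0 : 0 ≤ s) (h3 : s ≤ 3) :
    loopMap c m (pt (c + s / 9) 0 m) = pt (c + 1 / 2 + firstX s) (firstY s) (m + min s 1) := by
  rw [loopMap, liftMap_first h0 h3, twistMap_first h0 h3,
    flattenMap_eq h0 (loopHeight_first h0 h3), div_max_one s]

theorem loopMap_second {c m s : ℝ} (hc : 0 ≤ c) (h0 : 0 ≤ s) (h3 : s ≤ 3) :
    loopMap c m (pt (c + 1 - s / 9) 0 m) =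
      pt (c + 1 / 2 + secondX c s) (secondY c s) (m + min s 1) := by
  rw [loopMap, liftMap_second h0 h3, twistMap_second h0 h3,
    flattenMap_eq h0 (loopHeight_second hc h0 h3), div_max_one s]

theorem loopMap_top {c m t : ℝ} (hc : 0 ≤ c) (h0 : 0 ≤ t) (h1 : t ≤ 1) :
    loopMap c m (pt (c + (1 + t) / 3) 0 m) = pt (c + 2 + t * (-2 - c)) (-2) (m + 1) := by
  rw [loopMap, liftMap_top h0 h1, twistMap_top]
  have : c + 2 + t * (-2 - c) = c + 1 / 2 + (3 / 2 + t * (-2 - c)) := by ring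
  rw [this, flattenMap_eq (by norm_num) (loopHeight_top hc (by nlinarith) (by nlinarith))]
  norm_num

/-- The part of the segment on which the first end of the lifted arc has heights between `a` and
`b`. -/
theorem image_loopMap_first {c m a b : ℝ} (ha : 0 ≤ a) (hab : a ≤ b) (hb : b ≤ 3)
    {p q : R3} (h : ∀ t : ℝ, 0 ≤ t → t ≤ 1 → ∀ s, s = a + t * (b - a) → a ≤ s → s ≤ b →
      c + 1 / 2 + firstX s = p 0 + t * (q 0 - p 0) ∧ firstY s = p 1 + t * (q 1 - p 1) ∧
      m + min s 1 = p 2 + t * (q 2 - p 2)) :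
    loopMap c m '' segment ℝ (pt (c + a / 9) 0 m) (pt (c + b / 9) 0 m) = segment ℝ p q := by
  refine image_segment_of_affine fun t h0 h1 => ?_
  have h2 : a ≤ a + t * (b - a) := by nlinarith
  have h3 : a + t * (b - a) ≤ b := by nlinarith
  obtain ⟨e0, e1, e2⟩ := h t h0 h1 _ rfl h2 h3
  rw [← e0, ← e1, ← e2, ← loopMap_first (by linarith) (by linarith)]
  congr 2 <;> simp
  ring

/-- The part of the segment on which the second end of the lifted arc has heights between `a` and
`b`. -/
theorem image_loopMap_second {c m a b : ℝ} (hc : 0 ≤ c) (ha : 0 ≤ a) (hab : a ≤ b) (hb : b ≤ 3)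
    {p q : R3} (h : ∀ t : ℝ, 0 ≤ t → t ≤ 1 → ∀ s, s = a + t * (b - a) → a ≤ s → s ≤ b →
      c + 1 / 2 + secondX c s = p 0 + t * (q 0 - p 0) ∧ secondY c s = p 1 + t * (q 1 - p 1) ∧
      m + min s 1 = p 2 + t * (q 2 - p 2)) :
    loopMap c m '' segment ℝ (pt (c + 1 - a / 9) 0 m) (pt (c + 1 - b / 9) 0 m) =
      segment ℝ p q := by
  refine image_segment_of_affine fun t h0 h1 => ?_
  have h2 : a ≤ a + t * (b - a) := by nlinarith
  have h3 : a + t * (b - a) ≤ b := by nlinarith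
  obtain ⟨e0, e1, e2⟩ := h t h0 h1 _ rfl h2 h3
  rw [← e0, ← e1, ← e2, ← loopMap_second hc (by linarith) (by linarith)]
  congr 2 <;> simp
  ring

/-- The arc that replaces the segment. -/
def loopArc (c m : ℝ) : Set R3 :=
  (segment ℝ (pt c 0 m) (pt (c + 1 / 2) 1 (m + 1 / 2)) ∪
    segment ℝ (pt (c + 1 / 2) 1 (m + 1 / 2)) (pt (c + 1) 0 (m + 1))) ∪
  (segment ℝ (pt (c + 1) 0 (m + 1)) (pt (c + 2) 0 (m + 1)) ∪
    segment ℝ (pt (c + 2) 0 (m + 1)) (pt (c + 2) (-2) (m + 1)) ∪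
    segment ℝ (pt (c + 2) (-2) (m + 1)) (pt 0 (-2) (m + 1)) ∪
    segment ℝ (pt 0 (-2) (m + 1)) (pt 0 0 (m + 1)) ∪
    segment ℝ (pt 0 0 (m + 1)) (pt c 0 (m + 1))) ∪
  (segment ℝ (pt (c + 1) 0 m) (pt (c + 1 / 2) (-1) (m + 1 / 2)) ∪
    segment ℝ (pt (c + 1 / 2) (-1) (m + 1 / 2)) (pt c 0 (m + 1)))

theorem image_loopMap_segment {c : ℝ} (hc : 0 ≤ c) (m : ℝ) :
    loopMap c m '' segment ℝ (pt c 0 m) (pt (c + 1) 0 m) = loopArc c m := by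
  have hc2 : 0 < c + 2 := by linarith
  -- The height at which the second end turns the corner at `x = 0`, having covered `c` of its `c +
  -- 2` units. The corresponding corner of the first end is at height `5/3`.
  obtain ⟨r, hr⟩ : ∃ r, 1 + 2 * c / (c + 2) = r := ⟨_, rfl⟩
  have hr1 : 1 ≤ r := by rw [← hr, le_add_iff_nonneg_right]; positivity
  have hrc : (c + 2) / 2 * (r - 1) = c := by rw [← hr]; field_simp; ring
  have hr3 : r ≤ 3 := by nlinarith
  -- The straight pieces of the first end are `f1` to `f4` and those of the second end `g1` to `g4`,
  -- by increasing height; `f5` is the back side.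
  have f1 := image_loopMap_first (c := c) (m := m) (le_refl 0) (by norm_num : (0 : ℝ) ≤ 1 / 2)
    (by norm_num) (p := pt c 0 m) (q := pt (c + 1 / 2) 1 (m + 1 / 2)) (by
      intro t h0 h1 s hs _ h2
      rw [firstX_of_le (by linarith), firstY_of_le (by linarith), min_eq_left (by linarith),
        min_eq_left (by linarith)]
      simp only [pt_zero, pt_one, pt_two]
      refine ⟨by linarith, by linarith, by linarith⟩)
  have f2 := image_loopMap_first (c := c) (m := m) (by norm_num : (0 : ℝ) ≤ 1 / 2)
    (by norm_num : (1 / 2 : ℝ) ≤ 1)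
    (by norm_num) (p := pt (c + 1 / 2) 1 (m + 1 / 2)) (q := pt (c + 1) 0 (m + 1)) (by
      intro t h0 h1 s hs h2 h3
      rw [firstX_of_le (by linarith), firstY_of_le (by linarith), min_eq_right (by linarith),
        min_eq_left (by linarith)]
      simp only [pt_zero, pt_one, pt_two]
      refine ⟨by linarith, by linarith, by linarith⟩)
  have f3 := image_loopMap_first (c := c) (m := m) (by norm_num : (0 : ℝ) ≤ 1)
    (by norm_num : (1 : ℝ) ≤ 5 / 3)
    (by norm_num) (p := pt (c + 1) 0 (m + 1)) (q := pt (c + 2) 0 (m + 1)) (by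
      intro t h0 h1 s hs h2 h3
      rw [firstX_of_ge (by linarith), firstY_of_ge (by linarith), min_eq_left (by linarith),
        max_eq_right (by linarith), min_eq_right (by linarith)]
      simp only [pt_zero, pt_one, pt_two]
      refine ⟨by linarith, by linarith, by linarith⟩)
  have f4 := image_loopMap_first (c := c) (m := m) (by norm_num : (0 : ℝ) ≤ 5 / 3)
    (by norm_num : (5 / 3 : ℝ) ≤ 3)
    (by norm_num) (p := pt (c + 2) 0 (m + 1)) (q := pt (c + 2) (-2) (m + 1)) (by
      intro t h0 h1 s hs h2 h3
      rw [firstX_of_ge (by linarith), firstY_of_ge (by linarith), min_eq_right (by linarith),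
        max_eq_left (by linarith), min_eq_right (by linarith)]
      simp only [pt_zero, pt_one, pt_two]
      refine ⟨by linarith, by linarith, by linarith⟩)
  have f5 : loopMap c m '' segment ℝ (pt (c + 3 / 9) 0 m) (pt (c + 2 / 3) 0 m) =
      segment ℝ (pt (c + 2) (-2) (m + 1)) (pt 0 (-2) (m + 1)) := by
    refine image_segment_of_affine fun t h0 h1 => ?_
    have := loopMap_top (m := m) hc h0 h1
    simp only [pt_zero, pt_one, pt_two]
    convert! this using 2 <;> ring_nf
  have g1 := image_loopMap_second (m := m) hc (le_refl 0) (by norm_num : (0 : ℝ) ≤ 1 / 2)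
    (by norm_num) (p := pt (c + 1) 0 m) (q := pt (c + 1 / 2) (-1) (m + 1 / 2)) (by
      intro t h0 h1 s hs _ h2
      rw [secondX_of_le hc (by linarith), secondY_of_le hc (by linarith),
        min_eq_left (by linarith), min_eq_left (by linarith)]
      simp only [pt_zero, pt_one, pt_two]
      refine ⟨by linarith, by linarith, by linarith⟩)
  have g2 := image_loopMap_second (m := m) hc (by norm_num : (0 : ℝ) ≤ 1 / 2)
    (by norm_num : (1 / 2 : ℝ) ≤ 1)
    (by norm_num) (p := pt (c + 1 / 2) (-1) (m + 1 / 2)) (q := pt c 0 (m + 1)) (by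
      intro t h0 h1 s hs h2 h3
      rw [secondX_of_le hc (by linarith), secondY_of_le hc (by linarith),
        min_eq_right (by linarith), min_eq_left (by linarith)]
      simp only [pt_zero, pt_one, pt_two]
      refine ⟨by linarith, by linarith, by linarith⟩)
  have g3 := image_loopMap_second (m := m) hc (by norm_num : (0 : ℝ) ≤ 1) hr1
    hr3 (p := pt c 0 (m + 1)) (q := pt 0 0 (m + 1)) (by
      intro t h0 h1 s hs h2 h3
      have e : (c + 2) / 2 * (s - 1) = t * c := by rw [hs]; linear_combination t * hrc
      rw [secondX_of_ge (by linarith), secondY_of_ge (by linarith), e, min_eq_left (by nlinarith),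
        max_eq_right (by nlinarith), min_eq_right (by linarith)]
      simp only [pt_zero, pt_one, pt_two]
      refine ⟨by linarith, by linarith, by linarith⟩)
  have g4 := image_loopMap_second (m := m) hc (by linarith : 0 ≤ r) hr3
    le_rfl (p := pt 0 0 (m + 1)) (q := pt 0 (-2) (m + 1)) (by
      intro t h0 h1 s hs h2 h3
      have e : (c + 2) / 2 * (s - 1) = c + 2 * t := by
        rw [hs]; linear_combination (1 - t) * hrc
      rw [secondX_of_ge (by linarith), secondY_of_ge (by linarith), e,
        min_eq_right (by nlinarith), max_eq_left (by nlinarith), min_eq_right (by linarith)]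
      simp only [pt_zero, pt_one, pt_two]
      refine ⟨by linarith, by linarith, by linarith⟩)
  -- The segment is cut at the points that go to the corners of the arc.
  have hseg : segment ℝ (pt c 0 m) (pt (c + 1) 0 m) =
      (segment ℝ (pt (c + 0 / 9) 0 m) (pt (c + 1 / 2 / 9) 0 m) ∪
        segment ℝ (pt (c + 1 / 2 / 9) 0 m) (pt (c + 1 / 9) 0 m) ∪
        segment ℝ (pt (c + 1 / 9) 0 m) (pt (c + 5 / 3 / 9) 0 m) ∪
        segment ℝ (pt (c + 5 / 3 / 9) 0 m) (pt (c + 3 / 9) 0 m)) ∪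
      segment ℝ (pt (c + 3 / 9) 0 m) (pt (c + 2 / 3) 0 m) ∪
      (segment ℝ (pt (c + 1 - 0 / 9) 0 m) (pt (c + 1 - 1 / 2 / 9) 0 m) ∪
        segment ℝ (pt (c + 1 - 1 / 2 / 9) 0 m) (pt (c + 1 - 1 / 9) 0 m) ∪
        segment ℝ (pt (c + 1 - 1 / 9) 0 m) (pt (c + 1 - r / 9) 0 m) ∪
        segment ℝ (pt (c + 1 - r / 9) 0 m) (pt (c + 1 - 3 / 9) 0 m)) := by
    have e1 : c + 0 / 9 = c := by ring
    have e2 : c + 1 - 0 / 9 = c + 1 := by ring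
    have e3 : c + 2 / 3 = c + 1 - 3 / 9 := by ring
    rw [e1, e2, e3, segment_along_x_union (by linarith) (by linarith),
      segment_along_x_union (by linarith) (by linarith),
      segment_along_x_union (by linarith) (by linarith),
      segment_along_x_union (by linarith) (by linarith)]
    rw [segment_symm ℝ (pt (c + 1) 0 m) (pt (c + 1 - 1 / 2 / 9) 0 m),
      segment_symm ℝ (pt (c + 1 - 1 / 2 / 9) 0 m) (pt (c + 1 - 1 / 9) 0 m),
      segment_symm ℝ (pt (c + 1 - 1 / 9) 0 m) (pt (c + 1 - r / 9) 0 m),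
      segment_symm ℝ (pt (c + 1 - r / 9) 0 m) (pt (c + 1 - 3 / 9) 0 m)]
    have e4 : ∀ A B C D : Set R3, A ∪ B ∪ C ∪ D = D ∪ C ∪ B ∪ A := fun A B C D => by
      ext; simp only [Set.mem_union]; tauto
    rw [e4, segment_along_x_union (by linarith) (by linarith),
      segment_along_x_union (by linarith) (by linarith),
      segment_along_x_union (by linarith) (by linarith),
      segment_along_x_union (by linarith) (by linarith)]
  rw [hseg]
  simp only [Set.image_union, f1, f2, f3, f4, f5, g1, g2, g3, g4]
  rw [segment_symm ℝ (pt c 0 (m + 1)), segment_symm ℝ (pt 0 0 (m + 1)) (pt 0 (-2) (m + 1)), loopArc]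
  ext
  simp only [Set.mem_union]
  tauto

/-! ### Stabilization of closed braids -/

/-- The braid itself, without its closing arcs. -/
def columns {n : ℕ} (w : BraidWord n) : Set R3 :=
  ⋃ k : Fin w.length, crossingColumn n k (w.get k)

theorem mem_columns {n : ℕ} {w : BraidWord n} {p : R3} :
    p ∈ columns w ↔ ∃ (k : ℕ) (h : k < w.length), p ∈ crossingColumn n k w[k] := by
  simp only [columns, Set.mem_iUnion]
  exact ⟨fun ⟨k, hk⟩ => ⟨k, k.2, hk⟩, fun ⟨k, h, hk⟩ => ⟨⟨k, h⟩, hk⟩⟩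

theorem columns_append_singleton {n : ℕ} (w : BraidWord n) (a : Fin (n - 1) × Bool) :
    columns (w ++ [a]) = columns w ∪ crossingColumn n w.length a := by
  ext p
  rw [Set.mem_union, mem_columns, mem_columns]
  constructor
  · rintro ⟨k, h, hp⟩
    rw [List.length_append, List.length_singleton] at h
    rcases Nat.lt_succ_iff_lt_or_eq.1 h with h' | rfl
    · rw [List.getElem_append_left h'] at hp
      exact Or.inl ⟨k, h', hp⟩
    · rw [List.getElem_append_right le_rfl] at hp
      exact Or.inr (by simpa using hp)
  · rintro (⟨k, h, hp⟩ | hp)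
    · exact ⟨k, by simp; omega, by rwa [List.getElem_append_left h]⟩
    · exact ⟨w.length, by simp, by rw [List.getElem_append_right le_rfl]; simpa using hp⟩

theorem mem_segment_bounds {p a b : R3} (h : p ∈ segment ℝ a b) (i : Fin 3) :
    min (a i) (b i) ≤ p i ∧ p i ≤ max (a i) (b i) := by
  obtain ⟨t, h0, h1, rfl⟩ := mem_segment_iff.1 h
  have key : ∀ x y : ℝ, min x y ≤ x + t * (y - x) ∧ x + t * (y - x) ≤ max x y := by
    intro x y
    rcases le_total x y with h | h
    · rw [min_eq_left h, max_eq_right h]; constructor <;> nlinarith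
    · rw [min_eq_right h, max_eq_left h]; constructor <;> nlinarith
  fin_cases i <;> exact key _ _

theorem crossingColumn_bounds {n k : ℕ} {a : Fin (n - 1) × Bool} {p : R3}
    (h : p ∈ crossingColumn n k a) : p 0 ≤ k + 1 ∧ p 2 ≤ (n : ℝ) - 1 := by
  have hi : ((a.1 : ℕ) : ℝ) + 2 ≤ n := by
    have := a.1.2
    exact_mod_cast (by omega : (a.1 : ℕ) + 2 ≤ n)
  simp only [crossingColumn, Set.mem_union, Set.mem_iUnion, Set.mem_ofPred_eq, exists_prop] at h
  have key : ∀ {x y z x' y' z' : ℝ}, x ≤ k + 1 → x' ≤ k + 1 → z ≤ (n : ℝ) - 1 →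
      z' ≤ (n : ℝ) - 1 → p ∈ segment ℝ (pt x y z) (pt x' y' z') →
      p 0 ≤ k + 1 ∧ p 2 ≤ (n : ℝ) - 1 := fun h1 h2 h3 h4 h =>
    ⟨(mem_segment_bounds h 0).2.trans (max_le h1 h2),
      (mem_segment_bounds h 2).2.trans (max_le h3 h4)⟩
  rcases h with (⟨j, ⟨hj, -⟩, h⟩ | h | h) | h | h
  · have hj' : (j : ℝ) + 1 ≤ n := by exact_mod_cast hj
    exact key (by linarith) (by linarith) (by linarith) (by linarith) h
  all_goals exact key (by linarith) (by linarith) (by linarith) (by linarith) h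

/-- The part of the stabilized closed braid that is already present before the stabilization. -/
def stabilizationRest {m : ℕ} (w : BraidWord (m + 1)) : Set R3 :=
  columns w ∪ (⋃ j : Fin m, segment ℝ (pt w.length 0 (j : ℕ)) (pt (w.length + 1) 0 (j : ℕ))) ∪
    ⋃ j : Fin (m + 1), closingArc (w.length + 1) j

theorem segment_image_stretch {a b c y z : ℝ} (hab : a ≤ b) :
    (fun p : R3 => pt (stretch 1 c (p 0)) (p 1) (p 2)) '' segment ℝ (pt a y z) (pt b y z) =
      segment ℝ (pt (stretch 1 c a) y z) (pt (stretch 1 c b) y z) := by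
  rw [segment_along_x hab, segment_along_x (monotone_stretch zero_le_one c hab), Set.image_image,
    ← image_stretch_Icc zero_le_one, Set.image_image]
  simp

theorem segment_image_stretch_const {a b c y y' z : ℝ} (hb : stretch 1 c a = b) :
    (fun p : R3 => pt (stretch 1 c (p 0)) (p 1) (p 2)) '' segment ℝ (pt a y z) (pt a y' z) =
      segment ℝ (pt b y z) (pt b y' z) := by
  refine image_segment_of_affine fun t _ _ => ?_
  simp [hb]

/-- Doubling the length of the interval from `c` to `c + 1` on the `x`-axis inserts a column without
crossings between the braid and its closing arcs. The top strand of this column is kept apart, since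
the loop is going to replace it. -/
theorem ambientIsotopic_closedBraid_rest {m : ℕ} (w : BraidWord (m + 1)) :
    AmbientIsotopic (closedBraid w)
      (stabilizationRest w ∪ segment ℝ (pt w.length 0 m) (pt (w.length + 1) 0 m)) := by
  obtain ⟨c, hc⟩ : ∃ c : ℝ, (w.length : ℝ) = c := ⟨_, rfl⟩
  have hc0 : 0 ≤ c := by rw [← hc]; positivity
  have key := ambientIsotopic_image (fun t p => pt (stretch t c (p 0)) (p 1) (p 2))
    (fun t p => pt (unstretch t c (p 0)) (p 1) (p 2)) (by fun_prop)
    (fun t ht => Continuous.pt (continuous_unstretch continuous_const (fun _ => ht.1)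
      continuous_const (by fun_prop)) (by fun_prop) (by fun_prop))
    (fun t ht p => by apply R3_ext <;> simp [unstretch_stretch ht.1])
    (fun t ht p => by apply R3_ext <;> simp [stretch_unstretch ht.1])
    (fun p => by apply R3_ext <;> simp [stretch_zero]) (closedBraid w)
  convert! key using 1
  have hcol : (fun p : R3 => pt (stretch 1 c (p 0)) (p 1) (p 2)) '' columns w = columns w := by
    refine Set.EqOn.image_eq_self fun p hp => ?_
    obtain ⟨k, hk, hp⟩ := mem_columns.1 hp
    have h1 := (crossingColumn_bounds hp).1
    have h2 : (k : ℝ) + 1 ≤ c := by rw [← hc]; exact_mod_cast hk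
    apply R3_ext
    · exact stretch_of_le (h1.trans h2)
    · rfl
    · rfl
  have harc : ∀ j : ℕ, (fun p : R3 => pt (stretch 1 c (p 0)) (p 1) (p 2)) '' closingArc w.length j =
      segment ℝ (pt c 0 j) (pt (c + 1) 0 j) ∪ closingArc (w.length + 1) j := by
    intro j
    have s0 : stretch 1 c c = c := stretch_of_le le_rfl
    have s1 : stretch 1 c (c + 1) = c + 1 + 1 := stretch_of_ge le_rfl
    have s2 : stretch 1 c 0 = 0 := stretch_of_le hc0
    rw [closingArc, closingArc, Nat.cast_add, Nat.cast_one, hc, segment_symm ℝ (pt (c + 1) (-2) _),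
      segment_symm ℝ (pt (c + 1 + 1) (-2) _)]
    simp only [Set.image_union]
    rw [segment_image_stretch (by linarith), segment_image_stretch (by linarith),
      segment_image_stretch_const s1, segment_image_stretch_const s2, s0, s1, s2,
      ← segment_along_x_union (by linarith : c ≤ c + 1) (by linarith : c + 1 ≤ c + 1 + 1)]
    simp only [Set.union_assoc]
  have hcl : closedBraid w = columns w ∪ ⋃ j : Fin (m + 1), closingArc w.length j := rfl
  rw [hcl, Set.image_union, hcol, Set.image_iUnion]
  simp only [harc]
  rw [Set.iUnion_union_distrib, stabilizationRest, hc]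
  have : (⋃ j : Fin (m + 1), segment ℝ (pt c 0 (j : ℕ)) (pt (c + 1) 0 (j : ℕ))) =
      (⋃ j : Fin m, segment ℝ (pt c 0 (j : ℕ)) (pt (c + 1) 0 (j : ℕ))) ∪
        segment ℝ (pt c 0 m) (pt (c + 1) 0 m) := by
    ext p
    simp only [Set.mem_iUnion, Set.mem_union]
    rw [Fin.exists_fin_succ']
    simp
  rw [this]
  ext p
  simp only [Set.mem_union]
  tauto

/-- The Markov stabilization of a braid word. -/
def stabilize {m : ℕ} (w : BraidWord (m + 1)) : BraidWord (m + 2) :=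
  (w.map fun a => ((Fin.castSucc (n := m) a.1 : Fin (m + 1)), a.2)) ++ [(Fin.last m, true)]

theorem length_stabilize {m : ℕ} (w : BraidWord (m + 1)) :
    (stabilize w).length = w.length + 1 := by simp [stabilize]

theorem crossingColumn_castSucc {m k : ℕ} (a : Fin (m + 1 - 1) × Bool) :
    crossingColumn (m + 2) k ((Fin.castSucc (n := m) a.1 : Fin (m + 1)), a.2) =
      crossingColumn (m + 1) k a ∪
        segment ℝ (pt k 0 ((m : ℝ) + 1)) (pt (k + 1) 0 ((m : ℝ) + 1)) := by
  have hi : (a.1 : ℕ) < m := a.1.2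
  have : (⋃ j ∈ {j : ℕ | j < m + 2 ∧ j ≠ (a.1 : ℕ) ∧ j ≠ (a.1 : ℕ) + 1},
      segment ℝ (pt k 0 j) (pt (k + 1) 0 j)) =
      (⋃ j ∈ {j : ℕ | j < m + 1 ∧ j ≠ (a.1 : ℕ) ∧ j ≠ (a.1 : ℕ) + 1},
        segment ℝ (pt k 0 j) (pt (k + 1) 0 j)) ∪
        segment ℝ (pt k 0 ((m : ℝ) + 1)) (pt (k + 1) 0 ((m : ℝ) + 1)) := by
    ext p
    simp only [Set.mem_iUnion, Set.mem_union, Set.mem_ofPred_eq, exists_prop]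
    constructor
    · rintro ⟨j, ⟨h1, h2, h3⟩, hp⟩
      rcases Nat.lt_succ_iff_lt_or_eq.1 h1 with h | rfl
      · exact Or.inl ⟨j, ⟨h, h2, h3⟩, hp⟩
      · exact Or.inr (by simpa using hp)
    · rintro (⟨j, ⟨h1, h2, h3⟩, hp⟩ | hp)
      · exact ⟨j, ⟨by omega, h2, h3⟩, hp⟩
      · exact ⟨m + 1, ⟨by omega, by omega, by omega⟩, by simpa using hp⟩
  simp only [crossingColumn, Fin.val_castSucc]
  rw [this]
  ext p
  simp only [Set.mem_union]
  tauto

/-- The new strand passes straight over the old columns. The extra point matters for the empty word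
only, where this strand degenerates to a point but there is no column to contain it; in the closed
braid that point lies on the closing arc. -/
theorem columns_map_castSucc {m : ℕ} (w : BraidWord (m + 1)) :
    columns (n := m + 2)
      (w.map fun a => ((Fin.castSucc (n := m) a.1 : Fin (m + 1)), a.2)) ∪ {pt 0 0 (m + 1)} =
      columns w ∪ segment ℝ (pt 0 0 (m + 1)) (pt w.length 0 (m + 1)) := by
  induction w using List.reverseRecOn with
  | nil =>
    have h : ∀ n, columns ([] : BraidWord n) = ∅ := fun n => by ext p; simp [mem_columns]
    rw [List.map_nil, h, h]
    simp
  | append_singleton w a ih =>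
    rw [List.map_append, List.map_singleton, columns_append_singleton, columns_append_singleton,
      Set.union_right_comm, ih, crossingColumn_castSucc, List.length_map, List.length_append,
      List.length_singleton, Nat.cast_add, Nat.cast_one,
      ← segment_along_x_union (Nat.cast_nonneg w.length : (0 : ℝ) ≤ w.length)
        (by linarith : (w.length : ℝ) ≤ w.length + 1)]
    ext p
    simp only [Set.mem_union]
    tauto

/-- The two strands of the new crossing, the new closing arc and the new strand over the old columns
make up `loopArc`. All the rest is the old closed braid with an empty column inserted. -/
theorem closedBraid_stabilize {m : ℕ} (w : BraidWord (m + 1)) :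
    closedBraid (stabilize w) = stabilizationRest w ∪ loopArc w.length m := by
  have hcl : closedBraid (stabilize w) = columns (stabilize w) ∪
    ⋃ j : Fin (m + 2), closingArc (stabilize w).length j := rfl
  have hfin : (⋃ j : Fin (m + 2), closingArc (w.length + 1) j) =
      (⋃ j : Fin (m + 1), closingArc (w.length + 1) j) ∪ closingArc (w.length + 1) (m + 1) := by
    ext p
    simp only [Set.mem_iUnion, Set.mem_union]
    rw [Fin.exists_fin_succ']
    simp
  have hpt : closingArc (w.length + 1) (m + 1) ∪ {pt 0 0 (m + 1)} =
      closingArc (w.length + 1) (m + 1) := by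
    rw [Set.union_eq_left, Set.singleton_subset_iff]
    right
    simpa using right_mem_segment ℝ (pt 0 (-2) (m + 1)) (pt 0 0 (m + 1))
  have hlast : crossingColumn (m + 2) w.length (Fin.last m, true) =
      (⋃ j : Fin m, segment ℝ (pt w.length 0 (j : ℕ)) (pt (w.length + 1) 0 (j : ℕ))) ∪
      (segment ℝ (pt w.length 0 m) (pt (w.length + 1 / 2) 1 (m + 1 / 2)) ∪
        segment ℝ (pt (w.length + 1 / 2) 1 (m + 1 / 2)) (pt (w.length + 1) 0 (m + 1))) ∪
      (segment ℝ (pt w.length 0 (m + 1)) (pt (w.length + 1 / 2) (-1) (m + 1 / 2)) ∪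
        segment ℝ (pt (w.length + 1 / 2) (-1) (m + 1 / 2)) (pt (w.length + 1) 0 m)) := by
    have : (⋃ j ∈ {j : ℕ | j < m + 2 ∧ j ≠ m ∧ j ≠ m + 1},
        segment ℝ (pt w.length 0 j) (pt (w.length + 1) 0 j)) =
        ⋃ j : Fin m, segment ℝ (pt w.length 0 (j : ℕ)) (pt (w.length + 1) 0 (j : ℕ)) := by
      ext p
      simp only [Set.mem_iUnion, Set.mem_ofPred_eq, exists_prop]
      constructor
      · rintro ⟨j, ⟨h1, h2, h3⟩, hp⟩
        exact ⟨⟨j, by omega⟩, hp⟩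
      · rintro ⟨j, hp⟩
        exact ⟨j, ⟨by omega, by omega, by omega⟩, hp⟩
    simp only [crossingColumn, Fin.val_last]
    rw [this]
    simp
  rw [hcl, length_stabilize, hfin, ← hpt, stabilize, columns_append_singleton, List.length_map,
    hlast]
  have hcols := columns_map_castSucc w
  ext p
  have hp := Set.ext_iff.1 hcols p
  simp only [closingArc, loopArc, Nat.cast_add, Nat.cast_one]
  rw [show (w.length : ℝ) + 1 + 1 = w.length + 2 by ring,
    segment_symm ℝ (pt w.length 0 (m + 1)) (pt (w.length + 1 / 2) (-1) (m + 1 / 2)),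
    segment_symm ℝ (pt (w.length + 1 / 2) (-1) (m + 1 / 2)) (pt (w.length + 1) 0 m)]
  simp only [stabilizationRest, closingArc, Nat.cast_add, Nat.cast_one, Set.mem_union] at hp ⊢
  rw [show (w.length : ℝ) + 1 + 1 = w.length + 2 by ring]
  tauto

/-- After the insertion of an empty column, `loopMap` replaces the top segment of that column by the
loop and leaves the rest in place. -/
theorem ambientIsotopic_stabilize {m : ℕ} (w : BraidWord (m + 1)) :
    AmbientIsotopic (closedBraid w) (closedBraid (stabilize w)) := by
  refine (ambientIsotopic_closedBraid_rest w).trans ?_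
  have hc : (0 : ℝ) ≤ w.length := Nat.cast_nonneg _
  have key := ambientIsotopic_loopMap hc m
    (stabilizationRest w ∪ segment ℝ (pt w.length 0 m) (pt (w.length + 1) 0 m))
  rw [Set.image_union, image_loopMap_segment hc] at key
  rw [closedBraid_stabilize]
  convert! key using 2
  refine (Set.EqOn.image_eq_self fun p hp => ?_).symm
  have hfix : p 2 ≤ m → (p 0 ≤ w.length ∨ w.length + 1 ≤ p 0 ∨ 1 ≤ |p 1| ∨ p 2 ≤ (m : ℝ) - 1) →
    loopMap w.length m p = id p := fun h1 h2 => loopMap_eq_self hc h1 h2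
  -- The columns lie to the left of the support of the lift and the lower strands of the inserted
  -- column at least one unit below the top one. The closing arcs lie to the left, to the right or
  -- in the plane `y = -2`.
  rcases hp with (hp | hp) | hp
  · obtain ⟨k, hk, hp⟩ := mem_columns.1 hp
    obtain ⟨h1, h2⟩ := crossingColumn_bounds hp
    have h3 : (k : ℝ) + 1 ≤ w.length := by exact_mod_cast hk
    push_cast at h2
    exact hfix (by linarith) (Or.inl (h1.trans h3))
  · obtain ⟨j, hp⟩ := Set.mem_iUnion.1 hp
    have h1 := (mem_segment_bounds hp 2).2
    have h2 : ((j : ℕ) : ℝ) + 1 ≤ m := by exact_mod_cast j.2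
    simp only [pt_two, max_self] at h1
    exact hfix (by linarith) (Or.inr (Or.inr (Or.inr (by linarith))))
  · obtain ⟨j, hp⟩ := Set.mem_iUnion.1 hp
    have hj : ((j : ℕ) : ℝ) ≤ m := by exact_mod_cast Nat.lt_succ_iff.1 j.2
    simp only [closingArc, Set.mem_union, Nat.cast_add, Nat.cast_one] at hp
    rcases hp with ((hp | hp) | hp) | hp <;>
      have h1 := (mem_segment_bounds hp 2).2 <;> have h2 := mem_segment_bounds hp 0 <;>
      have h3 := mem_segment_bounds hp 1 <;>
      simp only [pt_zero, pt_one, pt_two, max_self, min_self] at h1 h2 h3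
    · rw [min_eq_left (by linarith)] at h2
      exact hfix (by linarith) (Or.inr (Or.inl (by linarith [h2.1])))
    · exact hfix (by linarith) (Or.inr (Or.inl (by linarith [h2.1])))
    · refine hfix (by linarith) (Or.inr (Or.inr (Or.inl ?_)))
      have : p 1 = -2 := le_antisymm h3.2 h3.1
      rw [this]; norm_num
    · exact hfix (by linarith) (Or.inl (by linarith [h2.2]))

/-! ### Oriented families of triangles -/

/-- A family of triangles with cyclically ordered vertices that fit together to an oriented
simplicial complex: every directed edge belongs to at most one triangle. -/
structure OrientedTriangles (ι : Type*) where
  /-- The vertices of a triangle, in cyclic order. -/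
  v : ι → Fin 3 → R3
  indep : ∀ τ, AffineIndependent ℝ (v τ)
  inter : ∀ τ τ', convexHull ℝ (Set.range (v τ)) ∩ convexHull ℝ (Set.range (v τ')) ⊆
    convexHull ℝ (Set.range (v τ) ∩ Set.range (v τ'))
  range_injective : ∀ τ τ', Set.range (v τ) = Set.range (v τ') → τ = τ'
  directed : ∀ τ τ' s s', v τ s = v τ' s' → v τ (s + 1) = v τ' (s' + 1) → τ = τ'

namespace OrientedTriangles

open Classical in
/-- The vertex set of a triangle. -/
def tri {ι : Type*} (D : OrientedTriangles ι) (τ : ι) : Finset R3 := Finset.univ.image (D.v τ)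

variable {ι : Type*} (D : OrientedTriangles ι)

theorem coe_tri (τ : ι) : (D.tri τ : Set R3) = Set.range (D.v τ) := by simp [tri]

theorem mem_tri {τ : ι} {p : R3} : p ∈ D.tri τ ↔ ∃ s, D.v τ s = p := by simp [tri]

theorem v_injective (τ : ι) : Function.Injective (D.v τ) := (D.indep τ).injective

theorem card_tri (τ : ι) : (D.tri τ).card = 3 := by
  classical
  rw [tri, Finset.card_image_of_injective _ (D.v_injective τ)]; rfl

theorem tri_injective : Function.Injective D.tri := fun τ τ' h =>
  D.range_injective τ τ' (by rw [← coe_tri, ← coe_tri, h])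

theorem indep_tri (τ : ι) : AffineIndependent ℝ ((↑) : D.tri τ → R3) := by
  have h := (D.indep τ).range
  rw [← coe_tri] at h
  exact h

/-- The simplicial complex formed by a family of triangles. -/
def complex : Geometry.SimplicialComplex ℝ R3 where
  faces := {s | s.Nonempty ∧ ∃ τ, s ⊆ D.tri τ}
  isRelLowerSet_faces := by
    rintro s ⟨hs, τ, h⟩
    exact ⟨hs, fun t hts ht => ⟨ht, τ, hts.trans h⟩⟩
  indep := by
    rintro s ⟨-, τ, h⟩
    exact (D.indep_tri τ).mono (s := (s : Set R3)) (t := (D.tri τ : Set R3)) h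
  inter_subset_convexHull := by
    classical
    rintro s t ⟨-, τ, hs⟩ ⟨-, τ', ht⟩ p ⟨hps, hpt⟩
    -- The point lies in the common face of the two triangles. It is then intersected with `s`
    -- inside the first triangle and with `t` inside the second, since faces of one simplex meet in
    -- the face on their common vertices.
    have h1 : p ∈ convexHull ℝ ((D.tri τ ∩ D.tri τ' : Finset R3) : Set R3) := by
      have := D.inter τ τ'
      rw [← coe_tri, ← coe_tri] at this
      rw [Finset.coe_inter]
      exact this ⟨convexHull_mono (Finset.coe_subset.2 hs) hps,
        convexHull_mono (Finset.coe_subset.2 ht) hpt⟩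
    have h2 : p ∈ convexHull ℝ ((s ∩ (D.tri τ ∩ D.tri τ') : Finset R3) : Set R3) := by
      rw [Finset.coe_inter, (D.indep_tri τ).convexHull_inter hs Finset.inter_subset_left]
      exact ⟨hps, h1⟩
    have h3 : p ∈ convexHull ℝ (((s ∩ (D.tri τ ∩ D.tri τ')) ∩ t : Finset R3) : Set R3) := by
      rw [Finset.coe_inter, (D.indep_tri τ').convexHull_inter
        (Finset.inter_subset_right.trans Finset.inter_subset_right) ht]
      exact ⟨h2, hpt⟩
    refine convexHull_mono ?_ h3
    intro q hq
    simp only [Finset.coe_inter] at hq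
    exact ⟨hq.1.1, hq.2⟩

theorem tri_mem_simplices (τ : ι) : D.tri τ ∈ simplices D.complex 2 :=
  ⟨⟨Finset.card_pos.1 (by rw [card_tri]; norm_num), τ, subset_rfl⟩, D.card_tri τ⟩

theorem mem_simplices_two {t : Finset R3} : t ∈ simplices D.complex 2 ↔ ∃ τ, D.tri τ = t := by
  constructor
  · rintro ⟨⟨-, τ, h⟩, hc⟩
    exact ⟨τ, (Finset.eq_of_subset_of_card_le h (by rw [card_tri, hc])).symm⟩
  · rintro ⟨τ, rfl⟩
    exact D.tri_mem_simplices τ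

theorem simplices_two : simplices D.complex 2 = Set.range D.tri := by
  ext t; exact D.mem_simplices_two

theorem fin_three_cases : ∀ s t : Fin 3, s ≠ t → t = s + 1 ∨ s = t + 1 := by decide

open Classical in
theorem mem_simplices_one {e : Finset R3} :
    e ∈ simplices D.complex 1 ↔ ∃ τ s, e = {D.v τ s, D.v τ (s + 1)} := by
  constructor
  · rintro ⟨⟨-, τ, h⟩, hc⟩
    obtain ⟨a, b, hab, rfl⟩ := Finset.card_eq_two.1 hc
    obtain ⟨s, rfl⟩ := D.mem_tri.1 (h (by simp : a ∈ _))
    obtain ⟨s', rfl⟩ := D.mem_tri.1 (h (by simp : b ∈ _))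
    rcases fin_three_cases s s' (fun h => hab (by rw [h])) with rfl | rfl
    · exact ⟨τ, s, rfl⟩
    · exact ⟨τ, s', Finset.pair_comm _ _⟩
  · rintro ⟨τ, s, rfl⟩
    refine ⟨⟨by simp, τ, ?_⟩, Finset.card_pair ?_⟩
    · intro p hp
      simp only [Finset.mem_insert, Finset.mem_singleton] at hp
      rcases hp with rfl | rfl <;> exact D.mem_tri.2 ⟨_, rfl⟩
    · exact (D.v_injective τ).ne (by decide +revert)

theorem mem_simplices_zero {e : Finset R3} :
    e ∈ simplices D.complex 0 ↔ ∃ τ s, e = {D.v τ s} := by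
  constructor
  · rintro ⟨⟨-, τ, h⟩, hc⟩
    obtain ⟨a, rfl⟩ := Finset.card_eq_one.1 hc
    obtain ⟨s, rfl⟩ := D.mem_tri.1 (h (by simp : a ∈ _))
    exact ⟨τ, s, rfl⟩
  · rintro ⟨τ, s, rfl⟩
    exact ⟨⟨by simp, τ, by simpa using D.mem_tri.2 ⟨s, rfl⟩⟩, by simp⟩

/-- The directed edge from `a` to `b` occurs in the triangle `τ`. -/
def HasEdge (τ : ι) (a b : R3) : Prop := ∃ s, D.v τ s = a ∧ D.v τ (s + 1) = b

variable {D}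

theorem HasEdge.unique {τ τ' : ι} {a b : R3} (h : D.HasEdge τ a b) (h' : D.HasEdge τ' a b) :
    τ = τ' := by
  obtain ⟨s, rfl, rfl⟩ := h
  obtain ⟨s', h1, h2⟩ := h'
  exact (D.directed _ _ _ _ h1 h2).symm

theorem HasEdge.not_reverse {τ : ι} {a b : R3} (h : D.HasEdge τ a b) : ¬ D.HasEdge τ b a := by
  obtain ⟨s, rfl, rfl⟩ := h
  rintro ⟨s', h1, h2⟩
  have h1 := D.v_injective τ h1
  subst h1
  revert s
  simp only [(D.v_injective τ).eq_iff]
  decide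

theorem hasEdge_or {τ : ι} {a b : R3} (ha : a ∈ D.tri τ) (hb : b ∈ D.tri τ) (hab : a ≠ b) :
    D.HasEdge τ a b ∨ D.HasEdge τ b a := by
  obtain ⟨s, rfl⟩ := D.mem_tri.1 ha
  obtain ⟨s', rfl⟩ := D.mem_tri.1 hb
  rcases fin_three_cases s s' (fun h => hab (by rw [h])) with rfl | rfl
  · exact Or.inl ⟨s, rfl, rfl⟩
  · exact Or.inr ⟨s', rfl, rfl⟩

theorem HasEdge.mem {τ : ι} {a b : R3} (h : D.HasEdge τ a b) : a ∈ D.tri τ ∧ b ∈ D.tri τ := by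
  obtain ⟨s, rfl, rfl⟩ := h
  exact ⟨D.mem_tri.2 ⟨_, rfl⟩, D.mem_tri.2 ⟨_, rfl⟩⟩

theorem HasEdge.ne {τ : ι} {a b : R3} (h : D.HasEdge τ a b) : a ≠ b := by
  obtain ⟨s, rfl, rfl⟩ := h
  exact (D.v_injective τ).ne (by decide +revert)

variable (D)

open Classical in
theorem trianglesAt_pair {a b : R3} (hab : a ≠ b) :
    trianglesAt D.complex {a, b} =
      {t | ∃ τ, D.tri τ = t ∧ (D.HasEdge τ a b ∨ D.HasEdge τ b a)} := by
  ext t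
  constructor
  · rintro ⟨ht, hs⟩
    obtain ⟨τ, rfl⟩ := D.mem_simplices_two.1 ht
    exact ⟨τ, rfl, hasEdge_or (hs (by simp)) (hs (by simp)) hab⟩
  · rintro ⟨τ, rfl, h⟩
    refine ⟨D.tri_mem_simplices τ, ?_⟩
    intro p hp
    simp only [Finset.mem_insert, Finset.mem_singleton] at hp
    rcases h with h | h <;> rcases hp with rfl | rfl
    exacts [h.mem.1, h.mem.2, h.mem.2, h.mem.1]

open Classical in
theorem ncard_trianglesAt_of_reverse {τ τ' : ι} {a b : R3} (h : D.HasEdge τ a b)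
    (h' : D.HasEdge τ' b a) : (trianglesAt D.complex {a, b}).ncard = 2 := by
  have hne : τ ≠ τ' := by rintro rfl; exact h.not_reverse h'
  have : trianglesAt D.complex {a, b} = {D.tri τ, D.tri τ'} := by
    rw [D.trianglesAt_pair h.ne]
    ext t
    constructor
    · rintro ⟨σ, rfl, hσ | hσ⟩
      · rw [hσ.unique h]; exact Or.inl rfl
      · rw [hσ.unique h']; exact Or.inr rfl
    · rintro (rfl | rfl)
      · exact ⟨τ, rfl, Or.inl h⟩
      · exact ⟨τ', rfl, Or.inr h'⟩
  rw [this, Set.ncard_pair (D.tri_injective.ne hne)]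

open Classical in
theorem ncard_trianglesAt_of_not_reverse {τ : ι} {a b : R3} (h : D.HasEdge τ a b)
    (h' : ∀ τ', ¬ D.HasEdge τ' b a) : (trianglesAt D.complex {a, b}).ncard = 1 := by
  have : trianglesAt D.complex {a, b} = {D.tri τ} := by
    rw [D.trianglesAt_pair h.ne]
    ext t
    constructor
    · rintro ⟨σ, rfl, hσ | hσ⟩
      · rw [hσ.unique h]; rfl
      · exact absurd hσ (h' σ)
    · rintro rfl
      exact ⟨τ, rfl, Or.inl h⟩
  rw [this, Set.ncard_singleton]

/-- Each of the two directions of an edge occurs in at most one triangle. -/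
theorem ncard_trianglesAt {e : Finset R3} (he : e ∈ simplices D.complex 1) :
    (trianglesAt D.complex e).ncard = 1 ∨ (trianglesAt D.complex e).ncard = 2 := by
  classical
  obtain ⟨τ, s, rfl⟩ := D.mem_simplices_one.1 he
  have h : D.HasEdge τ (D.v τ s) (D.v τ (s + 1)) := ⟨s, rfl, rfl⟩
  by_cases h' : ∃ τ', D.HasEdge τ' (D.v τ (s + 1)) (D.v τ s)
  · obtain ⟨τ', h'⟩ := h'
    exact Or.inr (D.ncard_trianglesAt_of_reverse h h')
  · exact Or.inl (D.ncard_trianglesAt_of_not_reverse h (not_exists.1 h'))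

/-- A directed edge whose reverse does not occur. -/
def IsBoundaryEdge (a b : R3) : Prop := (∃ τ, D.HasEdge τ a b) ∧ ∀ τ, ¬ D.HasEdge τ b a

theorem boundary_complex :
    boundary D.complex = ⋃ q ∈ {q : R3 × R3 | D.IsBoundaryEdge q.1 q.2}, segment ℝ q.1 q.2 := by
  classical
  ext p
  simp only [boundary, Set.mem_iUnion, exists_prop]
  constructor
  · rintro ⟨e, ⟨he, hn⟩, hp⟩
    obtain ⟨τ, s, rfl⟩ := D.mem_simplices_one.1 he
    have h : D.HasEdge τ (D.v τ s) (D.v τ (s + 1)) := ⟨s, rfl, rfl⟩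
    refine ⟨(D.v τ s, D.v τ (s + 1)), ⟨⟨τ, h⟩, fun τ' h' => ?_⟩, ?_⟩
    · rw [D.ncard_trianglesAt_of_reverse h h'] at hn
      norm_num at hn
    · rwa [Finset.coe_pair, convexHull_pair] at hp
  · rintro ⟨⟨a, b⟩, ⟨⟨τ, h⟩, h'⟩, hp⟩
    refine ⟨{a, b}, ⟨?_, D.ncard_trianglesAt_of_not_reverse h h'⟩, ?_⟩
    · obtain ⟨s, rfl, rfl⟩ := h
      exact D.mem_simplices_one.2 ⟨τ, s, rfl⟩
    · rwa [Finset.coe_pair, convexHull_pair]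

/-- The cyclic orders of the vertices are the orientation: two different triangles cannot run along
a common edge in the same direction. -/
theorem isOrientable : IsOrientable D.complex := by
  refine ⟨fun t a b => ∃ τ, D.tri τ = t ∧ D.HasEdge τ a b, ?_, ?_⟩
  · intro t ht a ha b hb c hc hab hbc hac
    obtain ⟨τ, rfl⟩ := D.mem_simplices_two.1 ht
    have key : ∀ x y, (∃ τ', D.tri τ' = D.tri τ ∧ D.HasEdge τ' x y) ↔ D.HasEdge τ x y :=
      fun x y => ⟨fun ⟨τ', h, h'⟩ => D.tri_injective h ▸ h', fun h => ⟨τ, rfl, h⟩⟩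
    simp only [key]
    refine ⟨?_, ⟨HasEdge.not_reverse, fun h => (hasEdge_or ha hb hab).resolve_right h⟩⟩
    obtain ⟨i, rfl⟩ := D.mem_tri.1 ha
    obtain ⟨j, rfl⟩ := D.mem_tri.1 hb
    obtain ⟨k, rfl⟩ := D.mem_tri.1 hc
    have hv : ∀ x y, D.HasEdge τ (D.v τ x) (D.v τ y) ↔ y = x + 1 := fun x y =>
      ⟨fun ⟨s, h1, h2⟩ => by
        rw [← D.v_injective τ h1, ← D.v_injective τ h2], fun h => ⟨x, rfl, by rw [h]⟩⟩
    rw [hv, hv]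
    have hij : i ≠ j := fun h => hab (by rw [h])
    have hjk : j ≠ k := fun h => hbc (by rw [h])
    have hik : i ≠ k := fun h => hac (by rw [h])
    clear hab hbc hac ha hb hc key hv
    revert i j k
    decide
  · intro t ht t' ht' hne a b hab ha hb ha' hb'
    obtain ⟨τ, rfl⟩ := D.mem_simplices_two.1 ht
    obtain ⟨τ', rfl⟩ := D.mem_simplices_two.1 ht'
    have key : ∀ σ x y, (∃ τ', D.tri τ' = D.tri σ ∧ D.HasEdge τ' x y) ↔ D.HasEdge σ x y :=
      fun σ x y => ⟨fun ⟨τ', h, h'⟩ => D.tri_injective h ▸ h', fun h => ⟨σ, rfl, h⟩⟩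
    simp only [key]
    have hne' : τ ≠ τ' := fun h => hne (by rw [h])
    constructor
    · intro h
      exact (hasEdge_or ha' hb' hab).resolve_left fun h' => hne' (h.unique h')
    · intro h
      exact (hasEdge_or ha hb hab).resolve_right fun h' => hne' (h'.unique h)

theorem finite_faces [Finite ι] : D.complex.faces.Finite := by
  refine (Set.finite_iUnion fun τ => (D.tri τ).powerset.finite_toSet).subset ?_
  rintro s ⟨-, τ, h⟩
  exact Set.mem_iUnion.2 ⟨τ, by simpa using h⟩

theorem exists_triangle {s : Finset R3} (hs : s ∈ D.complex.faces) :
    ∃ t ∈ simplices D.complex 2, s ⊆ t := by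
  obtain ⟨-, τ, h⟩ := hs
  exact ⟨_, D.tri_mem_simplices τ, h⟩

theorem space_complex : D.complex.space = ⋃ τ, convexHull ℝ (Set.range (D.v τ)) := by
  ext p
  rw [Geometry.SimplicialComplex.mem_space_iff, Set.mem_iUnion]
  constructor
  · rintro ⟨s, ⟨-, τ, h⟩, hp⟩
    refine ⟨τ, ?_⟩
    rw [← coe_tri]
    exact convexHull_mono (Finset.coe_subset.2 h) hp
  · rintro ⟨τ, hp⟩
    rw [← coe_tri] at hp
    exact ⟨_, (D.tri_mem_simplices τ).1, hp⟩

end OrientedTriangles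

/-! ### Separating functionals -/

/-- In a convex combination at which the functional attains its bound `d`, the points with smaller
values have weight zero. -/
theorem mem_convexHull_of_nonpos {s : Set R3} {f : R3 →ₗ[ℝ] ℝ} {d : ℝ} (hs : ∀ q ∈ s, f q ≤ d)
    {p : R3} (hp : p ∈ convexHull ℝ s) (hfp : f p = d) : p ∈ convexHull ℝ {q ∈ s | f q = d} := by
  rw [convexHull_eq] at hp
  obtain ⟨ι, t, w, z, hw, hw1, hz, rfl⟩ := hp
  have hsum : ∑ i ∈ t, w i * (d - f (z i)) = 0 := by
    rw [Finset.centerMass_eq_of_sum_1 _ _ hw1, map_sum] at hfp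
    simp only [map_smul, smul_eq_mul] at hfp
    simp only [mul_sub, Finset.sum_sub_distrib, ← Finset.sum_mul, hw1, hfp]
    ring
  rw [Finset.sum_eq_zero_iff_of_nonneg fun i hi =>
    mul_nonneg (hw i hi) (sub_nonneg.2 (hs _ (hz i hi)))] at hsum
  classical
  rw [← Finset.centerMass_filter_ne_zero]
  refine Finset.centerMass_mem_convexHull _ (fun i hi => hw i (Finset.mem_filter.1 hi).1) ?_ ?_
  · rw [Finset.sum_filter_ne_zero, hw1]
    exact zero_lt_one
  · intro i hi
    obtain ⟨hi, hi0⟩ := Finset.mem_filter.1 hi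
    refine ⟨hz i hi, ?_⟩
    have := (mul_eq_zero.1 (hsum i hi)).resolve_left hi0
    linarith

/-- The simplices with vertex sets `s` and `t` meet in a common face. -/
def Glue (s t : Set R3) : Prop := convexHull ℝ s ∩ convexHull ℝ t ⊆ convexHull ℝ (s ∩ t)

theorem Glue.symm {s t : Set R3} (h : Glue s t) : Glue t s := by
  rw [Glue, Set.inter_comm, Set.inter_comm t]
  exact h

/-- The linear functional with the given coefficients. -/
def functional (a b c : ℝ) : R3 →ₗ[ℝ] ℝ :=
  a • LinearMap.proj 0 + b • LinearMap.proj 1 + c • LinearMap.proj 2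

theorem functional_apply (a b c : ℝ) (p : R3) :
    functional a b c p = a * p 0 + b * p 1 + c * p 2 := by
  simp [functional]

/-- A common point of the two hulls lies on the separating plane, hence in the hulls of the vertices
on that plane. Only these faces have to be compared. -/
theorem Glue.of_separated {s t : Set R3} (a b c d : ℝ)
    (hs : ∀ q ∈ s, a * q 0 + b * q 1 + c * q 2 ≤ d)
    (ht : ∀ q ∈ t, d ≤ a * q 0 + b * q 1 + c * q 2)
    (h : Glue {q ∈ s | a * q 0 + b * q 1 + c * q 2 = d}
      {q ∈ t | a * q 0 + b * q 1 + c * q 2 = d}) : Glue s t := by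
  simp only [← functional_apply] at hs ht h
  rintro p ⟨hps, hpt⟩
  have h1 : functional a b c p ≤ d :=
    convexHull_min (t := {q | functional a b c q ≤ d}) hs
      (convex_halfSpace_le (functional a b c).isLinear d) hps
  have h2 : d ≤ functional a b c p :=
    convexHull_min (t := {q | d ≤ functional a b c q}) ht
      (convex_halfSpace_ge (functional a b c).isLinear d) hpt
  have h3 := le_antisymm h1 h2
  have h4 := mem_convexHull_of_nonpos hs hps h3
  have h5 := mem_convexHull_of_nonpos (f := -functional a b c) (d := -d)
    (fun q hq => neg_le_neg (ht q hq)) hpt (by simp [h3])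
  simp only [LinearMap.neg_apply, neg_inj] at h5
  refine convexHull_mono ?_ (h ⟨h4, h5⟩)
  rintro q ⟨hq, hq'⟩
  exact ⟨hq.1, hq'.1⟩

theorem Glue.of_subset {s t : Set R3} (h : s ⊆ t) : Glue s t := by
  rw [Glue, Set.inter_eq_left.2 h]
  exact Set.inter_subset_left

theorem Glue.of_functional {s t : Set R3} (a b c d : ℝ)
    (hs : ∀ q ∈ s, a * q 0 + b * q 1 + c * q 2 ≤ d)
    (ht : ∀ q ∈ t, d ≤ a * q 0 + b * q 1 + c * q 2)
    (h : ∀ q ∈ s, a * q 0 + b * q 1 + c * q 2 = d → q ∈ t) : Glue s t :=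
  Glue.of_separated a b c d hs ht (Glue.of_subset fun q hq => ⟨h q hq.1 hq.2, hq.2⟩)

/-- Three points of space are affinely independent if they are so after a projection to a
plane. -/
theorem affineIndependent_of_det {v : Fin 3 → R3} (a b c a' b' c' : ℝ)
    (h : (a * (v 1 0 - v 0 0) + b * (v 1 1 - v 0 1) + c * (v 1 2 - v 0 2)) *
        (a' * (v 2 0 - v 0 0) + b' * (v 2 1 - v 0 1) + c' * (v 2 2 - v 0 2)) ≠
      (a * (v 2 0 - v 0 0) + b * (v 2 1 - v 0 1) + c * (v 2 2 - v 0 2)) *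
        (a' * (v 1 0 - v 0 0) + b' * (v 1 1 - v 0 1) + c' * (v 1 2 - v 0 2))) :
    AffineIndependent ℝ v := by
  rw [affineIndependent_iff_of_fintype]
  intro w hw hw'
  rw [Finset.weightedVSub_eq_weightedVSubOfPoint_of_sum_eq_zero _ _ _ hw (v 0),
    Finset.weightedVSubOfPoint_apply] at hw'
  simp only [Fin.sum_univ_three, vsub_eq_sub, sub_self, smul_zero, zero_add] at hw hw'
  have key : ∀ i, w 1 * (v 1 i - v 0 i) + w 2 * (v 2 i - v 0 i) = 0 := fun i => by
    simpa using congrFun hw' i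
  have k0 := key 0
  have k1 := key 1
  have k2 := key 2
  have e1 : w 1 * (a * (v 1 0 - v 0 0) + b * (v 1 1 - v 0 1) + c * (v 1 2 - v 0 2)) +
      w 2 * (a * (v 2 0 - v 0 0) + b * (v 2 1 - v 0 1) + c * (v 2 2 - v 0 2)) = 0 := by
    linear_combination a * k0 + b * k1 + c * k2
  have e2 : w 1 * (a' * (v 1 0 - v 0 0) + b' * (v 1 1 - v 0 1) + c' * (v 1 2 - v 0 2)) +
      w 2 * (a' * (v 2 0 - v 0 0) + b' * (v 2 1 - v 0 1) + c' * (v 2 2 - v 0 2)) = 0 := by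
    linear_combination a' * k0 + b' * k1 + c' * k2
  generalize a * (v 1 0 - v 0 0) + b * (v 1 1 - v 0 1) + c * (v 1 2 - v 0 2) = A at *
  generalize a * (v 2 0 - v 0 0) + b * (v 2 1 - v 0 1) + c * (v 2 2 - v 0 2) = B at *
  generalize a' * (v 1 0 - v 0 0) + b' * (v 1 1 - v 0 1) + c' * (v 1 2 - v 0 2) = C at *
  generalize a' * (v 2 0 - v 0 0) + b' * (v 2 1 - v 0 1) + c' * (v 2 2 - v 0 2) = E at *
  have hd : A * E - B * C ≠ 0 := sub_ne_zero.2 h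
  have h1 : w 1 = 0 := by
    refine (mul_eq_zero.1 (?_ : w 1 * (A * E - B * C) = 0)).resolve_right hd
    linear_combination E * e1 - B * e2
  have h2 : w 2 = 0 := by
    refine (mul_eq_zero.1 (?_ : w 2 * (A * E - B * C) = 0)).resolve_right hd
    linear_combination A * e2 - C * e1
  have h0 : w 0 = 0 := by linarith
  intro i
  fin_cases i <;> assumption

/-! ### The surface of a closed braid: its triangles -/

/-- The crossings of a braid word with `c` letters on `n` strands: the `k`-th letter interchanges
the strands at the heights `i k` and `i k + 1`, and its sign is `ε k`. -/
structure Crossings where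
  n : ℕ
  c : ℕ
  i : ℕ → ℕ
  ε : ℕ → ℝ
  i_lt : ∀ k < c, i k + 1 < n
  ε_sq : ∀ k, ε k * ε k = 1

/-- The vertices of the surface. There is one disk at every height; `rim j k` and `apex j` lie on
the boundary of the `j`-th one. The vertices `rising k` and `falling k` belong to the band of the
`k`-th crossing. -/
inductive Vertex
  | rim (j k : ℕ)
  | apex (j : ℕ)
  | rising (k : ℕ)
  | falling (k : ℕ)

open Vertex

namespace Crossings

variable (X : Crossings)

/-- The `x`-coordinate of the `k`-th vertex on the rim of a disk. -/
def rimX (k : ℕ) : ℝ := if k ≤ X.c + 1 then k else X.c + 1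

/-- The `y`-coordinate of the `k`-th vertex on the rim of a disk. -/
def rimY (k : ℕ) : ℝ := if k ≤ X.c + 1 then 0 else X.c - k

/-- The position of a vertex. -/
def pos : Vertex → R3
  | rim j k => pt (X.rimX k) (X.rimY k) j
  | apex j => pt 0 (-2) j
  | rising k => pt (k + 1 / 2) (X.ε k) (X.i k + 1 / 2)
  | falling k => pt (k + 1 / 2) (-X.ε k) (X.i k + 1 / 2)

theorem rimX_of_le {k : ℕ} (h : k ≤ X.c + 1) : X.rimX k = k := if_pos h

theorem rimY_of_le {k : ℕ} (h : k ≤ X.c + 1) : X.rimY k = 0 := if_pos h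

theorem rimX_last : X.rimX (X.c + 2) = X.c + 1 := if_neg (by omega)

theorem rimY_last : X.rimY (X.c + 2) = -2 := by
  rw [rimY, if_neg (by omega)]; push_cast; ring

theorem ε_ne_zero (k : ℕ) : X.ε k ≠ 0 := fun h => by simpa [h] using X.ε_sq k

theorem rimX_eq_natCast (k : ℕ) : ∃ a : ℕ, X.rimX k = a := by
  unfold rimX
  split_ifs
  · exact ⟨k, rfl⟩
  · exact ⟨X.c + 1, by push_cast; rfl⟩

theorem natCast_ne_add_half (a b : ℕ) : (a : ℝ) ≠ b + 1 / 2 := by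
  intro h
  have h2 : ((2 * a : ℕ) : ℝ) = ((2 * b + 1 : ℕ) : ℝ) := by push_cast; linarith
  have := Nat.cast_injective h2
  omega

/-- Disk vertices have integral and band vertices half-integral first coordinates. The height tells
disks apart, and the sign of `y` the two vertices of a band. The injectivity extends to indices that
do not occur in the surface because the rim is continued indefinitely in the direction of `-y`. -/
theorem pos_injective : Function.Injective X.pos := by
  intro u u' h
  have h0 := congrFun h 0
  have h1 := congrFun h 1
  have h2 := congrFun h 2
  have half := fun k b : ℕ => (X.rimX_eq_natCast k).elim fun a (ha : X.rimX k = a) =>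
    fun (e : X.rimX k = b + 1 / 2) => natCast_ne_add_half a b (ha ▸ e)
  have half0 : ∀ b : ℕ, (0 : ℝ) ≠ b + 1 / 2 := fun b => by
    simpa using natCast_ne_add_half 0 b
  cases u with
  | rim j k =>
    cases u' with
    | rim j' k' =>
      simp only [pos, pt_zero, pt_one, pt_two, Nat.cast_inj, rimX, rimY] at h0 h1 h2
      subst h2
      congr 1
      have key : ∀ a : ℕ, ¬ a ≤ X.c + 1 → (X.c : ℝ) - a < 0 := fun a ha => by
        have : ((X.c : ℕ) : ℝ) < a := by exact_mod_cast (by omega : X.c < a)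
        linarith
      split_ifs at h0 h1 with a b b
      · exact_mod_cast h0
      · linarith [key _ b]
      · linarith [key _ a]
      · exact_mod_cast (by linarith : (k : ℝ) = k')
    | apex j' =>
      simp only [pos, pt_zero, pt_one, rimX, rimY] at h0 h1
      split_ifs at h0 h1
      · norm_num at h1
      · linarith [(Nat.cast_nonneg X.c : (0 : ℝ) ≤ X.c)]
    | rising k' => exact absurd h0 (half k k')
    | falling k' => exact absurd h0 (half k k')
  | apex j =>
    cases u' with
    | rim j' k' =>
      simp only [pos, pt_zero, pt_one, rimX, rimY] at h0 h1
      split_ifs at h0 h1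
      · norm_num at h1
      · linarith [(Nat.cast_nonneg X.c : (0 : ℝ) ≤ X.c)]
    | apex j' =>
      simp only [pos, pt_two, Nat.cast_inj] at h2
      rw [h2]
    | rising k' => exact absurd h0 (half0 k')
    | falling k' => exact absurd h0 (half0 k')
  | rising k =>
    cases u' with
    | rim j' k' => exact absurd h0.symm (half k' k)
    | apex j' => exact absurd h0.symm (half0 k)
    | rising k' =>
      simp only [pos, pt_zero, add_left_inj, Nat.cast_inj] at h0
      rw [h0]
    | falling k' =>
      simp only [pos, pt_zero, pt_one, add_left_inj, Nat.cast_inj] at h0 h1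
      subst h0
      exact absurd (by linarith) (X.ε_ne_zero k)
  | falling k =>
    cases u' with
    | rim j' k' => exact absurd h0.symm (half k' k)
    | apex j' => exact absurd h0.symm (half0 k)
    | falling k' =>
      simp only [pos, pt_zero, add_left_inj, Nat.cast_inj] at h0
      rw [h0]
    | rising k' =>
      simp only [pos, pt_zero, pt_one, add_left_inj, Nat.cast_inj] at h0 h1
      subst h0
      exact absurd (by linarith) (X.ε_ne_zero k)

/-- The triangles of the surface: those of the disks, and four for every crossing. -/
abbrev Triangle : Type := (Fin X.n × Fin (X.c + 2)) ⊕ (Fin X.c × Fin 4)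

/-- The vertices of a triangle, in cyclic order. -/
def label : X.Triangle → Fin 3 → Vertex
  | Sum.inl (j, k) => ![apex j, rim j k, rim j (k + 1)]
  | Sum.inr (k, 0) => ![rim (X.i k) k, rising k, falling k]
  | Sum.inr (k, 1) => ![rim (X.i k) (k + 1), rim (X.i k) k, falling k]
  | Sum.inr (k, 2) => ![rising k, rim (X.i k + 1) (k + 1), falling k]
  | Sum.inr (k, 3) => ![rim (X.i k + 1) (k + 1), rim (X.i k + 1) k, falling k]

/-- All disks have the same orientation, and a band runs against it along both edges where it is
attached. The half twist is what makes these two requirements compatible inside the band. -/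
theorem label_directed (τ τ' : X.Triangle) (s s' : Fin 3) (h : X.label τ s = X.label τ' s')
    (h' : X.label τ (s + 1) = X.label τ' (s' + 1)) : τ = τ' := by
  rcases τ with ⟨j, k⟩ | ⟨k, x⟩ <;> rcases τ' with ⟨j', k'⟩ | ⟨k', x'⟩
  · fin_cases s <;> fin_cases s' <;> simp [label] at h h' ⊢ <;> grind
  · fin_cases x' <;> fin_cases s <;> fin_cases s' <;> simp [label] at h h' ⊢ <;> grind
  · fin_cases x <;> fin_cases s <;> fin_cases s' <;> simp [label] at h h' ⊢ <;> grind
  · fin_cases x <;> fin_cases x' <;> fin_cases s <;> fin_cases s' <;>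
      simp [label] at h h' ⊢ <;> grind

theorem label_range_injective (τ τ' : X.Triangle)
    (h : Set.range (X.label τ) = Set.range (X.label τ')) : τ = τ' := by
  have h0 : ∀ s, ∃ s', X.label τ' s' = X.label τ s := fun s => by
    rw [← Set.mem_range, ← h]; exact ⟨s, rfl⟩
  simp only [Fin.forall_fin_succ, Fin.exists_fin_succ] at h0
  rcases τ with ⟨j, k⟩ | ⟨k, x⟩ <;> rcases τ' with ⟨j', k'⟩ | ⟨k', x'⟩
  · simp [label] at h0 ⊢; grind
  · fin_cases x' <;> simp [label] at h0 ⊢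
  · fin_cases x <;> simp [label] at h0 ⊢
  · fin_cases x <;> fin_cases x' <;> simp [label] at h0 ⊢ <;> grind

/-! ### The surface of a closed braid: its embedding -/

/-- The positions of the vertices of a triangle. -/
def vert (τ : X.Triangle) (s : Fin 3) : R3 := X.pos (X.label τ s)

theorem forall_mem_range_vert {τ : X.Triangle} {P : R3 → Prop} :
    (∀ q ∈ Set.range (X.vert τ), P q) ↔
      P (X.pos (X.label τ 0)) ∧ P (X.pos (X.label τ 1)) ∧ P (X.pos (X.label τ 2)) := by
  simp only [Set.forall_mem_range, Fin.forall_fin_succ, vert]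
  simp

/-- Every triangle of the surface stays nondegenerate under the projection to the `xy`-plane. -/
theorem affineIndependent_vert (τ : X.Triangle) : AffineIndependent ℝ (X.vert τ) := by
  apply affineIndependent_of_det 1 0 0 0 1 0
  rcases τ with ⟨j, k⟩ | ⟨k, x⟩
  · have hk := k.2
    rcases Nat.lt_or_eq_of_le (Nat.lt_succ_iff.1 hk) with h | h
    · simp [vert, label, pos, X.rimX_of_le (by omega : (k : ℕ) ≤ X.c + 1),
        X.rimY_of_le (by omega : (k : ℕ) ≤ X.c + 1), X.rimX_of_le (by omega : (k : ℕ) + 1 ≤ X.c + 1),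
        X.rimY_of_le (by omega : (k : ℕ) + 1 ≤ X.c + 1)]
    · simp [vert, label, pos, h, X.rimX_of_le le_rfl, X.rimY_of_le le_rfl, X.rimX_last, X.rimY_last]
      positivity
  · have hk := k.2
    have hε := X.ε_ne_zero k
    fin_cases x <;> simp [vert, label, pos, X.rimX_of_le (by omega : (k : ℕ) ≤ X.c + 1),
        X.rimY_of_le (by omega : (k : ℕ) ≤ X.c + 1), X.rimX_of_le (by omega : (k : ℕ) + 1 ≤ X.c + 1),
        X.rimY_of_le (by omega : (k : ℕ) + 1 ≤ X.c + 1), hε]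
    · intro h; exact hε (by linarith)
    · exact ⟨by norm_num, fun h => hε (by linarith)⟩

end Crossings

theorem Glue.of_subsingleton {s t : Set R3} (hs : s.Subsingleton) (ht : t.Subsingleton) :
    Glue s t := by
  rw [Glue, hs.convex.convexHull_eq, ht.convex.convexHull_eq]
  exact subset_convexHull ℝ _

/-- Simplices in two adjacent columns that have at most one vertex each on the common wall. -/
theorem Glue.of_wall {s t : Set R3} (x : ℝ) (hs : ∀ q ∈ s, q 0 ≤ x) (ht : ∀ q ∈ t, x ≤ q 0)
    (hs' : {q ∈ s | q 0 = x}.Subsingleton) (ht' : {q ∈ t | q 0 = x}.Subsingleton) : Glue s t := by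
  have e : ∀ q : R3, 1 * q 0 + 0 * q 1 + 0 * q 2 = q 0 := fun q => by ring
  refine Glue.of_separated 1 0 0 x (by simpa only [e]) (by simpa only [e]) ?_
  simp only [e]
  exact Glue.of_subsingleton hs' ht'

namespace Crossings

variable (X : Crossings)

/-- The cross product of two vectors from the apex of a disk to vertices of its rim. -/
def cross (k l : ℕ) : ℝ := X.rimX k * (X.rimY l + 2) - X.rimX l * (X.rimY k + 2)

theorem cross_self (k : ℕ) : X.cross k k = 0 := sub_self _

theorem cross_comm (k l : ℕ) : X.cross k l = -X.cross l k := by unfold cross; ring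

/-- Seen from the apex, the rim is traversed clockwise through less than a half turn. -/
theorem cross_neg {k l : ℕ} (h : k < l) (hl : l ≤ X.c + 2) : X.cross k l < 0 := by
  have hk : k ≤ X.c + 1 := by omega
  have hkl : (k : ℝ) < l := by exact_mod_cast h
  rw [cross, X.rimX_of_le hk, X.rimY_of_le hk]
  rcases Nat.lt_or_eq_of_le hl with hl | rfl
  · have hl : l ≤ X.c + 1 := by omega
    rw [X.rimX_of_le hl, X.rimY_of_le hl]
    linarith
  · rw [rimX_last, rimY_last]
    have : (0 : ℝ) ≤ X.c := Nat.cast_nonneg _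
    linarith

theorem cross_nonpos {k l : ℕ} (h : k ≤ l) (hl : l ≤ X.c + 2) : X.cross k l ≤ 0 := by
  rcases h.lt_or_eq with h | rfl
  · exact (X.cross_neg h hl).le
  · exact (X.cross_self k).le

theorem cross_pos {k l : ℕ} (h : l < k) (hk : k ≤ X.c + 2) : 0 < X.cross k l := by
  rw [cross_comm]; linarith [X.cross_neg h hk]

theorem cross_nonneg {k l : ℕ} (h : l ≤ k) (hk : k ≤ X.c + 2) : 0 ≤ X.cross k l := by
  rw [cross_comm]; linarith [X.cross_nonpos h hk]

/-- The functional that vanishes on the line from the apex of a disk between the vertices `a` and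
`b` of its rim, evaluated at a vertex of the rim. -/
theorem functional_rim (a b j k : ℕ) :
    (X.rimY a + 2 + (X.rimY b + 2)) * X.pos (rim j k) 0 +
      -(X.rimX a + X.rimX b) * X.pos (rim j k) 1 + 0 * X.pos (rim j k) 2 =
      2 * (X.rimX a + X.rimX b) + (X.cross k a + X.cross k b) := by
  simp only [pos, pt_zero, pt_one, pt_two, cross]; ring

theorem functional_apex (a b j : ℕ) :
    (X.rimY a + 2 + (X.rimY b + 2)) * X.pos (apex j) 0 +
      -(X.rimX a + X.rimX b) * X.pos (apex j) 1 + 0 * X.pos (apex j) 2 =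
      2 * (X.rimX a + X.rimX b) := by
  simp only [pos, pt_zero, pt_one, pt_two]; ring

/-- Two triangles of a fan are separated by the vertical plane through the apex in the direction of
the sum of the vectors to the rim vertices `k + 1` and `k'`. For neighbouring triangles these
vertices coincide and the plane contains the common edge; otherwise it meets the first triangle in
the apex alone. -/
theorem glue_disk_lt {j : Fin X.n} {k k' : Fin (X.c + 2)} (h : k < k') :
    Glue (Set.range (X.vert (Sum.inl (j, k)))) (Set.range (X.vert (Sum.inl (j, k')))) := by
  have h : (k : ℕ) < k' := h
  have hk' := k'.2
  refine Glue.of_functional (X.rimY (k + 1) + 2 + (X.rimY k' + 2))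
    (-(X.rimX (k + 1) + X.rimX k')) 0 (2 * (X.rimX (k + 1) + X.rimX k')) ?_ ?_ ?_
  · rw [forall_mem_range_vert]
    refine ⟨(X.functional_apex _ _ _).le, (X.functional_rim _ _ _ _).le.trans ?_,
      (X.functional_rim _ _ _ _).le.trans ?_⟩
    · linarith [X.cross_nonpos (by omega : (k : ℕ) ≤ k + 1) (by omega),
        X.cross_nonpos (by omega : (k : ℕ) ≤ k') (by omega)]
    · linarith [X.cross_nonpos (by omega : (k : ℕ) + 1 ≤ k + 1) (by omega),
        X.cross_nonpos (by omega : (k : ℕ) + 1 ≤ k') (by omega)]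
  · rw [forall_mem_range_vert]
    refine ⟨(X.functional_apex _ _ _).ge, le_trans ?_ (X.functional_rim _ _ _ _).ge,
      le_trans ?_ (X.functional_rim _ _ _ _).ge⟩
    · linarith [X.cross_nonneg (by omega : (k : ℕ) + 1 ≤ k') (by omega),
        X.cross_nonneg (by omega : (k' : ℕ) ≤ k') (by omega)]
    · linarith [X.cross_nonneg (by omega : (k : ℕ) + 1 ≤ k' + 1) (by omega),
        X.cross_nonneg (by omega : (k' : ℕ) ≤ k' + 1) (by omega)]
  · rw [forall_mem_range_vert]
    refine ⟨fun _ => ⟨0, rfl⟩, fun e => ?_, fun e => ?_⟩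
    · have := (X.functional_rim _ _ _ _).symm.trans e
      linarith [X.cross_neg (by omega : (k : ℕ) < k + 1) (by omega),
        X.cross_nonpos (by omega : (k : ℕ) ≤ k') (by omega)]
    · have := (X.functional_rim _ _ _ _).symm.trans e
      rcases Nat.lt_or_eq_of_le (by omega : (k : ℕ) + 1 ≤ k') with h' | h'
      · linarith [X.cross_neg h' (by omega), X.cross_self (k + 1)]
      · exact ⟨1, by simp [vert, label, h']⟩

theorem glue_disk (j j' : Fin X.n) (k k' : Fin (X.c + 2)) :
    Glue (Set.range (X.vert (Sum.inl (j, k)))) (Set.range (X.vert (Sum.inl (j', k')))) := by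
  have key : ∀ {j j' : Fin X.n} {k k' : Fin (X.c + 2)}, j < j' →
      Glue (Set.range (X.vert (Sum.inl (j, k)))) (Set.range (X.vert (Sum.inl (j', k')))) := by
    intro j j' k k' h
    have h : ((j : ℕ) : ℝ) < j' := by exact_mod_cast h
    refine Glue.of_functional 0 0 1 (((j : ℕ) + (j' : ℕ)) / 2) ?_ ?_ ?_ <;>
      rw [forall_mem_range_vert]
    · simp [label, pos]; linarith
    · simp [label, pos]; linarith
    · simp only [label, pos]
      refine ⟨fun e => ?_, fun e => ?_, fun e => ?_⟩ <;> simp at e <;> linarith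
  rcases lt_trichotomy j j' with h | rfl | h
  · exact key h
  · rcases lt_trichotomy k k' with h | rfl | h
    · exact X.glue_disk_lt h
    · exact Glue.of_subset subset_rfl
    · exact (X.glue_disk_lt h).symm
  · exact (key h).symm

/-- A simplex on one side of a disk that meets its plane in a part of the edge between two
consecutive vertices of the rim. -/
theorem glue_edge_disk {t : Set R3} {σ : ℝ} (j : Fin X.n) (k' : Fin (X.c + 2)) {k : ℕ}
    (hk : k < X.c)
    (ht : ∀ q ∈ t, q = X.pos (rim j k) ∨ q = X.pos (rim j (k + 1)) ∨ 0 < σ * (q 2 - (j : ℕ))) :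
    Glue t (Set.range (X.vert (Sum.inl (j, k')))) := by
  have hk' := k'.2
  have hz : ∀ k, X.pos (rim j k) 2 = (j : ℕ) := fun k => rfl
  -- The plane of the disk separates, with `σ` telling the side of `t`. Within this plane, the edge
  -- is compared with the triangle of the disk in the same way as two triangles of a fan.
  refine Glue.of_separated 0 0 (-σ) (-σ * (j : ℕ)) ?_ ?_ ?_
  · intro q hq
    rcases ht q hq with rfl | rfl | h
    · rw [hz]; linarith
    · rw [hz]; linarith
    · linarith
  · rw [forall_mem_range_vert]; simp [label, pos]
  have ht' : ∀ q ∈ {q ∈ t | 0 * q 0 + 0 * q 1 + -σ * q 2 = -σ * (j : ℕ)},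
      q = X.pos (rim j k) ∨ q = X.pos (rim j (k + 1)) := by
    rintro q ⟨hq, hq'⟩
    rcases ht q hq with h | h | h
    · exact Or.inl h
    · exact Or.inr h
    · linarith
  have hs' : ∀ {P : R3 → Prop}, (P (X.pos (apex j)) ∧ P (X.pos (rim j k')) ∧
      P (X.pos (rim j (k' + 1)))) → ∀ q ∈ {q ∈ Set.range (X.vert (Sum.inl (j, k'))) |
        0 * q 0 + 0 * q 1 + -σ * q 2 = -σ * (j : ℕ)}, P q :=
    fun h q hq => X.forall_mem_range_vert.2 h q hq.1
  have hmem : ∀ q ∈ Set.range (X.vert (Sum.inl (j, k'))),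
      q ∈ {q ∈ Set.range (X.vert (Sum.inl (j, k'))) |
        0 * q 0 + 0 * q 1 + -σ * q 2 = -σ * (j : ℕ)} := fun q hq => ⟨hq, by
    revert q; rw [forall_mem_range_vert]; simp [label, pos]⟩
  rcases lt_trichotomy k k' with h | rfl | h
  · refine Glue.of_functional (X.rimY (k + 1) + 2 + (X.rimY k' + 2))
      (-(X.rimX (k + 1) + X.rimX k')) 0 (2 * (X.rimX (k + 1) + X.rimX k')) ?_ (hs' ?_) ?_
    · intro q hq
      rcases ht' q hq with rfl | rfl <;> rw [functional_rim]
      · linarith [X.cross_nonpos (by omega : (k : ℕ) ≤ k + 1) (by omega),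
          X.cross_nonpos (by omega : (k : ℕ) ≤ k') (by omega)]
      · linarith [X.cross_nonpos (by omega : (k : ℕ) + 1 ≤ k + 1) (by omega),
          X.cross_nonpos (by omega : (k : ℕ) + 1 ≤ k') (by omega)]
    · refine ⟨(X.functional_apex _ _ _).ge, ?_, ?_⟩ <;> rw [functional_rim]
      · linarith [X.cross_nonneg (by omega : (k : ℕ) + 1 ≤ k') (by omega),
          X.cross_nonneg (by omega : (k' : ℕ) ≤ k') (by omega)]
      · linarith [X.cross_nonneg (by omega : (k : ℕ) + 1 ≤ k' + 1) (by omega),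
          X.cross_nonneg (by omega : (k' : ℕ) ≤ k' + 1) (by omega)]
    · intro q hq
      rcases ht' q hq with rfl | rfl <;> rw [functional_rim] <;> intro e
      · linarith [X.cross_neg (by omega : (k : ℕ) < k + 1) (by omega),
          X.cross_nonpos (by omega : (k : ℕ) ≤ k') (by omega)]
      · rcases Nat.lt_or_eq_of_le (by omega : (k : ℕ) + 1 ≤ k') with h' | h'
        · linarith [X.cross_neg h' (by omega), X.cross_self (k + 1)]
        · exact hmem _ ⟨1, by simp [vert, label, h']⟩
  · refine Glue.of_subset fun q hq => hmem q ?_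
    rcases ht' q hq with rfl | rfl
    · exact ⟨1, rfl⟩
    · exact ⟨2, rfl⟩
  · refine Glue.of_functional (-(X.rimY (k' + 1) + 2 + (X.rimY k + 2)))
      (X.rimX (k' + 1) + X.rimX k) 0 (-(2 * (X.rimX (k' + 1) + X.rimX k))) ?_ (hs' ?_) ?_
    · intro q hq
      rcases ht' q hq with rfl | rfl
      · linarith [X.functional_rim (k' + 1) k j k,
          X.cross_nonneg (by omega : (k' : ℕ) + 1 ≤ k) (by omega), X.cross_self k]
      · linarith [X.functional_rim (k' + 1) k j (k + 1),
          X.cross_nonneg (by omega : (k' : ℕ) + 1 ≤ k + 1) (by omega),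
          X.cross_nonneg (by omega : (k : ℕ) ≤ k + 1) (by omega)]
    · refine ⟨?_, ?_, ?_⟩
      · linarith [X.functional_apex (k' + 1) k j]
      · linarith [X.functional_rim (k' + 1) k j k',
          X.cross_nonpos (by omega : (k' : ℕ) ≤ k' + 1) (by omega),
          X.cross_nonpos (by omega : (k' : ℕ) ≤ k) (by omega)]
      · linarith [X.functional_rim (k' + 1) k j (k' + 1), X.cross_self (k' + 1),
          X.cross_nonpos (by omega : (k' : ℕ) + 1 ≤ k) (by omega)]
    · intro q hq
      rcases ht' q hq with rfl | rfl <;> intro e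
      · rcases Nat.lt_or_eq_of_le (by omega : (k' : ℕ) + 1 ≤ k) with h' | h'
        · linarith [X.functional_rim (k' + 1) k j k, X.cross_pos h' (by omega), X.cross_self k]
        · exact hmem _ ⟨2, by simp [vert, label, h']⟩
      · linarith [X.functional_rim (k' + 1) k j (k + 1),
          X.cross_nonneg (by omega : (k' : ℕ) + 1 ≤ k + 1) (by omega),
          X.cross_pos (by omega : (k : ℕ) < k + 1) (by omega)]

theorem pos_rim {j k : ℕ} (h : k ≤ X.c + 1) : X.pos (rim j k) = pt k 0 j := by
  rw [pos, X.rimX_of_le h, X.rimY_of_le h]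

/-- The lower two triangles of a band occupy the heights from `i` to `i + 1/2` and touch only the
disk `i`; the upper two occupy those from `i + 1/2` to `i + 1` and touch only the disk `i + 1`. -/
theorem glue_band_disk (k : Fin X.c) (x : Fin 4) (j : Fin X.n) (k' : Fin (X.c + 2)) :
    Glue (Set.range (X.vert (Sum.inr (k, x)))) (Set.range (X.vert (Sum.inl (j, k')))) := by
  have hx : (x = 0 ∨ x = 1) ∨ (x = 2 ∨ x = 3) := by
    fin_cases x <;> simp
  rcases hx with hx | hx
  · rcases le_or_gt (j : ℕ) (X.i k) with h | h
    · have h1 : ((j : ℕ) : ℝ) ≤ X.i k := by exact_mod_cast h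
      refine X.glue_edge_disk (σ := 1) j k' k.2 ?_
      rw [forall_mem_range_vert]
      rcases h.lt_or_eq with h | h
      · have h1 : ((j : ℕ) : ℝ) < X.i k := by exact_mod_cast h
        rcases hx with rfl | rfl <;> simp only [label] <;>
          refine ⟨Or.inr (Or.inr ?_), Or.inr (Or.inr ?_), Or.inr (Or.inr ?_)⟩ <;> simp [pos] <;>
          linarith
      · rcases hx with rfl | rfl <;> simp [label, h] <;> simp [pos]
    · have h1 : (X.i k : ℝ) + 1 ≤ (j : ℕ) := by exact_mod_cast h
      refine X.glue_edge_disk (σ := -1) j k' k.2 ?_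
      rw [forall_mem_range_vert]
      rcases hx with rfl | rfl <;> simp only [label] <;>
        refine ⟨Or.inr (Or.inr ?_), Or.inr (Or.inr ?_), Or.inr (Or.inr ?_)⟩ <;> simp [pos] <;>
        linarith
  · rcases le_or_gt (X.i k + 1) (j : ℕ) with h | h
    · refine X.glue_edge_disk (σ := -1) j k' k.2 ?_
      rw [forall_mem_range_vert]
      rcases h.lt_or_eq with h | h
      · have h1 : (X.i k : ℝ) + 1 < (j : ℕ) := by exact_mod_cast h
        rcases hx with rfl | rfl <;> simp only [label] <;>
          refine ⟨Or.inr (Or.inr ?_), Or.inr (Or.inr ?_), Or.inr (Or.inr ?_)⟩ <;> simp [pos] <;>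
          linarith
      · rcases hx with rfl | rfl <;> simp [label, ← h] <;> simp [pos] <;> norm_num
    · have h1 : ((j : ℕ) : ℝ) ≤ X.i k := by exact_mod_cast Nat.lt_succ_iff.1 h
      refine X.glue_edge_disk (σ := 1) j k' k.2 ?_
      rw [forall_mem_range_vert]
      rcases hx with rfl | rfl <;> simp only [label] <;>
        refine ⟨Or.inr (Or.inr ?_), Or.inr (Or.inr ?_), Or.inr (Or.inr ?_)⟩ <;> simp [pos] <;>
        linarith

/-- Bands of different crossings lie in different columns, and no triangle of a band has more than
one vertex on a wall of its column. -/
theorem glue_band_lt {k k' : Fin X.c} (h : k < k') (x x' : Fin 4) :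
    Glue (Set.range (X.vert (Sum.inr (k, x)))) (Set.range (X.vert (Sum.inr (k', x')))) := by
  have h1 : ((k : ℕ) : ℝ) + 1 ≤ (k' : ℕ) := by exact_mod_cast h
  have hr : ∀ (k : Fin X.c) j, X.pos (rim j k) = pt (k : ℕ) 0 j := fun k j =>
    X.pos_rim (by omega)
  have hr' : ∀ (k : Fin X.c) j, X.pos (rim j (k + 1)) = pt ((k : ℕ) + 1) 0 j := fun k j => by
    rw [X.pos_rim (by omega)]; push_cast; rfl
  have single : ∀ {τ : X.Triangle} {p : R3},
      (∀ q ∈ Set.range (X.vert τ), q 0 = ((k : ℕ) : ℝ) + 1 → q = p) →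
      {q ∈ Set.range (X.vert τ) | q 0 = ((k : ℕ) : ℝ) + 1}.Subsingleton := fun h q hq q' hq' => by
    rw [h q hq.1 hq.2, h q' hq'.1 hq'.2]
  refine Glue.of_wall ((k : ℕ) + 1) ?_ ?_ ?_ ?_
  · rw [forall_mem_range_vert]
    fin_cases x <;> simp [label, hr, hr'] <;> simp [pos] <;> norm_num
  · rw [forall_mem_range_vert]
    fin_cases x' <;> simp only [label, Matrix.cons_val, hr, hr'] <;>
      simp only [pos, pt_zero] <;> refine ⟨?_, ?_, ?_⟩ <;> linarith
  · have e : ¬ (2⁻¹ : ℝ) = 1 := by norm_num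
    fin_cases x
    -- This triangle has no vertex on the wall, so any value of `p` will do.
    · refine single (p := 0) ?_
      rw [forall_mem_range_vert]
      simp [label, hr]; simp [pos, e]
    · refine single (p := X.pos (rim (X.i k) (k + 1))) ?_
      rw [forall_mem_range_vert]
      simp [label, hr, hr']; simp [pos, e]
    · refine single (p := X.pos (rim (X.i k + 1) (k + 1))) ?_
      rw [forall_mem_range_vert]
      simp [label, hr']; simp [pos, e]
    · refine single (p := X.pos (rim (X.i k + 1) (k + 1))) ?_
      rw [forall_mem_range_vert]
      simp [label, hr, hr']; simp [pos, e]
  · have e : ¬ ((k' : ℕ) : ℝ) + 2⁻¹ = (k : ℕ) + 1 := by intro e; linarith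
    have e' : ¬ ((k' : ℕ) : ℝ) = (k : ℕ) := by intro e; linarith
    fin_cases x'
    · refine single (p := X.pos (rim (X.i k') k')) ?_
      rw [forall_mem_range_vert]
      simp [label, hr]; simp [pos, e]
    · refine single (p := X.pos (rim (X.i k') k')) ?_
      rw [forall_mem_range_vert]
      simp [label, hr, hr', e']; simp [pos, e]
    · refine single (p := 0) ?_
      rw [forall_mem_range_vert]
      simp [label, hr', e']; simp [pos, e]
    · refine single (p := X.pos (rim (X.i k' + 1) k')) ?_
      rw [forall_mem_range_vert]
      simp [label, hr, hr', e']; simp [pos, e]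

/-- The plane at height `i + 1/2` separates the lower two triangles from the upper two; each of
these pairs is separated by a plane through its common edge. -/
theorem glue_band_self (k : Fin X.c) (x x' : Fin 4) :
    Glue (Set.range (X.vert (Sum.inr (k, x)))) (Set.range (X.vert (Sum.inr (k, x')))) := by
  have hr : ∀ j, X.pos (rim j k) = pt (k : ℕ) 0 j := fun j => X.pos_rim (by omega)
  have hr' : ∀ j, X.pos (rim j (k + 1)) = pt ((k : ℕ) + 1) 0 j := fun j => by
    rw [X.pos_rim (by omega)]; push_cast; rfl
  have hε := X.ε_sq k
  have lower : Glue (Set.range (X.vert (Sum.inr (k, 0)))) (Set.range (X.vert (Sum.inr (k, 1)))) := by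
    -- The plane contains the edge from `rim (X.i k) k` to `falling k`. At the two remaining
    -- vertices the functional exceeds `d` by `-2` and `1`.
    refine Glue.of_functional 1 (-X.ε k) (-3)
      (1 + (k + 1 / 2) - 3 * ((X.i k : ℝ) + 1 / 2)) ?_ ?_ ?_ <;> rw [forall_mem_range_vert]
    · simp only [label, Matrix.cons_val]
      rw [hr]; simp only [pos, pt_zero, pt_one, pt_two]
      refine ⟨?_, ?_, ?_⟩ <;> linarith
    · simp only [label, Matrix.cons_val]
      rw [hr, hr']; simp only [pos, pt_zero, pt_one, pt_two]
      refine ⟨?_, ?_, ?_⟩ <;> linarith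
    · refine ⟨fun _ => ⟨1, rfl⟩, fun e => ?_, fun _ => ⟨2, rfl⟩⟩
      simp only [label, Matrix.cons_val, pos, pt_zero, pt_one, pt_two] at e
      linarith
  have upper : Glue (Set.range (X.vert (Sum.inr (k, 2)))) (Set.range (X.vert (Sum.inr (k, 3)))) := by
    -- The plane contains the edge from `rim (X.i k + 1) (k + 1)` to `falling k`, and the excesses
    -- over `d` are again `-2` and `1`.
    refine Glue.of_functional (-1) (-X.ε k) 3
      (1 - (k + 1 / 2) + 3 * ((X.i k : ℝ) + 1 / 2)) ?_ ?_ ?_ <;> rw [forall_mem_range_vert]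
    · simp only [label, Matrix.cons_val]
      rw [hr']; simp only [pos, pt_zero, pt_one, pt_two]
      push_cast
      refine ⟨?_, ?_, ?_⟩ <;> linarith
    · simp only [label, Matrix.cons_val]
      rw [hr, hr']; simp only [pos, pt_zero, pt_one, pt_two]
      push_cast
      refine ⟨?_, ?_, ?_⟩ <;> linarith
    · refine ⟨fun e => ?_, fun _ => ⟨0, rfl⟩, fun _ => ⟨2, rfl⟩⟩
      simp only [label, Matrix.cons_val, pos, pt_zero, pt_one, pt_two] at e
      linarith
  have middle : ∀ {x x' : Fin 4}, (x = 0 ∨ x = 1) → (x' = 2 ∨ x' = 3) →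
      Glue (Set.range (X.vert (Sum.inr (k, x)))) (Set.range (X.vert (Sum.inr (k, x')))) := by
    intro x x' hx hx'
    have hs : ∀ q ∈ Set.range (X.vert (Sum.inr (k, x))), q 2 ≤ (X.i k : ℝ) + 1 / 2 := by
      rw [forall_mem_range_vert]
      rcases hx with rfl | rfl <;> simp [label, pos]
    have ht : ∀ q ∈ Set.range (X.vert (Sum.inr (k, x'))), (X.i k : ℝ) + 1 / 2 ≤ q 2 := by
      rw [forall_mem_range_vert]
      rcases hx' with rfl | rfl <;> simp [label, pos] <;> norm_num
    rcases hx' with rfl | rfl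
    · refine Glue.of_functional 0 0 1 ((X.i k : ℝ) + 1 / 2) (by simpa using hs)
        (by simpa using ht) ?_
      rw [forall_mem_range_vert]
      rcases hx with rfl | rfl
      · refine ⟨fun e => ?_, fun _ => ⟨0, rfl⟩, fun _ => ⟨2, rfl⟩⟩
        simp [label, pos] at e
      · refine ⟨fun e => ?_, fun e => ?_, fun _ => ⟨2, rfl⟩⟩ <;> simp [label, pos] at e
    -- This upper triangle meets the plane only in `falling k`, a vertex of both lower triangles, so
    -- the roles of the two sides are exchanged.
    · refine (Glue.of_functional 0 0 (-1) (-((X.i k : ℝ) + 1 / 2)) (by simpa using ht)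
        (by simpa using hs) ?_).symm
      rw [forall_mem_range_vert]
      refine ⟨fun e => ?_, fun e => ?_, fun _ => ⟨2, ?_⟩⟩
      · simp [label, pos] at e
      · simp [label, pos] at e
      · rcases hx with rfl | rfl <;> rfl
  fin_cases x <;> fin_cases x'
  exacts [Glue.of_subset subset_rfl, lower, middle (Or.inl rfl) (Or.inl rfl),
    middle (Or.inl rfl) (Or.inr rfl), lower.symm, Glue.of_subset subset_rfl,
    middle (Or.inr rfl) (Or.inl rfl), middle (Or.inr rfl) (Or.inr rfl),
    (middle (Or.inl rfl) (Or.inl rfl)).symm, (middle (Or.inr rfl) (Or.inl rfl)).symm,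
    Glue.of_subset subset_rfl, upper, (middle (Or.inl rfl) (Or.inr rfl)).symm,
    (middle (Or.inr rfl) (Or.inr rfl)).symm, upper.symm, Glue.of_subset subset_rfl]

theorem glue_vert (τ τ' : X.Triangle) : Glue (Set.range (X.vert τ)) (Set.range (X.vert τ')) := by
  rcases τ with ⟨j, k⟩ | ⟨k, x⟩ <;> rcases τ' with ⟨j', k'⟩ | ⟨k', x'⟩
  · exact X.glue_disk j j' k k'
  · exact (X.glue_band_disk k' x' j k).symm
  · exact X.glue_band_disk k x j' k'
  · rcases lt_trichotomy k k' with h | rfl | h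
    · exact X.glue_band_lt h x x'
    · exact X.glue_band_self k x x'
    · exact (X.glue_band_lt h x' x).symm

/-- The triangulated surface spanned by a closed braid: a stack of disks joined by half-twisted
bands. -/
def surface : OrientedTriangles X.Triangle where
  v := X.vert
  indep := X.affineIndependent_vert
  inter := X.glue_vert
  range_injective τ τ' h := X.label_range_injective τ τ' <| by
    have e : ∀ τ, Set.range (X.vert τ) = X.pos '' Set.range (X.label τ) := fun τ => by
      rw [← Set.range_comp]; rfl
    rw [e, e] at h
    exact X.pos_injective.image_injective h
  directed τ τ' s s' h h' :=
    X.label_directed τ τ' s s' (X.pos_injective h) (X.pos_injective h')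

end Crossings

/-- If the boundary is connected, then a labelling of the boundary vertices that is constant along
the boundary edges is constant. -/
theorem OrientedTriangles.label_eq_of_connected {ι : Type*} [Finite ι] (D : OrientedTriangles ι)
    (hD : IsPreconnected (boundary D.complex)) (L : R3 → Prop)
    (hL : ∀ a b, D.IsBoundaryEdge a b → (L a ↔ L b)) {a b a' b' : R3}
    (h : D.IsBoundaryEdge a b) (h' : D.IsBoundaryEdge a' b') : L a → L a' := by
  classical
  intro ha
  by_contra ha'
  -- The union of the boundary edges whose initial vertex satisfies `P`: finitely many segments,
  -- hence a closed set.
  obtain ⟨part, hmem, hclosed⟩ : ∃ part : (R3 → Prop) → Set R3,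
      (∀ P p, p ∈ part P ↔ ∃ a b, D.IsBoundaryEdge a b ∧ P a ∧ p ∈ segment ℝ a b) ∧
      ∀ P, IsClosed (part P) := by
    refine ⟨fun P => ⋃ x ∈ {x : ι × Fin 3 | D.IsBoundaryEdge (D.v x.1 x.2) (D.v x.1 (x.2 + 1)) ∧
      P (D.v x.1 x.2)}, segment ℝ (D.v x.1 x.2) (D.v x.1 (x.2 + 1)), fun P p => ?_, fun P => ?_⟩
    · simp only [Set.mem_iUnion, exists_prop]
      constructor
      · rintro ⟨x, ⟨h1, h2⟩, h3⟩
        exact ⟨_, _, h1, h2, h3⟩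
      · rintro ⟨a, b, h1, h2, h3⟩
        obtain ⟨⟨τ, s, rfl, rfl⟩, -⟩ := id h1
        exact ⟨(τ, s), ⟨h1, h2⟩, h3⟩
    · refine (Set.toFinite _).isClosed_biUnion fun x _ => ?_
      rw [← convexHull_pair]
      exact (Set.toFinite _).isClosed_convexHull ℝ
  have hbd : ∀ p, p ∈ boundary D.complex ↔ ∃ a b, D.IsBoundaryEdge a b ∧ p ∈ segment ℝ a b := by
    intro p
    rw [D.boundary_complex]
    simp
  obtain ⟨p, -, hp, hp'⟩ := isPreconnected_closed_iff.1 hD (part L) (part fun q => ¬ L q)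
    (hclosed _) (hclosed _) (by
      intro p hp
      obtain ⟨a, b, h1, h2⟩ := (hbd p).1 hp
      by_cases hLa : L a
      · exact Or.inl ((hmem _ _).2 ⟨a, b, h1, hLa, h2⟩)
      · exact Or.inr ((hmem _ _).2 ⟨a, b, h1, hLa, h2⟩))
    ⟨a, (hbd a).2 ⟨a, b, h, left_mem_segment ℝ a b⟩,
      (hmem _ _).2 ⟨a, b, h, ha, left_mem_segment ℝ a b⟩⟩
    ⟨a', (hbd a').2 ⟨a', b', h', left_mem_segment ℝ a' b'⟩,
      (hmem _ _).2 ⟨a', b', h', ha', left_mem_segment ℝ a' b'⟩⟩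
  obtain ⟨u, v, huv, hu, hp⟩ := (hmem _ _).1 hp
  obtain ⟨u', v', huv', hu', hp'⟩ := (hmem _ _).1 hp'
  have face : ∀ {u v}, D.IsBoundaryEdge u v → ({u, v} : Finset R3) ∈ D.complex.faces := by
    rintro u v ⟨⟨τ, s, rfl, rfl⟩, -⟩
    exact (D.mem_simplices_one.2 ⟨τ, s, rfl⟩).1
  -- Edges of a simplicial complex that share a point share a vertex, and this vertex would get both
  -- labels.
  have key := D.complex.inter_subset_convexHull (face huv) (face huv')
    (show p ∈ _ from ⟨by rwa [Finset.coe_pair, convexHull_pair],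
      by rwa [Finset.coe_pair, convexHull_pair]⟩)
  obtain ⟨q, hq, hq'⟩ := convexHull_nonempty_iff.1 ⟨p, key⟩
  have h1 : L q := by
    simp only [Finset.coe_pair, Set.mem_insert_iff, Set.mem_singleton_iff] at hq
    rcases hq with rfl | rfl
    · exact hu
    · exact (hL _ _ huv).1 hu
  have h2 : ¬ L q := by
    simp only [Finset.coe_pair, Set.mem_insert_iff, Set.mem_singleton_iff] at hq'
    rcases hq' with rfl | rfl
    · exact hu'
    · exact fun h => hu' ((hL _ _ huv').2 h)
  exact h2 h1

namespace Crossings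

variable (X : Crossings)

/-! ### The surface of a closed braid: its edges -/

/-- The directed edges of the oriented triangles. -/
inductive DirEdge : Vertex → Vertex → Prop
  | spoke_out {j k} (hj : j < X.n) (hk : k < X.c + 2) : DirEdge (apex j) (rim j k)
  | rim {j k} (hj : j < X.n) (hk : k < X.c + 2) : DirEdge (rim j k) (rim j (k + 1))
  | spoke_in {j k} (hj : j < X.n) (hk : k < X.c + 2) : DirEdge (rim j (k + 1)) (apex j)
  | low_rising {k} (hk : k < X.c) : DirEdge (Vertex.rim (X.i k) k) (rising k)
  | rising_falling {k} (hk : k < X.c) : DirEdge (rising k) (falling k)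
  | falling_low {k} (hk : k < X.c) : DirEdge (falling k) (Vertex.rim (X.i k) k)
  | low_low {k} (hk : k < X.c) : DirEdge (Vertex.rim (X.i k) (k + 1)) (Vertex.rim (X.i k) k)
  | low_falling {k} (hk : k < X.c) : DirEdge (Vertex.rim (X.i k) k) (falling k)
  | falling_low' {k} (hk : k < X.c) : DirEdge (falling k) (Vertex.rim (X.i k) (k + 1))
  | rising_high {k} (hk : k < X.c) : DirEdge (rising k) (Vertex.rim (X.i k + 1) (k + 1))
  | high_falling {k} (hk : k < X.c) : DirEdge (Vertex.rim (X.i k + 1) (k + 1)) (falling k)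
  | falling_rising {k} (hk : k < X.c) : DirEdge (falling k) (rising k)
  | high_high {k} (hk : k < X.c) :
      DirEdge (Vertex.rim (X.i k + 1) (k + 1)) (Vertex.rim (X.i k + 1) k)
  | high_falling' {k} (hk : k < X.c) : DirEdge (Vertex.rim (X.i k + 1) k) (falling k)
  | falling_high {k} (hk : k < X.c) : DirEdge (falling k) (Vertex.rim (X.i k + 1) (k + 1))

theorem dirEdge_iff {a b : Vertex} :
    X.DirEdge a b ↔ ∃ τ s, X.label τ s = a ∧ X.label τ (s + 1) = b := by
  constructor
  · intro h
    cases h with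
    | @spoke_out j k hj hk => exact ⟨Sum.inl (⟨j, hj⟩, ⟨k, hk⟩), 0, rfl, rfl⟩
    | @rim j k hj hk => exact ⟨Sum.inl (⟨j, hj⟩, ⟨k, hk⟩), 1, rfl, rfl⟩
    | @spoke_in j k hj hk => exact ⟨Sum.inl (⟨j, hj⟩, ⟨k, hk⟩), 2, rfl, rfl⟩
    | @low_rising k hk => exact ⟨Sum.inr (⟨k, hk⟩, 0), 0, rfl, rfl⟩
    | @rising_falling k hk => exact ⟨Sum.inr (⟨k, hk⟩, 0), 1, rfl, rfl⟩
    | @falling_low k hk => exact ⟨Sum.inr (⟨k, hk⟩, 0), 2, rfl, rfl⟩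
    | @low_low k hk => exact ⟨Sum.inr (⟨k, hk⟩, 1), 0, rfl, rfl⟩
    | @low_falling k hk => exact ⟨Sum.inr (⟨k, hk⟩, 1), 1, rfl, rfl⟩
    | @falling_low' k hk => exact ⟨Sum.inr (⟨k, hk⟩, 1), 2, rfl, rfl⟩
    | @rising_high k hk => exact ⟨Sum.inr (⟨k, hk⟩, 2), 0, rfl, rfl⟩
    | @high_falling k hk => exact ⟨Sum.inr (⟨k, hk⟩, 2), 1, rfl, rfl⟩
    | @falling_rising k hk => exact ⟨Sum.inr (⟨k, hk⟩, 2), 2, rfl, rfl⟩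
    | @high_high k hk => exact ⟨Sum.inr (⟨k, hk⟩, 3), 0, rfl, rfl⟩
    | @high_falling' k hk => exact ⟨Sum.inr (⟨k, hk⟩, 3), 1, rfl, rfl⟩
    | @falling_high k hk => exact ⟨Sum.inr (⟨k, hk⟩, 3), 2, rfl, rfl⟩
  · rintro ⟨⟨j, k⟩ | ⟨k, x⟩, s, rfl, rfl⟩
    · fin_cases s
      exacts [.spoke_out j.2 k.2, .rim j.2 k.2, .spoke_in j.2 k.2]
    · fin_cases x <;> fin_cases s
      exacts [.low_rising k.2, .rising_falling k.2, .falling_low k.2, .low_low k.2,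
        .low_falling k.2, .falling_low' k.2, .rising_high k.2, .high_falling k.2,
        .falling_rising k.2, .high_high k.2, .high_falling' k.2, .falling_high k.2]

/-- The directed edges on the boundary. -/
inductive BoundaryEdge : Vertex → Vertex → Prop
  | spoke_out {j} (hj : j < X.n) : BoundaryEdge (apex j) (rim j 0)
  | rim {j k} (hj : j < X.n) (hk : k < X.c + 2)
      (h : k < X.c → j ≠ X.i k ∧ j ≠ X.i k + 1) : BoundaryEdge (rim j k) (rim j (k + 1))
  | spoke_in {j} (hj : j < X.n) : BoundaryEdge (Vertex.rim j (X.c + 2)) (apex j)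
  | low_rising {k} (hk : k < X.c) : BoundaryEdge (Vertex.rim (X.i k) k) (rising k)
  | rising_high {k} (hk : k < X.c) : BoundaryEdge (rising k) (Vertex.rim (X.i k + 1) (k + 1))
  | high_falling {k} (hk : k < X.c) : BoundaryEdge (Vertex.rim (X.i k + 1) k) (falling k)
  | falling_low {k} (hk : k < X.c) : BoundaryEdge (falling k) (Vertex.rim (X.i k) (k + 1))

/-- Three kinds of edges cancel in pairs: the inner spokes of the disks, the inner edges of the
bands and the rim edges at which a band is attached. -/
theorem boundaryEdge_iff {a b : Vertex} :
    X.BoundaryEdge a b ↔ X.DirEdge a b ∧ ¬ X.DirEdge b a := by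
  constructor
  · intro h
    cases h with
    | spoke_out hj =>
      refine ⟨.spoke_out hj (by omega), fun h => ?_⟩
      generalize he : Vertex.rim _ 0 = e at h
      cases h; simp at he
    | @rim j k hj hk h =>
      refine ⟨.rim hj hk, fun h' => ?_⟩
      generalize he : Vertex.rim j (k + 1) = e at h'
      generalize he' : Vertex.rim j k = e' at h'
      cases h' <;> grind
    | spoke_in hj =>
      refine ⟨.spoke_in hj (by omega), fun h => ?_⟩
      generalize he : Vertex.rim _ (X.c + 2) = e at h
      cases h; grind
    | low_rising hk =>
      refine ⟨.low_rising hk, fun h => ?_⟩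
      generalize he : Vertex.rim _ _ = e at h
      cases h <;> grind
    | rising_high hk =>
      refine ⟨.rising_high hk, fun h => ?_⟩
      generalize he : Vertex.rim _ _ = e at h
      cases h <;> grind
    | high_falling hk =>
      refine ⟨.high_falling' hk, fun h => ?_⟩
      generalize he : Vertex.rim _ _ = e at h
      cases h <;> grind
    | falling_low hk =>
      refine ⟨.falling_low' hk, fun h => ?_⟩
      generalize he : Vertex.rim _ _ = e at h
      cases h <;> grind
  · rintro ⟨h, h'⟩
    cases h with
    | @spoke_out j k hj hk =>
      rcases k with _ | k
      · exact .spoke_out hj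
      · exact absurd (.spoke_in hj (by omega)) h'
    | @rim j k hj hk =>
      refine .rim hj hk fun hk' => ⟨?_, ?_⟩
      · rintro rfl; exact h' (.low_low hk')
      · rintro rfl; exact h' (.high_high hk')
    | @spoke_in j k hj hk =>
      rcases Nat.lt_or_eq_of_le (by omega : k + 1 ≤ X.c + 2) with hk' | hk'
      · exact absurd (.spoke_out hj hk') h'
      · rw [hk']; exact .spoke_in hj
    | low_rising hk => exact .low_rising hk
    | rising_falling hk => exact absurd (.falling_rising hk) h'
    | falling_low hk => exact absurd (.low_falling hk) h'
    | low_low hk => exact absurd (.rim (Nat.lt_of_succ_lt (X.i_lt _ hk)) (by omega)) h'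
    | low_falling hk => exact absurd (.falling_low hk) h'
    | falling_low' hk => exact .falling_low hk
    | rising_high hk => exact .rising_high hk
    | high_falling hk => exact absurd (.falling_high hk) h'
    | falling_rising hk => exact absurd (.rising_falling hk) h'
    | high_high hk => exact absurd (.rim (X.i_lt _ hk) (by omega)) h'
    | high_falling' hk => exact .high_falling hk
    | falling_high hk => exact absurd (.high_falling hk) h'

theorem hasEdge_iff {p q : R3} : (∃ τ, X.surface.HasEdge τ p q) ↔
    ∃ a b, X.DirEdge a b ∧ X.pos a = p ∧ X.pos b = q := by
  constructor
  · rintro ⟨τ, s, rfl, rfl⟩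
    exact ⟨_, _, X.dirEdge_iff.2 ⟨τ, s, rfl, rfl⟩, rfl, rfl⟩
  · rintro ⟨a, b, h, rfl, rfl⟩
    obtain ⟨τ, s, rfl, rfl⟩ := X.dirEdge_iff.1 h
    exact ⟨τ, s, rfl, rfl⟩

theorem isBoundaryEdge_iff {p q : R3} : X.surface.IsBoundaryEdge p q ↔
    ∃ a b, X.BoundaryEdge a b ∧ X.pos a = p ∧ X.pos b = q := by
  rw [OrientedTriangles.IsBoundaryEdge, ← not_exists, hasEdge_iff, hasEdge_iff]
  constructor
  · rintro ⟨⟨a, b, h, rfl, rfl⟩, h'⟩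
    exact ⟨a, b, X.boundaryEdge_iff.2 ⟨h, fun h2 => h' ⟨b, a, h2, rfl, rfl⟩⟩, rfl, rfl⟩
  · rintro ⟨a, b, h, rfl, rfl⟩
    obtain ⟨h1, h2⟩ := X.boundaryEdge_iff.1 h
    refine ⟨⟨a, b, h1, rfl, rfl⟩, ?_⟩
    rintro ⟨b', a', h3, hb, ha⟩
    rw [X.pos_injective hb, X.pos_injective ha] at h3
    exact h2 h3

theorem mem_boundary_surface {p : R3} : p ∈ boundary X.surface.complex ↔
    ∃ a b, X.BoundaryEdge a b ∧ p ∈ segment ℝ (X.pos a) (X.pos b) := by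
  rw [X.surface.boundary_complex]
  simp only [Set.mem_iUnion, exists_prop]
  constructor
  · rintro ⟨q, hq, hp⟩
    obtain ⟨a, b, h, h1, h2⟩ := X.isBoundaryEdge_iff.1 hq
    exact ⟨a, b, h, by rwa [h1, h2]⟩
  · rintro ⟨a, b, h, hp⟩
    exact ⟨(X.pos a, X.pos b), X.isBoundaryEdge_iff.2 ⟨a, b, h, rfl, rfl⟩, hp⟩

theorem label_eq_of_connected (hX : IsPreconnected (boundary X.surface.complex))
    (L : Vertex → Prop) (hL : ∀ a b, X.BoundaryEdge a b → (L a ↔ L b)) {a b a' b' : Vertex}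
    (h : X.BoundaryEdge a b) (h' : X.BoundaryEdge a' b') (ha : L a) : L a' := by
  have key : ∀ u, (∃ u', X.pos u' = X.pos u ∧ L u') ↔ L u := fun u =>
    ⟨fun ⟨u', e, hu⟩ => X.pos_injective e ▸ hu, fun hu => ⟨u, rfl, hu⟩⟩
  refine (key _).1 (X.surface.label_eq_of_connected hX (fun p => ∃ u, X.pos u = p ∧ L u) ?_
    (X.isBoundaryEdge_iff.2 ⟨a, b, h, rfl, rfl⟩) (X.isBoundaryEdge_iff.2 ⟨a', b', h', rfl, rfl⟩)
    ((key _).2 ha))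
  intro p q hpq
  obtain ⟨u, v, huv, rfl, rfl⟩ := X.isBoundaryEdge_iff.1 hpq
  rw [key, key]
  exact hL u v huv

end Crossings

namespace Crossings

variable (X : Crossings)

/-! ### The surface of a closed braid: links and connectedness -/

/-- The triangle `τ` has the vertex `a`. -/
def HasVertex (τ : X.Triangle) (a : Vertex) : Prop := ∃ s, X.label τ s = a

/-- Two triangles have an edge at the vertex `a` in common. -/
def AdjAt (a : Vertex) (τ τ' : X.Triangle) : Prop :=
  ∃ b, a ≠ b ∧ X.HasVertex τ a ∧ X.HasVertex τ b ∧ X.HasVertex τ' a ∧ X.HasVertex τ' b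

/-- Two triangles can be joined by a chain of triangles around the vertex `a`. -/
abbrev JoinedAt (a : Vertex) : X.Triangle → X.Triangle → Prop := Relation.ReflTransGen (X.AdjAt a)

variable {X}

theorem AdjAt.symm {a : Vertex} {τ τ' : X.Triangle} (h : X.AdjAt a τ τ') : X.AdjAt a τ' τ := by
  obtain ⟨b, h0, h1, h2, h3, h4⟩ := h
  exact ⟨b, h0, h3, h4, h1, h2⟩

theorem JoinedAt.symm {a : Vertex} {τ τ' : X.Triangle} (h : X.JoinedAt a τ τ') :
    X.JoinedAt a τ' τ :=
  Relation.ReflTransGen.mono (fun _ _ h => AdjAt.symm h) _ _ (Relation.ReflTransGen.swap _ _ h)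

theorem joinedAt_of_labels {τ τ' : X.Triangle} {a b : Vertex} (s t s' t' : Fin 3)
    (hab : a ≠ b) (h1 : X.label τ s = a) (h2 : X.label τ t = b) (h3 : X.label τ' s' = a)
    (h4 : X.label τ' t' = b) : X.JoinedAt a τ τ' :=
  Relation.ReflTransGen.single ⟨b, hab, ⟨s, h1⟩, ⟨t, h2⟩, ⟨s', h3⟩, ⟨t', h4⟩⟩

theorem joinedAt_apex (j : Fin X.n) (k : ℕ) (hk : k < X.c + 2) :
    X.JoinedAt (apex j) (Sum.inl (j, ⟨k, hk⟩)) (Sum.inl (j, 0)) := by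
  induction k with
  | zero => exact Relation.ReflTransGen.refl
  | succ k ih =>
    refine (joinedAt_of_labels (a := apex j) (b := rim j (k + 1)) 0 1 0 2 (by simp) rfl rfl rfl rfl).trans
      (ih (by omega))

theorem joinedAt_rim_succ (j : Fin X.n) {k : ℕ} (hk : k + 1 < X.c + 2) :
    X.JoinedAt (rim j (k + 1)) (Sum.inl (j, ⟨k, by omega⟩)) (Sum.inl (j, ⟨k + 1, hk⟩)) :=
  joinedAt_of_labels (b := apex j) 2 0 1 0 (by simp) rfl rfl rfl rfl

/-- The lower strand of a crossing. -/
def low (k : Fin X.c) : Fin X.n := ⟨X.i k, by have := X.i_lt k k.2; omega⟩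

/-- The upper strand of a crossing. -/
def high (k : Fin X.c) : Fin X.n := ⟨X.i k + 1, X.i_lt k k.2⟩

/-- A triangle of the disk at the given vertex of its rim. -/
def rimTriangle (j : Fin X.n) (k : ℕ) : X.Triangle :=
  if h : k < X.c + 2 then Sum.inl (j, ⟨k, h⟩) else Sum.inl (j, Fin.last _)

theorem rimTriangle_of_lt (j : Fin X.n) {k : ℕ} (h : k < X.c + 2) :
    rimTriangle j k = Sum.inl (j, ⟨k, h⟩) := dif_pos h

theorem joinedAt_rimTriangle_disk (j : Fin X.n) (k : Fin (X.c + 2)) :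
    X.JoinedAt (rim j (k + 1)) (Sum.inl (j, k)) (rimTriangle j (k + 1)) := by
  by_cases h : (k : ℕ) + 1 < X.c + 2
  · rw [rimTriangle_of_lt j h]
    exact joinedAt_rim_succ j h
  · have : k = Fin.last _ := by ext; simp; omega
    rw [rimTriangle, dif_neg h, this]

/-- The triangles of a band at a rim vertex lead across the rim edge of attachment into the disk.
The disk triangles at the vertex have a spoke in common, so all chains can end at the same one. -/
theorem joinedAt_rimTriangle {τ : X.Triangle} {j : Fin X.n} {k : ℕ}
    (h : X.HasVertex τ (rim j k)) : X.JoinedAt (rim j k) τ (rimTriangle j k) := by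
  obtain ⟨s, h⟩ := h
  rcases τ with ⟨j', k'⟩ | ⟨k', x⟩
  · fin_cases s
    · simp [label] at h
    · simp only [label, Fin.reduceFinMk, Matrix.cons_val, rim.injEq] at h
      obtain ⟨h1, rfl⟩ := h
      obtain rfl := Fin.ext h1
      rw [rimTriangle_of_lt _ k'.2]
    · simp only [label, Fin.reduceFinMk, Matrix.cons_val, rim.injEq] at h
      obtain ⟨h1, rfl⟩ := h
      obtain rfl := Fin.ext h1
      exact joinedAt_rimTriangle_disk _ _
  · have hk := k'.2
    have low_disk : X.JoinedAt (rim (X.i k') k') (Sum.inr (k', 1))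
        (rimTriangle (low k') k') := by
      rw [rimTriangle_of_lt _ (by omega)]
      exact joinedAt_of_labels (b := rim (X.i k') (k' + 1)) 1 0 1 2 (by simp) rfl rfl rfl rfl
    have low_disk' : X.JoinedAt (rim (X.i k') (k' + 1)) (Sum.inr (k', 1))
        (rimTriangle (low k') (k' + 1)) :=
      (joinedAt_of_labels (a := rim (X.i k') (k' + 1)) (b := rim (X.i k') k')
        (τ' := Sum.inl (low k', ⟨k', by omega⟩)) 0 1 2 1 (by simp) rfl rfl rfl rfl).trans
        (joinedAt_rimTriangle_disk (low k') ⟨k', by omega⟩)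
    have high_disk : X.JoinedAt (rim (X.i k' + 1) k') (Sum.inr (k', 3))
        (rimTriangle (high k') k') := by
      rw [rimTriangle_of_lt _ (by omega)]
      exact joinedAt_of_labels (b := rim (X.i k' + 1) (k' + 1)) 1 0 1 2 (by simp) rfl rfl rfl rfl
    have high_disk' : X.JoinedAt (rim (X.i k' + 1) (k' + 1)) (Sum.inr (k', 3))
        (rimTriangle (high k') (k' + 1)) :=
      (joinedAt_of_labels (a := rim (X.i k' + 1) (k' + 1)) (b := rim (X.i k' + 1) k')
        (τ' := Sum.inl (high k', ⟨k', by omega⟩)) 0 1 2 1 (by simp) rfl rfl rfl rfl).trans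
        (joinedAt_rimTriangle_disk (high k') ⟨k', by omega⟩)
    fin_cases x <;> fin_cases s <;>
      simp only [label, Fin.reduceFinMk, Matrix.cons_val, rim.injEq, reduceCtorEq] at h
    all_goals
      obtain ⟨h1, rfl⟩ := h
    · obtain rfl : low k' = j := Fin.ext h1
      exact (joinedAt_of_labels (a := rim (X.i k') k') (b := falling k') 0 2 1 2 (by simp)
        rfl rfl rfl rfl).trans low_disk
    · obtain rfl : low k' = j := Fin.ext h1
      exact low_disk'
    · obtain rfl : low k' = j := Fin.ext h1
      exact low_disk
    · obtain rfl : high k' = j := Fin.ext h1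
      exact (joinedAt_of_labels (a := rim (X.i k' + 1) (k' + 1)) (b := falling k') 1 2 0 2
        (by simp) rfl rfl rfl rfl).trans high_disk'
    · obtain rfl : high k' = j := Fin.ext h1
      exact high_disk'
    · obtain rfl : high k' = j := Fin.ext h1
      exact high_disk

theorem joinedAt_rising {τ : X.Triangle} {k : Fin X.c} (h : X.HasVertex τ (rising k)) :
    X.JoinedAt (rising k) τ (Sum.inr (k, 0)) := by
  obtain ⟨s, h⟩ := h
  rcases τ with ⟨j', k'⟩ | ⟨k', x⟩
  · fin_cases s <;> simp [label] at h
  · fin_cases x <;> fin_cases s <;>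
      simp only [label, Fin.reduceFinMk, Matrix.cons_val, rising.injEq, reduceCtorEq] at h
    all_goals obtain rfl := Fin.ext h
    · exact Relation.ReflTransGen.refl
    · exact joinedAt_of_labels (b := falling k') 0 2 1 2 (by simp) rfl rfl rfl rfl

theorem joinedAt_falling {τ : X.Triangle} {k : Fin X.c} (h : X.HasVertex τ (falling k)) :
    X.JoinedAt (falling k) τ (Sum.inr (k, 0)) := by
  obtain ⟨s, h⟩ := h
  rcases τ with ⟨j', k'⟩ | ⟨k', x⟩
  · fin_cases s <;> simp [label] at h
  · have h2 : X.JoinedAt (falling k') (Sum.inr (k', 2)) (Sum.inr (k', 0)) :=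
      joinedAt_of_labels (b := rising k') 2 0 2 1 (by simp) rfl rfl rfl rfl
    fin_cases x <;> fin_cases s <;>
      simp only [label, Fin.reduceFinMk, Matrix.cons_val, falling.injEq, reduceCtorEq] at h
    all_goals obtain rfl := Fin.ext h
    · exact Relation.ReflTransGen.refl
    · exact joinedAt_of_labels (b := rim (X.i k') k') 2 1 2 0 (by simp) rfl rfl rfl rfl
    · exact h2
    · exact (joinedAt_of_labels (a := falling k') (b := rim (X.i k' + 1) (k' + 1)) 2 0 2 1 (by simp)
        rfl rfl rfl rfl).trans h2

theorem HasVertex.vertex_cases {τ : X.Triangle} {a : Vertex} (h : X.HasVertex τ a) :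
    (∃ (j : Fin X.n) (k : Fin (X.c + 3)), a = rim j k) ∨ (∃ j : Fin X.n, a = apex j) ∨
      (∃ k : Fin X.c, a = rising k) ∨ ∃ k : Fin X.c, a = falling k := by
  obtain ⟨s, rfl⟩ := h
  rcases τ with ⟨j, k⟩ | ⟨k, x⟩
  · have := k.2
    fin_cases s
    · exact Or.inr (Or.inl ⟨j, rfl⟩)
    · exact Or.inl ⟨j, ⟨k, by omega⟩, rfl⟩
    · exact Or.inl ⟨j, ⟨k + 1, by omega⟩, rfl⟩
  · have := k.2
    fin_cases x <;> fin_cases s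
    · exact Or.inl ⟨low k, ⟨k, by omega⟩, rfl⟩
    · exact Or.inr (Or.inr (Or.inl ⟨k, rfl⟩))
    · exact Or.inr (Or.inr (Or.inr ⟨k, rfl⟩))
    · exact Or.inl ⟨low k, ⟨k + 1, by omega⟩, rfl⟩
    · exact Or.inl ⟨low k, ⟨k, by omega⟩, rfl⟩
    · exact Or.inr (Or.inr (Or.inr ⟨k, rfl⟩))
    · exact Or.inr (Or.inr (Or.inl ⟨k, rfl⟩))
    · exact Or.inl ⟨high k, ⟨k + 1, by omega⟩, rfl⟩
    · exact Or.inr (Or.inr (Or.inr ⟨k, rfl⟩))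
    · exact Or.inl ⟨high k, ⟨k + 1, by omega⟩, rfl⟩
    · exact Or.inl ⟨high k, ⟨k, by omega⟩, rfl⟩
    · exact Or.inr (Or.inr (Or.inr ⟨k, rfl⟩))

theorem joinedAt {τ τ' : X.Triangle} {a : Vertex} (h : X.HasVertex τ a) (h' : X.HasVertex τ' a) :
    X.JoinedAt a τ τ' := by
  rcases h.vertex_cases with ⟨j, k, rfl⟩ | ⟨j, rfl⟩ | ⟨k, rfl⟩ | ⟨k, rfl⟩
  · exact (joinedAt_rimTriangle h).trans (joinedAt_rimTriangle h').symm
  · have key : ∀ {τ : X.Triangle}, X.HasVertex τ (apex j) →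
        X.JoinedAt (apex j) τ (Sum.inl (j, 0)) := by
      rintro (⟨j', k'⟩ | ⟨k', x⟩) ⟨s, h⟩
      · fin_cases s <;>
          simp only [label, Fin.reduceFinMk, Matrix.cons_val, apex.injEq, reduceCtorEq] at h
        obtain rfl := Fin.ext h
        exact joinedAt_apex j' k' k'.2
      · fin_cases x <;> fin_cases s <;> simp [label] at h
    exact (key h).trans (key h').symm
  · exact (joinedAt_rising h).trans (joinedAt_rising h').symm
  · exact (joinedAt_falling h).trans (joinedAt_falling h').symm

theorem pos_mem_tri {τ : X.Triangle} {a : Vertex} :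
    X.pos a ∈ X.surface.tri τ ↔ X.HasVertex τ a := by
  rw [OrientedTriangles.mem_tri]
  exact ⟨fun ⟨s, h⟩ => ⟨s, X.pos_injective h⟩, fun ⟨s, h⟩ => ⟨s, congrArg X.pos h⟩⟩

variable (X)

theorem link_surface {v : R3} {s t : Finset R3} (hs : s ∈ trianglesAt X.surface.complex {v})
    (ht : t ∈ trianglesAt X.surface.complex {v}) :
    Relation.ReflTransGen (fun s' t' => ∃ e ∈ simplices X.surface.complex 1, v ∈ e ∧
      s' ∈ trianglesAt X.surface.complex e ∧ t' ∈ trianglesAt X.surface.complex e) s t := by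
  classical
  obtain ⟨hs, hvs⟩ := hs
  obtain ⟨ht, hvt⟩ := ht
  obtain ⟨τ, rfl⟩ := X.surface.mem_simplices_two.1 hs
  obtain ⟨τ', rfl⟩ := X.surface.mem_simplices_two.1 ht
  rw [Finset.singleton_subset_iff] at hvs hvt
  obtain ⟨a, ha⟩ := X.surface.mem_tri.1 hvs
  obtain rfl : X.pos (X.label τ a) = v := ha
  refine Relation.ReflTransGen.lift X.surface.tri ?_ _ _ (joinedAt (pos_mem_tri.1 hvs)
    (pos_mem_tri.1 hvt))
  rintro σ σ' ⟨b, hab, h1, h2, h3, h4⟩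
  have hsub : ∀ {σ}, X.HasVertex σ (X.label τ a) → X.HasVertex σ b →
      ({X.pos (X.label τ a), X.pos b} : Finset R3) ⊆ X.surface.tri σ := by
    intro σ h h' p hp
    simp only [Finset.mem_insert, Finset.mem_singleton] at hp
    rcases hp with rfl | rfl
    · exact pos_mem_tri.2 h
    · exact pos_mem_tri.2 h'
  refine ⟨{X.pos (X.label τ a), X.pos b}, ⟨⟨by simp, σ, hsub h1 h2⟩,
    Finset.card_pair (X.pos_injective.ne hab)⟩, by simp,
    ⟨X.surface.tri_mem_simplices σ, hsub h1 h2⟩, ⟨X.surface.tri_mem_simplices σ', hsub h3 h4⟩⟩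

/-- The surface is connected if every generator of the braid group occurs in the word. -/
theorem isConnected_surface (hn : 0 < X.n) (hX : ∀ j, j + 1 < X.n → ∃ k < X.c, X.i k = j) :
    IsConnected X.surface.complex.space := by
  rw [X.surface.space_complex]
  have : Nonempty X.Triangle := ⟨Sum.inl (⟨0, hn⟩, 0)⟩
  refine IsConnected.iUnion_of_reflTransGen (fun τ => ⟨⟨_, subset_convexHull ℝ _ ⟨0, rfl⟩⟩,
    (convex_convexHull ℝ _).isPreconnected⟩) ?_
  set R : X.Triangle → X.Triangle → Prop := fun τ τ' =>
    (convexHull ℝ (Set.range (X.surface.v τ)) ∩ convexHull ℝ (Set.range (X.surface.v τ'))).Nonempty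
  have hR : ∀ {τ τ' : X.Triangle} (s s' : Fin 3), X.label τ s = X.label τ' s' →
      Relation.ReflTransGen R τ τ' := fun {τ τ'} s s' h => Relation.ReflTransGen.single
    ⟨X.pos (X.label τ s), subset_convexHull ℝ _ ⟨s, rfl⟩,
      subset_convexHull ℝ _ ⟨s', congrArg X.pos h.symm⟩⟩
  have hsymm : ∀ {τ τ'}, Relation.ReflTransGen R τ τ' → Relation.ReflTransGen R τ' τ := fun h =>
    Relation.ReflTransGen.mono (r := Function.swap R) (p := R) (fun _ _ h => by
      simp only [R]; rw [Set.inter_comm]; exact h) _ _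
      (Relation.ReflTransGen.swap _ _ h)
  have disk : ∀ (j : Fin X.n) k k', Relation.ReflTransGen R (Sum.inl (j, k)) (Sum.inl (j, k')) :=
    fun j k k' => hR 0 0 rfl
  have disks : ∀ j (hj : j < X.n),
      Relation.ReflTransGen R (Sum.inl (⟨j, hj⟩, 0)) (Sum.inl (⟨0, hn⟩, 0)) := by
    intro j
    induction j with
    | zero => exact fun _ => Relation.ReflTransGen.refl
    | succ j ih =>
      intro hj
      -- A crossing between the heights `j` and `j + 1` connects the two disks through the triangles
      -- `3` and `0` of its band, which share the vertex `falling k`.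
      obtain ⟨k, hk, rfl⟩ := hX j hj
      have h1 : Relation.ReflTransGen R (Sum.inl (⟨X.i k + 1, hj⟩, ⟨k, by omega⟩))
        (Sum.inr (⟨k, hk⟩, 3)) := hR 1 1 rfl
      have h2 : Relation.ReflTransGen R (Sum.inr (⟨k, hk⟩, 3)) (Sum.inr (⟨k, hk⟩, 0)) :=
        hR 2 2 rfl
      have h3 : Relation.ReflTransGen R (Sum.inr (⟨k, hk⟩, 0))
        (Sum.inl (⟨X.i k, by omega⟩, ⟨k, by omega⟩)) := hR 0 1 rfl
      exact ((((disk _ _ _).trans h1).trans h2).trans h3).trans ((disk _ _ _).trans (ih _))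
  have all : ∀ τ, Relation.ReflTransGen R τ (Sum.inl (⟨0, hn⟩, 0)) := by
    rintro (⟨j, k⟩ | ⟨k, x⟩)
    · exact (disk _ _ _).trans (disks j j.2)
    · have h3 : Relation.ReflTransGen R (Sum.inr (k, 0))
        (Sum.inl (low k, ⟨k, by omega⟩)) := hR 0 1 rfl
      have h4 : Relation.ReflTransGen R (Sum.inr (k, x)) (Sum.inr (k, 0)) :=
        hR 2 2 (by fin_cases x <;> rfl)
      exact (h4.trans h3).trans ((disk _ _ _).trans (disks _ _))
  exact fun τ τ' => (all τ).trans (hsymm (all τ'))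

theorem isSurface (hn : 0 < X.n) (hX : ∀ j, j + 1 < X.n → ∃ k < X.c, X.i k = j) :
    IsSurface X.surface.complex where
  finite := X.surface.finite_faces
  pure _ hs := X.surface.exists_triangle hs
  edge _ he := X.surface.ncard_trianglesAt he
  link _ _ _ hs _ ht := X.link_surface hs ht
  connected := X.isConnected_surface hn hX
  orientable := X.surface.isOrientable

/-! ### The surface of a closed braid: its Euler characteristic -/

/-- An enumeration of the vertices. -/
def vertexOf : (Fin X.n × Fin (X.c + 3)) ⊕ Fin X.n ⊕ Fin X.c ⊕ Fin X.c → Vertex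
  | Sum.inl (j, k) => rim j k
  | Sum.inr (Sum.inl j) => apex j
  | Sum.inr (Sum.inr (Sum.inl k)) => rising k
  | Sum.inr (Sum.inr (Sum.inr k)) => falling k

theorem vertexOf_injective : Function.Injective X.vertexOf := by
  rintro (⟨j, k⟩ | j | k | k) (⟨j', k'⟩ | j' | k' | k') h <;> simp [vertexOf] at h ⊢ <;> grind

theorem ncard_vertices :
    (simplices X.surface.complex 0).ncard = X.n * (X.c + 3) + (X.n + (X.c + X.c)) := by
  have : simplices X.surface.complex 0 =
      Set.range fun u => ({X.pos (X.vertexOf u)} : Finset R3) := by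
    ext e
    rw [OrientedTriangles.mem_simplices_zero]
    constructor
    · rintro ⟨τ, s, rfl⟩
      have h : X.HasVertex τ (X.label τ s) := ⟨s, rfl⟩
      have he : X.surface.v τ s = X.pos (X.label τ s) := rfl
      rw [he]
      rcases h.vertex_cases with ⟨j, k, h⟩ | ⟨j, h⟩ | ⟨k, h⟩ | ⟨k, h⟩
      · exact ⟨Sum.inl (j, k), by rw [h]; rfl⟩
      · exact ⟨Sum.inr (Sum.inl j), by rw [h]; rfl⟩
      · exact ⟨Sum.inr (Sum.inr (Sum.inl k)), by rw [h]; rfl⟩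
      · exact ⟨Sum.inr (Sum.inr (Sum.inr k)), by rw [h]; rfl⟩
    · rintro ⟨⟨j, k⟩ | j | k | k, rfl⟩
      · rcases k with ⟨_ | k, hk⟩
        · exact ⟨Sum.inl (j, 0), 1, rfl⟩
        · exact ⟨Sum.inl (j, ⟨k, by omega⟩), 2, rfl⟩
      · exact ⟨Sum.inl (j, 0), 0, rfl⟩
      · exact ⟨Sum.inr (k, 0), 1, rfl⟩
      · exact ⟨Sum.inr (k, 0), 2, rfl⟩
  rw [this, Set.ncard_range_of_injective]
  · simp
  · intro u u' h
    exact X.vertexOf_injective (X.pos_injective (Finset.singleton_injective h))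

/-- An enumeration of the edges. -/
def edgeOf : (Fin X.n × Fin (X.c + 3)) ⊕ (Fin X.n × Fin (X.c + 2)) ⊕ (Fin X.c × Fin 7) →
    Vertex × Vertex
  | Sum.inl (j, k) => (apex j, rim j k)
  | Sum.inr (Sum.inl (j, k)) => (rim j k, rim j (k + 1))
  | Sum.inr (Sum.inr (k, 0)) => (rim (X.i k) k, rising k)
  | Sum.inr (Sum.inr (k, 1)) => (rising k, rim (X.i k + 1) (k + 1))
  | Sum.inr (Sum.inr (k, 2)) => (rim (X.i k + 1) k, falling k)
  | Sum.inr (Sum.inr (k, 3)) => (falling k, rim (X.i k) (k + 1))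
  | Sum.inr (Sum.inr (k, 4)) => (rising k, falling k)
  | Sum.inr (Sum.inr (k, 5)) => (falling k, rim (X.i k) k)
  | Sum.inr (Sum.inr (k, 6)) => (falling k, rim (X.i k + 1) (k + 1))

theorem edgeOf_injective {x x'} (h : X.edgeOf x = X.edgeOf x' ∨ X.edgeOf x = (X.edgeOf x').swap) :
    x = x' := by
  rcases x with ⟨j, k⟩ | ⟨j, k⟩ | ⟨k, y⟩ <;> rcases x' with ⟨j', k'⟩ | ⟨j', k'⟩ | ⟨k', y'⟩
  · simp [edgeOf] at h ⊢; grind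
  · simp [edgeOf] at h ⊢
  · fin_cases y' <;> simp [edgeOf] at h ⊢
  · simp [edgeOf] at h ⊢
  · simp [edgeOf] at h ⊢; grind
  · fin_cases y' <;> simp [edgeOf] at h ⊢
  · fin_cases y <;> simp [edgeOf] at h ⊢
  · fin_cases y <;> simp [edgeOf] at h ⊢
  · fin_cases y <;> fin_cases y' <;> simp [edgeOf] at h ⊢ <;> grind

theorem dirEdge_edgeOf (x) : X.DirEdge (X.edgeOf x).1 (X.edgeOf x).2 ∨
    X.DirEdge (X.edgeOf x).2 (X.edgeOf x).1 := by
  rcases x with ⟨j, k⟩ | ⟨j, k⟩ | ⟨k, y⟩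
  · rcases k with ⟨_ | k, hk⟩
    · exact Or.inl (.spoke_out j.2 (Nat.succ_pos _))
    · exact Or.inr (.spoke_in j.2 (by omega))
  · exact Or.inl (.rim j.2 k.2)
  · left
    fin_cases y
    exacts [.low_rising k.2, .rising_high k.2, .high_falling' k.2, .falling_low' k.2,
      .rising_falling k.2, .falling_low k.2, .falling_high k.2]

theorem DirEdge.exists_edgeOf {a b : Vertex} (h : X.DirEdge a b) :
    ∃ x, X.edgeOf x = (a, b) ∨ X.edgeOf x = (b, a) := by
  cases h with
  | @spoke_out j k hj hk => exact ⟨Sum.inl (⟨j, hj⟩, ⟨k, by omega⟩), Or.inl rfl⟩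
  | @rim j k hj hk => exact ⟨Sum.inr (Sum.inl (⟨j, hj⟩, ⟨k, hk⟩)), Or.inl rfl⟩
  | @spoke_in j k hj hk => exact ⟨Sum.inl (⟨j, hj⟩, ⟨k + 1, by omega⟩), Or.inr rfl⟩
  | @low_rising k hk => exact ⟨Sum.inr (Sum.inr (⟨k, hk⟩, 0)), Or.inl rfl⟩
  | @rising_falling k hk => exact ⟨Sum.inr (Sum.inr (⟨k, hk⟩, 4)), Or.inl rfl⟩
  | @falling_low k hk => exact ⟨Sum.inr (Sum.inr (⟨k, hk⟩, 5)), Or.inl rfl⟩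
  | @low_low k hk =>
    exact ⟨Sum.inr (Sum.inl (low ⟨k, hk⟩, ⟨k, by omega⟩)), Or.inr rfl⟩
  | @low_falling k hk => exact ⟨Sum.inr (Sum.inr (⟨k, hk⟩, 5)), Or.inr rfl⟩
  | @falling_low' k hk => exact ⟨Sum.inr (Sum.inr (⟨k, hk⟩, 3)), Or.inl rfl⟩
  | @rising_high k hk => exact ⟨Sum.inr (Sum.inr (⟨k, hk⟩, 1)), Or.inl rfl⟩
  | @high_falling k hk => exact ⟨Sum.inr (Sum.inr (⟨k, hk⟩, 6)), Or.inr rfl⟩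
  | @falling_rising k hk => exact ⟨Sum.inr (Sum.inr (⟨k, hk⟩, 4)), Or.inr rfl⟩
  | @high_high k hk =>
    exact ⟨Sum.inr (Sum.inl (high ⟨k, hk⟩, ⟨k, by omega⟩)), Or.inr rfl⟩
  | @high_falling' k hk => exact ⟨Sum.inr (Sum.inr (⟨k, hk⟩, 2)), Or.inl rfl⟩
  | @falling_high k hk => exact ⟨Sum.inr (Sum.inr (⟨k, hk⟩, 6)), Or.inl rfl⟩

open Classical in
theorem ncard_edges : (simplices X.surface.complex 1).ncard =
    X.n * (X.c + 3) + (X.n * (X.c + 2) + X.c * 7) := by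
  have : simplices X.surface.complex 1 = Set.range fun x =>
      ({X.pos (X.edgeOf x).1, X.pos (X.edgeOf x).2} : Finset R3) := by
    ext e
    rw [OrientedTriangles.mem_simplices_one]
    constructor
    · rintro ⟨τ, s, rfl⟩
      obtain ⟨x, hx | hx⟩ := DirEdge.exists_edgeOf X (X.dirEdge_iff.2 ⟨τ, s, rfl, rfl⟩)
      · exact ⟨x, by simp only [hx]; rfl⟩
      · exact ⟨x, by simp only [hx]; exact Finset.pair_comm _ _⟩
    · rintro ⟨x, rfl⟩
      rcases X.dirEdge_edgeOf x with h | h <;> obtain ⟨τ, s, h1, h2⟩ := X.dirEdge_iff.1 h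
      · exact ⟨τ, s, by simp only [← h1, ← h2]; rfl⟩
      · exact ⟨τ, s, by simp only [← h1, ← h2]; exact Finset.pair_comm _ _⟩
  rw [this, Set.ncard_range_of_injective]
  · simp
  · intro x x' h
    refine X.edgeOf_injective ?_
    have h' := congrArg (fun s : Finset R3 => (s : Set R3)) h
    simp only [Finset.coe_pair, Set.pair_eq_pair_iff] at h'
    rcases h' with ⟨h1, h2⟩ | ⟨h1, h2⟩
    · exact Or.inl (Prod.ext (X.pos_injective h1) (X.pos_injective h2))
    · exact Or.inr (Prod.ext (X.pos_injective h1) (X.pos_injective h2))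

theorem ncard_triangles :
    (simplices X.surface.complex 2).ncard = X.n * (X.c + 2) + X.c * 4 := by
  rw [X.surface.simplices_two, Set.ncard_range_of_injective X.surface.tri_injective]
  simp

/-- Each disk contributes `1`, and each band, with two new vertices, seven new edges and four
triangles, contributes `-1`. -/
theorem eulerChar_surface : eulerChar X.surface.complex = (X.n : ℤ) - X.c := by
  rw [eulerChar, ncard_vertices, ncard_edges, ncard_triangles]
  push_cast
  ring

end Crossings

/-! ### The permutation of a braid -/

namespace Crossings

variable (X : Crossings)

/-- The transposition of the strands at the `k`-th crossing. -/
def transposition (k : ℕ) : Equiv.Perm (Fin X.n) :=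
  if h : k < X.c then Equiv.swap (low ⟨k, h⟩) (high ⟨k, h⟩) else 1

/-- The permutation of the strands by the first `k` crossings. -/
def perm : ℕ → Equiv.Perm (Fin X.n)
  | 0 => 1
  | k + 1 => X.transposition k * perm k

theorem transposition_of_lt {k : ℕ} (h : k < X.c) :
    X.transposition k = Equiv.swap (low ⟨k, h⟩) (high ⟨k, h⟩) := dif_pos h

theorem perm_succ_inv_apply (k : ℕ) (x : Fin X.n) :
    (X.perm (k + 1))⁻¹ x = (X.perm k)⁻¹ (X.transposition k x) := by
  have : (X.transposition k)⁻¹ = X.transposition k := by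
    unfold transposition
    split_ifs <;> simp
  rw [perm, mul_inv_rev, this, Equiv.Perm.mul_apply]

theorem sign_perm {k : ℕ} (hk : k ≤ X.c) : Equiv.Perm.sign (X.perm k) = (-1) ^ k := by
  induction k with
  | zero => simp [perm]
  | succ k ih =>
    have hne : (low ⟨k, hk⟩ : Fin X.n) ≠ high ⟨k, hk⟩ := by simp [low, high]
    rw [perm, Equiv.Perm.sign_mul, ih (by omega), X.transposition_of_lt hk,
      Equiv.Perm.sign_swap hne, pow_succ, mul_comm]

/-- The labelling of the vertices on the boundary that a set of strands defines. -/
def strandLabel (S : Set (Fin X.n)) : Vertex → Prop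
  | rim j k => ∃ h : j < X.n, (X.perm k)⁻¹ ⟨j, h⟩ ∈ S
  | apex j => ∃ h : j < X.n, ⟨j, h⟩ ∈ S
  | rising k => ∃ h : k < X.c, (X.perm k)⁻¹ (low ⟨k, h⟩) ∈ S
  | falling k => ∃ h : k < X.c, (X.perm k)⁻¹ (high ⟨k, h⟩) ∈ S

/-- A vertex is labelled by the initial height of the strand through it. Inside the columns this is
constant along a strand by the definition of `perm`; where the closing arc turns the final height
into a new initial height, it is preserved because `S` is invariant. -/
theorem strandLabel_boundaryEdge {S : Set (Fin X.n)} (hS : ∀ x, X.perm X.c x ∈ S ↔ x ∈ S)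
    {a b : Vertex} (h : X.BoundaryEdge a b) : X.strandLabel S a ↔ X.strandLabel S b := by
  cases h with
  | spoke_out hj => simp [strandLabel, perm]
  | @rim j k hj hk h =>
    have : X.transposition k ⟨j, hj⟩ = ⟨j, hj⟩ := by
      unfold transposition
      split_ifs with hk'
      · obtain ⟨h1, h2⟩ := h hk'
        exact Equiv.swap_apply_of_ne_of_ne (by simp [low, h1]) (by simp [high, h2])
      · rfl
    simp only [strandLabel, hj, exists_true_left]
    rw [perm_succ_inv_apply, this]
  | @spoke_in j hj =>
    -- Beyond the last crossing `transposition` has the default value `1`.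
    have : X.perm (X.c + 2) = X.perm X.c := by
      simp [perm, transposition]
    simp only [strandLabel, hj, exists_true_left, this]
    rw [← hS]
    simp
  | @low_rising k hk =>
    have := Nat.lt_of_succ_lt (X.i_lt k hk)
    simp [strandLabel, hk, low, this]
  | @rising_high k hk =>
    have h := X.i_lt k hk
    simp only [strandLabel, hk, h, exists_true_left]
    rw [perm_succ_inv_apply, X.transposition_of_lt hk]
    change _ ↔ (X.perm k)⁻¹ (Equiv.swap (low ⟨k, hk⟩) (high ⟨k, hk⟩) (high ⟨k, hk⟩)) ∈ S
    rw [Equiv.swap_apply_right]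
  | @high_falling k hk =>
    have := X.i_lt k hk
    simp [strandLabel, hk, high, this]
  | @falling_low k hk =>
    have h := Nat.lt_of_succ_lt (X.i_lt k hk)
    simp only [strandLabel, hk, h, exists_true_left]
    rw [perm_succ_inv_apply, X.transposition_of_lt hk]
    change _ ↔ (X.perm k)⁻¹ (Equiv.swap (low ⟨k, hk⟩) (high ⟨k, hk⟩) (low ⟨k, hk⟩)) ∈ S
    rw [Equiv.swap_apply_left]

/-- The strands of a connected closed braid form one orbit. -/
theorem mem_of_invariant (hX : IsPreconnected (boundary X.surface.complex)) {S : Set (Fin X.n)}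
    (hS : ∀ x, X.perm X.c x ∈ S ↔ x ∈ S) {x : Fin X.n} (hx : x ∈ S) (y : Fin X.n) : y ∈ S := by
  obtain ⟨_, h⟩ := X.label_eq_of_connected hX (X.strandLabel S)
    (fun a b h => X.strandLabel_boundaryEdge hS h) (.spoke_out x.2) (.spoke_out y.2) ⟨x.2, hx⟩
  exact h

theorem sameCycle_perm (hX : IsPreconnected (boundary X.surface.complex)) (x y : Fin X.n) :
    (X.perm X.c).SameCycle x y :=
  X.mem_of_invariant hX (S := {y | (X.perm X.c).SameCycle x y})
    (fun _ => Equiv.Perm.sameCycle_apply_right) (Equiv.Perm.SameCycle.refl _ _) y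

/-- For at least two strands the permutation is a cycle without fixed points, and its sign is
computed both from its length and from the number of transpositions. -/
theorem odd_sub_of_connected (hX : IsPreconnected (boundary X.surface.complex)) (hn : 0 < X.n) :
    Odd ((X.c : ℤ) - X.n) := by
  rcases Nat.lt_or_eq_of_le (Nat.succ_le_of_lt hn) with hn' | hn'
  · have hmove : ∀ x, X.perm X.c x ≠ x := by
      intro x hx
      have : Nontrivial (Fin X.n) := Fin.nontrivial_iff_two_le.2 hn'
      obtain ⟨y, hy⟩ := exists_ne x
      exact hy ((X.sameCycle_perm hX x y).eq_of_left hx).symm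
    have hcyc : (X.perm X.c).IsCycle := ⟨⟨0, hn⟩, hmove _, fun y _ => X.sameCycle_perm hX _ y⟩
    have hsupp : (X.perm X.c).support = Finset.univ := by
      ext x; simp [hmove x]
    have h := hcyc.sign
    rw [X.sign_perm le_rfl, hsupp, Finset.card_univ, Fintype.card_fin] at h
    have h' := congrArg (fun u : ℤˣ => (u : ℤ)) h
    push_cast at h'
    rcases Nat.even_or_odd X.c with hc | hc <;> rcases Nat.even_or_odd X.n with hm | hm <;>
      simp [hc.neg_one_pow, hm.neg_one_pow] at h'
    · exact Even.sub_odd (by exact_mod_cast hc) (by exact_mod_cast hm)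
    · exact Odd.sub_even (by exact_mod_cast hc) (by exact_mod_cast hm)
  -- On a single strand there are no letters, and the difference is `-1`.
  · have hc : X.c = 0 := by
      by_contra hc
      have := X.i_lt 0 (by omega)
      omega
    rw [hc, ← hn']
    exact ⟨-1, by norm_num⟩

/-- If no crossing exchanged the heights `j` and `j + 1`, the strands at heights `≤ j` would form a
proper nonempty invariant set. -/
theorem exists_crossing_of_connected (hX : IsPreconnected (boundary X.surface.complex)) {j : ℕ}
    (hj : j + 1 < X.n) : ∃ k < X.c, X.i k = j := by
  by_contra! h
  have hT : ∀ k (x : Fin X.n), (X.transposition k x : ℕ) ≤ j ↔ (x : ℕ) ≤ j := by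
    intro k x
    unfold transposition
    split_ifs with hk
    · have := h k hk
      rw [Equiv.swap_apply_def]
      split_ifs with h1 h2
      · rw [h1]; simp only [low, high]; omega
      · rw [h2]; simp only [low, high]; omega
      · rfl
    · rfl
  have hP : ∀ k (x : Fin X.n), (X.perm k x : ℕ) ≤ j ↔ (x : ℕ) ≤ j := by
    intro k
    induction k with
    | zero => intro x; rfl
    | succ k ih =>
      intro x
      rw [perm, Equiv.Perm.mul_apply, hT, ih]
  have := X.mem_of_invariant hX (S := {x | (x : ℕ) ≤ j}) (hP X.c)
    (x := ⟨0, by omega⟩) (Nat.zero_le _) ⟨j + 1, hj⟩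
  have : j + 1 ≤ j := this
  omega

/-- All `n - 1` generators occur. This bound is what makes the genus of the surface nonnegative. -/
theorem le_of_connected (hX : IsPreconnected (boundary X.surface.complex)) : X.n ≤ X.c + 1 := by
  choose! f hf hf' using fun j (hj : j + 1 < X.n) => X.exists_crossing_of_connected hX hj
  have : Fintype.card (Fin (X.n - 1)) ≤ Fintype.card (Fin X.c) :=
    Fintype.card_le_of_injective (fun j => (⟨f j, hf j (by omega)⟩ : Fin X.c)) fun j j' h => by
      have h : f j = f j' := congrArg Fin.val h
      ext
      rw [← hf' j (by omega), ← hf' j' (by omega), h]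
  simp only [Fintype.card_fin] at this
  omega

end Crossings

/-! ### The surface spanned by the closure of a braid word -/

/-- The crossings of a braid word. -/
def crossings {n : ℕ} (w : BraidWord n) : Crossings where
  n := n
  c := w.length
  i k := if h : k < w.length then (w[k].1 : ℕ) else 0
  ε k := if h : k < w.length then (if w[k].2 then 1 else -1) else 1
  i_lt k hk := by
    rw [dif_pos hk]
    omega
  ε_sq k := by
    split_ifs <;> norm_num

/-- The free rim edges of the disks, together with the outer spokes, are the straight strands and
the closing arcs; the two free sides of a band are the two strands of its crossing. -/
theorem boundary_surface {n : ℕ} (w : BraidWord n) :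
    boundary (crossings w).surface.complex = closedBraid w := by
  have hr : ∀ {j k : ℕ}, k ≤ w.length + 1 → (crossings w).pos (rim j k) = pt k 0 j :=
    fun h => (crossings w).pos_rim h
  have hlast : ∀ {j : ℕ}, (crossings w).pos (rim j (w.length + 2)) = pt (w.length + 1) (-2) j :=
    fun {j} => by
      rw [Crossings.pos]
      congr 1
      · exact (crossings w).rimX_last
      · exact (crossings w).rimY_last
  have hcl : closedBraid w = columns w ∪ ⋃ j : Fin n, closingArc w.length j := rfl
  have hi : ∀ {k} (h : k < w.length), (crossings w).i k = w[k].1 := fun h => dif_pos h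
  have hε : ∀ {k} (h : k < w.length), (crossings w).ε k = if w[k].2 then 1 else -1 :=
    fun h => dif_pos h
  have arc : ∀ {p : R3} {j : ℕ}, j < n → p ∈ closingArc w.length j → p ∈ closedBraid w :=
    fun hj hp => by
      rw [hcl]
      exact Or.inr (Set.mem_iUnion.2 ⟨⟨_, hj⟩, hp⟩)
  have col : ∀ {p : R3} {k : ℕ} (hk : k < w.length), p ∈ crossingColumn n k w[k] →
      p ∈ closedBraid w := fun hk hp => by
    rw [hcl]
    exact Or.inl (mem_columns.2 ⟨_, hk, hp⟩)
  ext p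
  rw [Crossings.mem_boundary_surface]
  constructor
  · rintro ⟨a, b, h, hp⟩
    cases h with
    | @spoke_out j hj =>
      rw [hr (Nat.zero_le _)] at hp
      refine arc hj (Or.inr ?_)
      simpa [Crossings.pos] using hp
    | @rim j k hj hk h =>
      change k < w.length + 2 at hk
      rw [hr (by omega)] at hp
      rcases lt_trichotomy k w.length with hk' | rfl | hk'
      · rw [hr (by omega)] at hp
        obtain ⟨h1, h2⟩ := h hk'
        rw [hi hk'] at h1 h2
        refine col hk' (Or.inl (Or.inl (Set.mem_biUnion (x := j) ⟨hj, h1, h2⟩ ?_)))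
        simpa using hp
      · rw [hr (by omega)] at hp
        refine arc hj (Or.inl (Or.inl (Or.inl ?_)))
        simpa using hp
      · obtain rfl : k = w.length + 1 := by omega
        rw [hlast] at hp
        refine arc hj (Or.inl (Or.inl (Or.inr ?_)))
        simpa using hp
    | @spoke_in j hj =>
      change p ∈ segment ℝ ((crossings w).pos (Vertex.rim j (w.length + 2))) _ at hp
      rw [hlast] at hp
      exact arc hj (Or.inl (Or.inr hp))
    | @low_rising k hk =>
      change k < w.length at hk
      rw [hr (by omega)] at hp
      refine col hk (Or.inl (Or.inr (Or.inl ?_)))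
      simpa only [Crossings.pos, hi hk, hε hk] using hp
    | @rising_high k hk =>
      change k < w.length at hk
      rw [hr (by omega)] at hp
      refine col hk (Or.inl (Or.inr (Or.inr ?_)))
      simpa only [Crossings.pos, hi hk, hε hk, Nat.cast_add, Nat.cast_one] using hp
    | @high_falling k hk =>
      change k < w.length at hk
      rw [hr (by omega)] at hp
      refine col hk (Or.inr (Or.inl ?_))
      simpa only [Crossings.pos, hi hk, hε hk, Nat.cast_add, Nat.cast_one] using hp
    | @falling_low k hk =>
      change k < w.length at hk
      rw [hr (by omega)] at hp
      refine col hk (Or.inr (Or.inr ?_))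
      simpa only [Crossings.pos, hi hk, hε hk, Nat.cast_add, Nat.cast_one] using hp
  · rw [hcl]
    rintro (hp | hp)
    · obtain ⟨k, hk, hp⟩ := mem_columns.1 hp
      have hk' : k < (crossings w).c := hk
      rcases hp with (hp | hp | hp) | hp | hp
      · simp only [Set.mem_iUnion, exists_prop] at hp
        obtain ⟨j, ⟨hj, h1, h2⟩, hp⟩ := hp
        refine ⟨_, _, .rim (j := j) (k := k) hj (Nat.lt_add_right 2 hk')
          (fun _ => by rw [hi hk]; exact ⟨h1, h2⟩), ?_⟩
        rw [hr (by omega), hr (by omega)]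
        simpa using hp
      · refine ⟨_, _, .low_rising hk', ?_⟩
        rw [hr (by omega)]
        simpa only [Crossings.pos, hi hk, hε hk] using hp
      · refine ⟨_, _, .rising_high hk', ?_⟩
        rw [hr (by omega)]
        simpa only [Crossings.pos, hi hk, hε hk, Nat.cast_add, Nat.cast_one] using hp
      · refine ⟨_, _, .high_falling hk', ?_⟩
        rw [hr (by omega)]
        simpa only [Crossings.pos, hi hk, hε hk, Nat.cast_add, Nat.cast_one] using hp
      · refine ⟨_, _, .falling_low hk', ?_⟩
        rw [hr (by omega)]
        simpa only [Crossings.pos, hi hk, hε hk, Nat.cast_add, Nat.cast_one] using hp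
    · obtain ⟨j, hp⟩ := Set.mem_iUnion.1 hp
      have hc : (crossings w).c = w.length := rfl
      rcases hp with ((hp | hp) | hp) | hp
      · refine ⟨_, _, .rim (j := j) (k := w.length) j.2 (by omega) (fun h => by omega), ?_⟩
        rw [hr (by omega), hr (by omega)]
        simpa using hp
      · refine ⟨_, _, .rim (j := j) (k := w.length + 1) j.2 (by omega) (fun h => by omega), ?_⟩
        rw [hr (by omega), hlast]
        simpa using hp
      · refine ⟨_, _, .spoke_in (j := j) j.2, ?_⟩
        change p ∈ segment ℝ ((crossings w).pos (Vertex.rim j (w.length + 2))) _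
        rw [hlast]
        exact hp
      · refine ⟨_, _, .spoke_out (j := j) j.2, ?_⟩
        rw [hr (by omega)]
        simpa [Crossings.pos] using hp

/-! ### Braids representing a knot -/

theorem IsSimpleClosedPolygon.isConnected {P : Set R3} (h : IsSimpleClosedPolygon P) :
    IsConnected P := by
  obtain ⟨m, hm, v, -, -, rfl⟩ := h
  have : NeZero m := ⟨by omega⟩
  -- Going around the polygon with indices in `ℕ` presents it as a chain of segments, each meeting
  -- the next.
  have e : (⋃ i : ZMod m, segment ℝ (v i) (v (i + 1))) =
      ⋃ k : ℕ, segment ℝ (v k) (v (k + 1)) := by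
    ext p
    simp only [Set.mem_iUnion]
    constructor
    · rintro ⟨i, hp⟩
      exact ⟨i.val, by rwa [ZMod.natCast_zmod_val]⟩
    · rintro ⟨k, hp⟩
      exact ⟨k, hp⟩
  rw [e]
  refine IsConnected.iUnion_of_chain (fun k => ⟨⟨_, left_mem_segment ℝ _ _⟩,
    (convex_segment _ _).isPreconnected⟩) fun k => ⟨v (k + 1), right_mem_segment ℝ _ _, ?_⟩
  rw [Nat.succ_eq_succ]
  push_cast
  exact left_mem_segment ℝ _ _

theorem IsKnot.isConnected {K : Set R3} (h : IsKnot K) : IsConnected K := by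
  obtain ⟨e, he⟩ := h
  have := he.isConnected.image e.symm e.symm.continuous.continuousOn
  rwa [← e.coe_toEquiv, ← e.coe_symm_toEquiv, e.toEquiv.symm_image_image] at this

section represents

variable {n : ℕ} {w : BraidWord n} {K : Set R3}

theorem Represents.isConnected (hK : IsKnot K) (h : Represents w K) :
    IsConnected (closedBraid w) := by
  obtain ⟨F, -, -, hF⟩ := AmbientIsotopic.symm h
  rw [← hF]
  exact hK.isConnected.image _ (F 1).continuous.continuousOn

/-- The closure of a word on no strands is empty. -/
theorem Represents.pos (hK : IsKnot K) (h : Represents w K) : 0 < n := by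
  by_contra hn
  obtain rfl : n = 0 := by omega
  obtain ⟨p, hp⟩ := (h.isConnected hK).nonempty
  rw [← boundary_surface, Crossings.mem_boundary_surface] at hp
  obtain ⟨a, b, hab, -⟩ := hp
  cases hab with
  | spoke_out hj => exact Nat.not_lt_zero _ hj
  | rim hj => exact Nat.not_lt_zero _ hj
  | spoke_in hj => exact Nat.not_lt_zero _ hj
  | low_rising hk => exact Nat.not_lt_zero _ ((crossings w).i_lt _ hk)
  | rising_high hk => exact Nat.not_lt_zero _ ((crossings w).i_lt _ hk)
  | high_falling hk => exact Nat.not_lt_zero _ ((crossings w).i_lt _ hk)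
  | falling_low hk => exact Nat.not_lt_zero _ ((crossings w).i_lt _ hk)

theorem Represents.isPreconnected_boundary (hK : IsKnot K) (h : Represents w K) :
    IsPreconnected (boundary (crossings w).surface.complex) := by
  rw [boundary_surface]
  exact (h.isConnected hK).isPreconnected

theorem Represents.odd (hK : IsKnot K) (h : Represents w K) : Odd ((w.length : ℤ) - n) :=
  (crossings w).odd_sub_of_connected (h.isPreconnected_boundary hK) (h.pos hK)

/-- The surface of a braid word with `c` letters on `n` strands has Euler characteristic
`n - c`. -/
theorem Represents.genus_le (hK : IsKnot K) (h : Represents w K) :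
    2 * (genus K : ℤ) - 1 ≤ (w.length : ℤ) - n := by
  have hX := h.isPreconnected_boundary hK
  have hpos := h.pos hK
  obtain ⟨r, hr⟩ := h.odd hK
  have hle : n ≤ w.length + 1 := (crossings w).le_of_connected hX
  -- The genus read off from the Euler characteristic `n - c`: integral by parity, nonnegative by `n
  -- ≤ c + 1`.
  obtain ⟨g, hg⟩ : ∃ g : ℕ, (w.length : ℤ) - n = 2 * g - 1 :=
    ⟨(r + 1).toNat, by rw [Int.toNat_of_nonneg (by omega)]; omega⟩
  have hgen : genus K ≤ g := by
    refine Nat.sInf_le ?_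
    obtain ⟨F, -, -, hF⟩ := h
    -- The end of the isotopy carries the surface to one that spans `K`, and its inverse is the
    -- homeomorphism that makes it polyhedral.
    refine ⟨F 1 '' (crossings w).surface.complex.space, (F 1).symm,
      (crossings w).surface.complex, (crossings w).isSurface ?_ ?_, ?_, ?_, ?_⟩
    · exact hpos
    · exact fun j hj => (crossings w).exists_crossing_of_connected hX hj
    · exact (F 1).toEquiv.symm_image_image _
    · rw [← hF, boundary_surface]
      exact (F 1).toEquiv.symm_image_image _
    · rw [Crossings.eulerChar_surface]
      change (n : ℤ) - (w.length : ℤ) = _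
      omega
  omega

theorem Represents.exists_stabilization (hK : IsKnot K) (h : Represents w K) :
    ∃ w' : BraidWord (n + 1), w'.length = w.length + 1 ∧ Represents w' K := by
  obtain ⟨m, rfl⟩ : ∃ m, n = m + 1 := ⟨n - 1, by have := h.pos hK; omega⟩
  exact ⟨stabilize w, length_stabilize w, (ambientIsotopic_stabilize w).symm.trans h⟩

end represents

/-! ### Minimal lengths under stabilization -/

/-- A finite bound on the infimum yields a word on some `m ≤ n` strands, which is stabilized `n - m`
times. The value `⊤` for an empty index set is excluded by the bound. -/
theorem exists_represents_of_braidIndex_le {K : Set R3} (hK : IsKnot K) {n : ℕ}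
    (hn : braidIndex K ≤ n) : ∃ w : BraidWord n, Represents w K := by
  obtain ⟨m, hm, w, hw⟩ : ∃ m ≤ n, ∃ w : BraidWord m, Represents w K := by
    by_contra! h
    have h1 : ((n + 1 : ℕ) : ℕ∞) ≤ braidIndex K := by
      refine le_iInf₂ fun m hm => ?_
      obtain ⟨w, hw⟩ := hm
      by_contra hlt
      have : m ≤ n := by
        have := not_le.1 hlt
        have : m < n + 1 := by exact_mod_cast this
        omega
      exact h m this w hw
    have h2 : ((n + 1 : ℕ) : ℕ∞) ≤ n := h1.trans hn
    have : n + 1 ≤ n := by exact_mod_cast h2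
    omega
  clear hn
  induction n, hm using Nat.le_induction with
  | base => exact ⟨w, hw⟩
  | succ k hk ih =>
    obtain ⟨w', hw'⟩ := ih
    obtain ⟨w'', -, hw''⟩ := hw'.exists_stabilization hK
    exact ⟨w'', hw''⟩

theorem isLeast_b {K : Set R3} (hK : IsKnot K) {n : ℕ} (hn : braidIndex K ≤ n) :
    IsLeast (lengthSet n K) (b n K) := by
  obtain ⟨w, hw⟩ := exists_represents_of_braidIndex_le hK hn
  exact ⟨Nat.sInf_mem ⟨_, w, rfl, hw⟩, fun _ hc => Nat.sInf_le hc⟩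

theorem b'_succ_le {K : Set R3} (hK : IsKnot K) {n : ℕ} (hn : braidIndex K ≤ n) :
    b' (n + 1) K ≤ b' n K := by
  obtain ⟨w, hw, h⟩ := (isLeast_b hK hn).1
  obtain ⟨w', hw', h'⟩ := h.exists_stabilization hK
  have : b (n + 1) K ≤ w'.length := Nat.sInf_le ⟨w', rfl, h'⟩
  unfold b'
  omega

end BraidLength

end

/-! ### The main theorem -/

theorem theorem1p4 (K : Set BraidLength.R3) (hK : BraidLength.IsKnot K) :
    (∀ n : ℕ, BraidLength.braidIndex K ≤ n →
      IsLeast (BraidLength.lengthSet n K) (BraidLength.b n K)) ∧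
    AntitoneOn (fun n : ℕ => BraidLength.b' n K) {n : ℕ | BraidLength.braidIndex K ≤ n} ∧
    (∀ n : ℕ, BraidLength.braidIndex K ≤ n → Odd (BraidLength.b' n K)) ∧
    (∀ n : ℕ, BraidLength.braidIndex K ≤ n →
      2 * (BraidLength.genus K : ℤ) - 1 ≤ BraidLength.b' n K) := by
  refine ⟨fun n hn => BraidLength.isLeast_b hK hn, ?_, fun n hn => ?_, fun n hn => ?_⟩
  · intro n hn m _ hnm
    change BraidLength.b' m K ≤ BraidLength.b' n K
    induction m, hnm using Nat.le_induction with
    | base => exact le_rfl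
    | succ k hk ih =>
      have hk' : BraidLength.braidIndex K ≤ k :=
        le_trans (show BraidLength.braidIndex K ≤ n from hn) (by exact_mod_cast hk)
      exact (BraidLength.b'_succ_le hK hk').trans (ih hk')
  · obtain ⟨w, hw, h⟩ := (BraidLength.isLeast_b hK hn).1
    rw [BraidLength.b', ← hw]
    exact h.odd hK
  · obtain ⟨w, hw, h⟩ := (BraidLength.isLeast_b hK hn).1
    rw [BraidLength.b', ← hw]
    exact h.genus_le hK
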